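/- **Machine models.** The word RAM has registers and a random access memory holding words of $w$ bits, with unit-cost arithmetic modulo $2^w$ ($+,-,\cdot$, integer division and remainder), bitwise operations, shifts, comparisons and indirect addressing. The real RAM has, in addition, registers and a random access memory holding real numbers, with unit-cost $+,-,\cdot,/,\sqrt{\ }$, comparisons and conversion of words to reals. Running time is the number of steps. Words have $\Theta(\log)$ of the input size many bits; precisely, an algorithm has to work for all word sizes $w\ge\kappa\log_2 s$, where the constant $\kappa$ is chosen by the algorithm, and where $s=2^N(N+M+2)$ for a CNF formula with $N$ variables and $M$ clauses (so that exponentially large memory can be addressed), $s=n+U+2$ for curves with at most $n$ vertices each and natural-number coordinates at most $U$ on the word RAM, and $s=n+2$ for curves with at most $n$ vertices each on the real RAM. **Hypothesis $\mathsf{SETH'}$** (on a model): for no $\delta>0$ is there a program that decides the satisfiability of CNF formulas with $N$ variables and $M$ clauses, of unbounded width, in time $O((2-\delta)^N (N+M+1)^c)$ for some constant $c$. **Fréchet distances.** Let $P$, $Q$ be polygonal curves in the Euclidean plane with $k$ and $m$ vertices, viewed as functions $P\colon[1,k]\to\mathbb R^2$, $Q\colon[1,m]\to\mathbb R^2$ that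 take the vertices at the integers and are affine in between. The continuous Fréchet distance is $\inf_{\phi,\psi}\max_{t\in[0,1]}\|P(\phi(t))-Q(\psi(t))\|$ over all continuous non-decreasing $\phi$, $\psi$ from $[0,1]$ onto $[1,k]$ and onto $[1,m]$; the discrete Fréchet distance is the same infimum over all non-decreasing $\phi$, $\psi$ from $[0,1]$ onto $\{1,\dots,k\}$ and onto $\{1,\dots,m\}$. **Theorem.** Consider the word RAM or the real RAM, and suppose that $\mathsf{SETH'}$ holds on this model. Then for no $\delta>0$ is there an algorithm on this model that computes the continuous Fréchet distance of any two polygonal curves in the plane in time $O(n^{2-\delta})$, where $n$ is the larger one of their numbers of vertices; and for no $\delta>0$ is there such an algorithm for the discrete Fréchet distance. Here, on the real RAM, the coordinates are arbitrary reals and the distance is returned as a real; on the word RAM, the coordinates are natural numbers that are given as words (so algorithms that only handle such coordinates are excluded, too) and the square of the distance, which is rational, is returned exactly as a fraction of two words. -/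

import Mathlib

/-! ## Polygonal curves and the two Fréchet distances -/

/-- The Euclidean plane. -/
abbrev Plane : Type := EuclideanSpace ℝ (Fin 2)

/-- A polygonal curve, given by its (nonempty, finite) sequence of vertices. -/
structure Curve (α : Type) where
  size : ℕ
  size_pos : 0 < size
  vertex : Fin size → α

namespace Curve

/-- Apply a map to every vertex. -/
def map {α β : Type} (f : α → β) (P : Curve α) : Curve β :=
  ⟨P.size, P.size_pos, fun i => f (P.vertex i)⟩

/-- The `i`-th vertex (counted from `0`); indices beyond the last vertex give the last vertex. -/
def vertexAt {α : Type} (P : Curve α) (i : ℕ) : α :=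
  P.vertex ⟨min i (P.size - 1), by have := P.size_pos; omega⟩

/-- The curve as a function: for `i + 1 < size` and `x ∈ [0, 1]`, the point at `i + x` is
`(1 - x) • pᵢ + x • pᵢ₊₁`. Only the values on `[0, size - 1]` matter. -/
noncomputable def point (P : Curve Plane) (t : ℝ) : Plane :=
  AffineMap.lineMap (P.vertexAt ⌊t⌋₊) (P.vertexAt (⌊t⌋₊ + 1)) (t - (⌊t⌋₊ : ℝ))

end Curve

/-- The continuous, non-decreasing maps from `[0, 1]` onto `[0, n - 1]`, the parameter interval of
a curve with `n` vertices. -/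
def contReparam (n : ℕ) : Set (unitInterval → ℝ) :=
  {f | Continuous f ∧ Monotone f ∧ Set.range f = Set.Icc (0 : ℝ) ((n : ℝ) - 1)}

/-- The non-decreasing maps from `[0, 1]` onto the vertex indices of a curve with `n` vertices. -/
def discReparam (n : ℕ) : Set (unitInterval → Fin n) :=
  {f | Monotone f ∧ Function.Surjective f}

/-- The continuous Fréchet distance: the infimum of the widths of the continuous traversals. -/
noncomputable def frechetDist (P Q : Curve Plane) : ℝ :=
  sInf {D : ℝ | ∃ f ∈ contReparam P.size, ∃ g ∈ contReparam Q.size,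
    ∀ t : unitInterval, dist (P.point (f t)) (Q.point (g t)) ≤ D}

/-- The discrete Fréchet distance: the infimum of the widths of the discrete traversals. -/
noncomputable def discreteFrechetDist (P Q : Curve Plane) : ℝ :=
  sInf {D : ℝ | ∃ f ∈ discReparam P.size, ∃ g ∈ discReparam Q.size,
    ∀ t : unitInterval, dist (P.vertex (f t)) (Q.vertex (g t)) ≤ D}

/-! ## Random access machines with words and reals

A machine has registers and a memory of words of `w` bits (natural numbers, arithmetic modulo
`2 ^ w`), and registers and a memory of real numbers; both memories are addressed by words.
A program names finitely many registers. Each elementary instruction and each test costs one step.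
There is no conversion from reals to words except through comparisons. -/

/-- Binary operations on words. -/
inductive WordOp
  | add | sub | mul | div | mod | and | or | xor | shl | shr

/-- The result of an operation on words of `w` bits (division by zero gives zero). -/
def WordOp.eval (w : ℕ) (o : WordOp) (a b : ℕ) : ℕ :=
  (match o with
    | .add => a + b
    | .sub => a + 2 ^ w - b
    | .mul => a * b
    | .div => a / b
    | .mod => a % b
    | .and => a &&& b
    | .or => a ||| b
    | .xor => a ^^^ b
    | .shl => a * 2 ^ b
    | .shr => a / 2 ^ b) % 2 ^ w

/-- Binary operations on reals. -/
inductive RealOp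
  | add | sub | mul | div

/-- The result of an operation on reals (division by zero gives zero). -/
noncomputable def RealOp.eval : RealOp → ℝ → ℝ → ℝ
  | .add, a, b => a + b
  | .sub, a, b => a - b
  | .mul, a, b => a * b
  | .div, a, b => a / b

/-- Elementary instructions. Arguments are register numbers, except the literal of `const`;
the first argument is the target (for `store` and `realStore`: the register with the address). -/
inductive Instr
  /-- word register := literal -/
  | const (r k : ℕ)
  /-- word register := operation on two word registers -/
  | op (o : WordOp) (r a b : ℕ)
  /-- word register `r` := word memory at the address in word register `a` -/
  | load (r a : ℕ)
  /-- word memory at the address in word register `a` := word register `r` -/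
  | store (a r : ℕ)
  /-- real register `r` := word register `a` -/
  | ofWord (r a : ℕ)
  /-- real register := operation on two real registers -/
  | realOp (o : RealOp) (r a b : ℕ)
  /-- real register `r` := square root of real register `a` -/
  | sqrt (r a : ℕ)
  /-- real register `r` := real memory at the address in word register `a` -/
  | realLoad (r a : ℕ)
  /-- real memory at the address in word register `a` := real register `r` -/
  | realStore (a r : ℕ)

/-- Tests: comparison of two word registers, or of two real registers. -/
inductive Test
  | lt (a b : ℕ)
  | eq (a b : ℕ)
  | realLt (a b : ℕ)
  | realEq (a b : ℕ)

/-- Programs. -/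
inductive Prog
  | skip
  | instr (i : Instr)
  | seq (p q : Prog)
  | ite (c : Test) (p q : Prog)
  | while (c : Test) (p : Prog)

/-- Configurations. -/
structure State where
  reg : ℕ → ℕ
  mem : ℕ → ℕ
  realReg : ℕ → ℝ
  realMem : ℕ → ℝ

/-- The initial configuration for an input of words and reals: the two lists stand at the beginning
of the two memories, and everything else is zero. -/
noncomputable def State.init (words : List ℕ) (reals : List ℝ) : State where
  reg := fun _ => 0
  mem := fun k => words.getD k 0
  realReg := fun _ => 0
  realMem := fun k => reals.getD k 0

/-- The effect of an elementary instruction with words of `w` bits. -/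
noncomputable def Instr.exec (w : ℕ) (i : Instr) (s : State) : State :=
  match i with
  | .const r k => { s with reg := Function.update s.reg r (k % 2 ^ w) }
  | .op o r a b => { s with reg := Function.update s.reg r (o.eval w (s.reg a) (s.reg b)) }
  | .load r a => { s with reg := Function.update s.reg r (s.mem (s.reg a)) }
  | .store a r => { s with mem := Function.update s.mem (s.reg a) (s.reg r) }
  | .ofWord r a => { s with realReg := Function.update s.realReg r (s.reg a : ℝ) }
  | .realOp o r a b =>
      { s with realReg := Function.update s.realReg r (o.eval (s.realReg a) (s.realReg b)) }
  | .sqrt r a => { s with realReg := Function.update s.realReg r (Real.sqrt (s.realReg a)) }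
  | .realLoad r a => { s with realReg := Function.update s.realReg r (s.realMem (s.reg a)) }
  | .realStore a r => { s with realMem := Function.update s.realMem (s.reg a) (s.realReg r) }

/-- Whether a test succeeds. -/
def Test.holds (s : State) : Test → Prop
  | .lt a b => s.reg a < s.reg b
  | .eq a b => s.reg a = s.reg b
  | .realLt a b => s.realReg a < s.realReg b
  | .realEq a b => s.realReg a = s.realReg b

/-- `Exec w p s t s'`: with words of `w` bits, the program `p` started in `s` halts in `s'` after
exactly `t` steps. -/
inductive Exec (w : ℕ) : Prog → State → ℕ → State → Prop
  | skip (s : State) : Exec w .skip s 0 s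
  | instr (i : Instr) (s : State) : Exec w (.instr i) s 1 (i.exec w s)
  | seq {p q : Prog} {s s' s'' : State} {t t' : ℕ} :
      Exec w p s t s' → Exec w q s' t' s'' → Exec w (.seq p q) s (t + t') s''
  | ite_true {c : Test} {p q : Prog} {s s' : State} {t : ℕ} :
      c.holds s → Exec w p s t s' → Exec w (.ite c p q) s (t + 1) s'
  | ite_false {c : Test} {p q : Prog} {s s' : State} {t : ℕ} :
      ¬ c.holds s → Exec w q s t s' → Exec w (.ite c p q) s (t + 1) s'
  | while_true {c : Test} {p : Prog} {s s' s'' : State} {t t' : ℕ} :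
      c.holds s → Exec w p s t s' → Exec w (.while c p) s' t' s'' →
      Exec w (.while c p) s (t + t' + 1) s''
  | while_false {c : Test} {p : Prog} {s : State} :
      ¬ c.holds s → Exec w (.while c p) s 1 s

/-- The two machine models: the word RAM, and the real RAM (which has the words as well). -/
inductive Model
  | word
  | real

/-- The instructions of the word RAM. -/
def Instr.IsWord : Instr → Prop
  | .const _ _ | .op _ _ _ _ | .load _ _ | .store _ _ => True
  | .ofWord _ _ | .realOp _ _ _ _ | .sqrt _ _ | .realLoad _ _ | .realStore _ _ => False

/-- The tests of the word RAM. -/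
def Test.IsWord : Test → Prop
  | .lt _ _ | .eq _ _ => True
  | .realLt _ _ | .realEq _ _ => False

/-- The programs of the word RAM: no instruction and no test concerns reals. -/
def Prog.IsWord : Prog → Prop
  | .skip => True
  | .instr i => i.IsWord
  | .seq p q => p.IsWord ∧ q.IsWord
  | .ite c p q => c.IsWord ∧ p.IsWord ∧ q.IsWord
  | .while c p => c.IsWord ∧ p.IsWord

/-- The programs of each model. -/
def Prog.IsFor (p : Prog) : Model → Prop
  | .word => p.IsWord
  | .real => True

/-! ## CNF-SAT and the hypothesis SETH' -/

/-- A CNF formula with `N` variables and `M` clauses of unbounded width: each clause is given by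
the set of its positive and the set of its negated variables. -/
abbrev CNF (N M : ℕ) : Type := Fin M → Finset (Fin N) × Finset (Fin N)

/-- Satisfiability of a formula. -/
def CNF.Satisfiable {N M : ℕ} (φ : CNF N M) : Prop :=
  ∃ a : Fin N → Bool, ∀ i : Fin M,
    (∃ j ∈ (φ i).1, a j = true) ∨ (∃ j ∈ (φ i).2, a j = false)

/-- The input words for a formula: `N`, `M`, and then, clause by clause and variable by variable,
two bits that say whether the variable occurs positively and whether it occurs negated. -/
def CNF.encode {N M : ℕ} (φ : CNF N M) : List ℕ :=
  [N, M] ++ (List.finRange M).flatMap fun i => (List.finRange N).flatMap fun j =>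
    [if j ∈ (φ i).1 then 1 else 0, if j ∈ (φ i).2 then 1 else 0]

/-- `p` decides CNF-SAT on the model `μ` in at most `T N M` steps. Words have a constant factor
times `N + log M` bits (so that exponentially large memory can be addressed): the program has to
work for every word size above a bound of this form. The answer, `1` or `0`, is left in word
register `0`. -/
def IsSatAlgorithm (μ : Model) (p : Prog) (T : ℕ → ℕ → ℝ) : Prop :=
  p.IsFor μ ∧ ∃ κ : ℕ, ∀ (N M : ℕ) (φ : CNF N M) (w : ℕ),
    (2 ^ N * (N + M + 2)) ^ κ ≤ 2 ^ w →
      ∃ (t : ℕ) (s : State), Exec w p (State.init φ.encode []) t s ∧ (t : ℝ) ≤ T N M ∧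
        (φ.Satisfiable → s.reg 0 = 1) ∧ (¬ φ.Satisfiable → s.reg 0 = 0)

/-- SETH' on the model `μ`: for no `δ > 0` can CNF-SAT be decided in time `(2 - δ) ^ N` up to
factors that are polynomial in `N` and `M`. -/
def SETHPrime (μ : Model) : Prop :=
  ¬ ∃ δ : ℝ, 0 < δ ∧ ∃ (p : Prog) (C : ℝ) (c : ℕ),
    IsSatAlgorithm μ p fun N M => C * (2 - δ) ^ N * ((N : ℝ) + M + 1) ^ c

/-! ## Algorithms for the Fréchet distances -/

/-- The sequence of all coordinates of a curve, vertex by vertex. -/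
def Curve.coords {α : Type} (P : Curve (α × α)) : List α :=
  (List.ofFn P.vertex).flatMap fun v => [v.1, v.2]

/-- The curve in the plane with given coordinates. -/
noncomputable def Curve.ofReal (P : Curve (ℝ × ℝ)) : Curve Plane :=
  P.map fun v => !₂[v.1, v.2]

/-- The curve in the plane with given natural numbers as coordinates. -/
noncomputable def Curve.ofNat (P : Curve (ℕ × ℕ)) : Curve Plane :=
  P.map fun v => !₂[(v.1 : ℝ), (v.2 : ℝ)]

/-- `p` computes the distance `d` of any two curves on the word RAM in at most `T n` steps, where
`n` is the larger one of the two numbers of vertices. The coordinates are words, at most `U`, and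
words have a constant factor times `log (n + U)` bits. The square of the distance, which is
rational, is returned exactly, as a fraction of the words in the registers `0` and `1`. -/
def IsWordDistAlgorithm (d : Curve Plane → Curve Plane → ℝ) (p : Prog) (T : ℕ → ℝ) : Prop :=
  p.IsFor .word ∧ ∃ κ : ℕ, ∀ (P Q : Curve (ℕ × ℕ)) (U w : ℕ),
    (∀ x ∈ P.coords ++ Q.coords, x ≤ U) →
    (max P.size Q.size + U + 2) ^ κ ≤ 2 ^ w →
      ∃ (t : ℕ) (s : State),
        Exec w p (State.init ([P.size, Q.size] ++ P.coords ++ Q.coords) []) t s ∧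
        (t : ℝ) ≤ T (max P.size Q.size) ∧
        s.reg 1 ≠ 0 ∧ (s.reg 0 : ℝ) / (s.reg 1 : ℝ) = d P.ofNat Q.ofNat ^ 2

/-- `p` computes the distance `d` of any two curves on the real RAM in at most `T n` steps, where
`n` is the larger one of the two numbers of vertices. The coordinates are reals, words have a
constant factor times `log n` bits, and the distance is returned in real register `0`. -/
def IsRealDistAlgorithm (d : Curve Plane → Curve Plane → ℝ) (p : Prog) (T : ℕ → ℝ) : Prop :=
  p.IsFor .real ∧ ∃ κ : ℕ, ∀ (P Q : Curve (ℝ × ℝ)) (w : ℕ),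
    (max P.size Q.size + 2) ^ κ ≤ 2 ^ w →
      ∃ (t : ℕ) (s : State),
        Exec w p (State.init [P.size, Q.size] (P.coords ++ Q.coords)) t s ∧
        (t : ℝ) ≤ T (max P.size Q.size) ∧
        s.realReg 0 = d P.ofReal Q.ofReal

/-- `p` is an algorithm for the distance `d` of planar polygonal curves on the model `μ` with
running time at most `T n` for curves with at most `n` vertices each. -/
def IsDistAlgorithm : Model → (Curve Plane → Curve Plane → ℝ) → Prog → (ℕ → ℝ) → Prop
  | .word => IsWordDistAlgorithm
  | .real => IsRealDistAlgorithm

/-! The reduction splits the variables into two halves with `L = 2 ^ ((N + 1) / 2)` partial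
assignments each. A formula is satisfiable iff some assignment `k` of the first half and some
assignment `l` of the second half are compatible, meaning that each clause is satisfied by one of
the two (`CNF.satisfiable_iff`). Two curves with `O(L * (M + 1))` vertices encode this: each partial
assignment is a row of `M` clause vertices, which zigzag between the abscissas 2 and 30. On the left
curve they have height 29 (satisfied) or 31, on the right curve 11 or 9. Opposite vertices of a
clause are therefore at distance at most 20, unless both assignments fail, and then at distance 22.

If rows `k` and `l` are compatible, a traversal of width 20 exists. The right curve waits at (16,
20), which is near the whole left curve, until the left one reaches the start (12, 16) of row `k`.
From there the left curve sees every right vertex except (32, 0), and waits for row `l`. The two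
rows are run through in lockstep. Then the left curve waits at (20, 16), which sees everything
except (0, 0), until the right one is back at (16, 20), where the right one waits until the end
(`exists_walks_of_compatible`).

Conversely, let a traversal have squared width below 480. When the right curve is at (0, 0), the
left one is close to some (12, 16); when the right curve is at (32, 0), the left one is close to
some (20, 16). In between the left curve traverses the clause vertices of a full row `k`, at height
at least 29. The right curve, which is between (0, 0) and (32, 0), cannot then be at height 0, hence
stays inside one row `l`. The zigzag forces clause vertex `i` to be matched with a clause vertex `j
i` of the same parity; monotonicity gives `j (i + 1) = j i + 1`, and as both rows have `M` clauses,
`j i = i`. Each clause is thus satisfied by row `k` or by row `l` (`exists_compatible_rows`).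

So the squared distance is at most 400 or at least 480 (`Separates`), for both Fréchet distances.
The remaining work is on machines: a program writes the two curves in time `2 ^ (N / 2)` up to
polynomial factors, restores exactly the initial state that a distance algorithm expects, runs that
algorithm and compares the squared distance with 440. A running time `O(n ^ (2 - δ))` becomes `2 ^
(N * (1 - δ / 2))` up to polynomial factors, against `SETHPrime`. -/

/-! ## Traversals along lattice paths bound both distances from above -/

/-- A number sequence that starts at `0`, ends at time `T` in `n`, and goes up by at most one
in each step. -/
structure IsUnitWalk (f : ℕ → ℕ) (T n : ℕ) : Prop where
  start : f 0 = 0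
  finish : f T = n
  le_succ : ∀ i, f i ≤ f (i + 1)
  succ_le : ∀ i, f (i + 1) ≤ f i + 1

namespace IsUnitWalk

variable {f : ℕ → ℕ} {T n : ℕ}

theorem monotone (h : IsUnitWalk f T n) : Monotone f := monotone_nat_of_le_succ h.le_succ

theorem exists_eq (h : IsUnitWalk f T n) {j : ℕ} (hj : j ≤ n) : ∃ i ≤ T, f i = j := by
  have key : ∀ t, j ≤ f t → ∃ i ≤ t, f i = j := by
    intro t
    induction t with
    | zero => intro ht; exact ⟨0, le_rfl, by have := h.start; omega⟩
    | succ t ih =>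
      intro ht
      by_cases hjt : j ≤ f t
      · obtain ⟨i, hi, hij⟩ := ih hjt
        exact ⟨i, by omega, hij⟩
      · exact ⟨t + 1, le_rfl, by have := h.succ_le t; omega⟩
  exact key T (h.finish ▸ hj)

end IsUnitWalk

/-- The piecewise affine interpolation of a sequence between the times `0` and `T`. -/
noncomputable def walkInterp (f : ℕ → ℕ) (T : ℕ) (x : ℝ) : ℝ :=
  (f 0 : ℝ) + ∑ i ∈ Finset.range T, ((f (i + 1) : ℝ) - f i) * max 0 (min 1 (x - i))

theorem walkInterp_continuous (f : ℕ → ℕ) (T : ℕ) : Continuous (walkInterp f T) := by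
  unfold walkInterp
  fun_prop

theorem walkInterp_monotone {f : ℕ → ℕ} (T : ℕ) (hf : ∀ i, f i ≤ f (i + 1)) :
    Monotone (walkInterp f T) := by
  intro x y hxy
  unfold walkInterp
  gcongr with i _
  have : (f i : ℝ) ≤ f (i + 1) := by exact_mod_cast hf i
  linarith

/-- At time `k + u` the ramps with index below `k` are complete, ramp `k` is at height `u` and the
later ones have not started, so the sum telescopes. -/
theorem walkInterp_add (f : ℕ → ℕ) {T k : ℕ} {u : ℝ} (hk : k < T) (h0 : 0 ≤ u) (h1 : u ≤ 1) :
    walkInterp f T (k + u) = f k + ((f (k + 1) : ℝ) - f k) * u := by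
  have hsum : ∀ S, k < S → ∑ i ∈ Finset.range S,
      ((f (i + 1) : ℝ) - f i) * max 0 (min 1 ((k : ℝ) + u - i)) =
      ((f k : ℝ) - f 0) + ((f (k + 1) : ℝ) - f k) * u := by
    intro S hS
    induction S, hS using Nat.le_induction with
    | base =>
      rw [Finset.sum_range_succ]
      have h2 : ∑ i ∈ Finset.range k, ((f (i + 1) : ℝ) - f i) * max 0 (min 1 ((k : ℝ) + u - i)) =
          ∑ i ∈ Finset.range k, ((f (i + 1) : ℝ) - f i) := by
        refine Finset.sum_congr rfl fun i hi => ?_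
        have : (i : ℝ) + 1 ≤ k := by exact_mod_cast Finset.mem_range.1 hi
        rw [min_eq_left (by linarith), max_eq_right zero_le_one, mul_one]
      rw [h2, Finset.sum_range_sub (fun i => (f i : ℝ)), add_sub_cancel_left, min_eq_right h1,
        max_eq_right h0]
    | succ S hS ih =>
      rw [Finset.sum_range_succ, ih]
      have : (k : ℝ) + 1 ≤ S := by exact_mod_cast hS
      rw [min_eq_right (by linarith), max_eq_left (by linarith), mul_zero, add_zero]
  rw [walkInterp, hsum T hk]
  ring

theorem walkInterp_natCast (f : ℕ → ℕ) {T k : ℕ} (hT : 0 < T) (hk : k ≤ T) :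
    walkInterp f T k = f k := by
  rcases hk.lt_or_eq with h | rfl
  · simpa using walkInterp_add f h le_rfl zero_le_one
  · obtain ⟨m, rfl⟩ : ∃ m, k = m + 1 := ⟨k - 1, by omega⟩
    have := walkInterp_add f (Nat.lt_succ_self m) zero_le_one le_rfl
    push_cast
    rw [this]
    ring

namespace Curve

theorem point_natCast (P : Curve Plane) (i : ℕ) : P.point i = P.vertexAt i := by
  simp [point]

theorem point_add (P : Curve Plane) (i : ℕ) {u : ℝ} (h0 : 0 ≤ u) (h1 : u < 1) :
    P.point (i + u) = AffineMap.lineMap (P.vertexAt i) (P.vertexAt (i + 1)) u := by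
  have h : ⌊(i : ℝ) + u⌋₊ = i := by
    rw [Nat.floor_eq_iff (by positivity)]
    constructor <;> linarith
  simp [point, h]

/-- In one time unit a unit walk stands still or runs through a single edge, so the motion on the
curve is affine in each time unit. -/
theorem point_walkInterp (P : Curve Plane) {f : ℕ → ℕ} {T k : ℕ} {u : ℝ}
    (hf : ∀ i, f i ≤ f (i + 1)) (hf' : ∀ i, f (i + 1) ≤ f i + 1)
    (hk : k < T) (h0 : 0 ≤ u) (h1 : u < 1) :
    P.point (walkInterp f T (k + u)) =
      AffineMap.lineMap (P.vertexAt (f k)) (P.vertexAt (f (k + 1))) u := by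
  rw [walkInterp_add f hk h0 h1.le]
  have := hf k
  have := hf' k
  obtain h | h : f (k + 1) = f k ∨ f (k + 1) = f k + 1 := by omega
  · simp [h, point_natCast]
  · rw [h]
    push_cast
    rw [add_sub_cancel_left, one_mul, point_add P _ h0 h1]

end Curve

/-- Convexity of the norm. It is the reason why a bound at integer times, which is all the discrete
distance asks for, bounds the continuous distance too. -/
theorem dist_lineMap_lineMap_le_of_le {a b c d : Plane} {D u : ℝ} (h0 : 0 ≤ u) (h1 : u ≤ 1)
    (hac : dist a c ≤ D) (hbd : dist b d ≤ D) :
    dist (AffineMap.lineMap a b u : Plane) (AffineMap.lineMap c d u) ≤ D := by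
  have h : (AffineMap.lineMap a b u : Plane) - AffineMap.lineMap c d u =
      (1 - u) • (a - c) + u • (b - d) := by
    simp only [AffineMap.lineMap_apply_module]
    module
  rw [dist_eq_norm, h]
  rw [dist_eq_norm] at hac hbd
  calc ‖(1 - u) • (a - c) + u • (b - d)‖ ≤ ‖(1 - u) • (a - c)‖ + ‖u • (b - d)‖ := norm_add_le _ _
    _ = (1 - u) * ‖a - c‖ + u * ‖b - d‖ := by
      rw [norm_smul, norm_smul, Real.norm_of_nonneg h0, Real.norm_of_nonneg (sub_nonneg.2 h1)]
    _ ≤ (1 - u) * D + u * D := by gcongr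
    _ = D := by ring

theorem walkInterp_mem_contReparam {f : ℕ → ℕ} {T n : ℕ} (hT : 0 < T) (hn : 0 < n)
    (hf : IsUnitWalk f T (n - 1)) :
    (fun t : unitInterval => walkInterp f T (T * t)) ∈ contReparam n := by
  have hc : Continuous fun t : unitInterval => walkInterp f T (T * t) :=
    (walkInterp_continuous f T).comp (by fun_prop)
  have hm : Monotone fun t : unitInterval => walkInterp f T (T * t) := by
    intro s t hst
    refine walkInterp_monotone T hf.le_succ ?_
    have : (s : ℝ) ≤ t := hst
    gcongr
  have h0 : walkInterp f T (T * (0 : unitInterval)) = 0 := by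
    have := walkInterp_natCast f hT (Nat.zero_le T)
    simpa [hf.start] using this
  have h1 : walkInterp f T (T * (1 : unitInterval)) = (n : ℝ) - 1 := by
    have := walkInterp_natCast f hT le_rfl
    rw [hf.finish, Nat.cast_pred hn] at this
    simpa using this
  refine ⟨hc, hm, Set.Subset.antisymm ?_ ?_⟩
  · rintro _ ⟨t, rfl⟩
    exact ⟨h0 ▸ hm (unitInterval.nonneg' (t := t)), h1 ▸ hm (unitInterval.le_one' (t := t))⟩
  · intro y hy
    have := intermediate_value_univ (0 : unitInterval) 1 hc
    simp only [h0, h1] at this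
    exact this hy

/-- The walk is sampled at the floor of `T * t`; steps of size at most one make it hit every vertex.
-/
theorem floor_walk_mem_discReparam {f : ℕ → ℕ} {T n : ℕ} (hT : 0 < T) (hn : 0 < n)
    (hf : IsUnitWalk f T (n - 1)) (hb : ∀ t : unitInterval, f ⌊(T : ℝ) * t⌋₊ < n) :
    (fun t : unitInterval => (⟨f ⌊(T : ℝ) * t⌋₊, hb t⟩ : Fin n)) ∈ discReparam n := by
  refine ⟨?_, ?_⟩
  · intro s t hst
    have : (s : ℝ) ≤ t := hst
    refine Fin.mk_le_mk.2 (hf.monotone (Nat.floor_mono ?_))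
    gcongr
  · rintro ⟨j, hj⟩
    obtain ⟨i, hi, hij⟩ := hf.exists_eq (j := j) (by omega)
    have hT' : (0 : ℝ) < T := by exact_mod_cast hT
    have hx : (i : ℝ) / T ∈ unitInterval :=
      ⟨by positivity, div_le_one_of_le₀ (by exact_mod_cast hi) hT'.le⟩
    refine ⟨⟨(i : ℝ) / T, hx⟩, Fin.ext ?_⟩
    change f ⌊(T : ℝ) * ((i : ℝ) / T)⌋₊ = j
    rw [mul_div_cancel₀ _ hT'.ne', Nat.floor_natCast, hij]

theorem Curve.vertexAt_of_lt {α : Type} (P : Curve α) {i : ℕ} (h : i < P.size) :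
    P.vertexAt i = P.vertex ⟨i, h⟩ := by
  have : min i (P.size - 1) = i := by omega
  simp [vertexAt, this]

section walk

variable {P Q : Curve Plane} {f g : ℕ → ℕ} {T : ℕ} {D : ℝ}

theorem exists_contReparam_of_walk (hT : 0 < T) (hf : IsUnitWalk f T (P.size - 1))
    (hg : IsUnitWalk g T (Q.size - 1))
    (hD : ∀ i ≤ T, dist (P.vertexAt (f i)) (Q.vertexAt (g i)) ≤ D) :
    ∃ F ∈ contReparam P.size, ∃ G ∈ contReparam Q.size,
      ∀ t : unitInterval, dist (P.point (F t)) (Q.point (G t)) ≤ D := by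
  refine ⟨_, walkInterp_mem_contReparam hT P.size_pos hf, _,
    walkInterp_mem_contReparam hT Q.size_pos hg, fun t => ?_⟩
  have hx0 : 0 ≤ (T : ℝ) * t := mul_nonneg (Nat.cast_nonneg _) t.2.1
  have hx1 : (T : ℝ) * t ≤ T := mul_le_of_le_one_right (Nat.cast_nonneg _) t.2.2
  rcases hx1.lt_or_eq with hlt | heq
  · have hk : ⌊(T : ℝ) * t⌋₊ < T := (Nat.floor_lt hx0).2 hlt
    have hu0 : 0 ≤ (T : ℝ) * t - ⌊(T : ℝ) * t⌋₊ := sub_nonneg.2 (Nat.floor_le hx0)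
    have hu1 : (T : ℝ) * t - ⌊(T : ℝ) * t⌋₊ < 1 := by
      linarith [Nat.lt_floor_add_one ((T : ℝ) * t)]
    have hx : (T : ℝ) * t = ⌊(T : ℝ) * t⌋₊ + ((T : ℝ) * t - ⌊(T : ℝ) * t⌋₊) := by ring
    rw [hx, P.point_walkInterp hf.le_succ hf.succ_le hk hu0 hu1,
      Q.point_walkInterp hg.le_succ hg.succ_le hk hu0 hu1]
    exact dist_lineMap_lineMap_le_of_le hu0 hu1.le (hD _ hk.le) (hD _ hk)
  · simp only [heq]
    rw [walkInterp_natCast f hT le_rfl, walkInterp_natCast g hT le_rfl, P.point_natCast,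
      Q.point_natCast]
    exact hD T le_rfl

theorem exists_discReparam_of_walk (hT : 0 < T) (hf : IsUnitWalk f T (P.size - 1))
    (hg : IsUnitWalk g T (Q.size - 1))
    (hD : ∀ i ≤ T, dist (P.vertexAt (f i)) (Q.vertexAt (g i)) ≤ D) :
    ∃ F ∈ discReparam P.size, ∃ G ∈ discReparam Q.size,
      ∀ t : unitInterval, dist (P.vertex (F t)) (Q.vertex (G t)) ≤ D := by
  have hfl : ∀ t : unitInterval, ⌊(T : ℝ) * t⌋₊ ≤ T := fun t =>
    Nat.floor_le_of_le (mul_le_of_le_one_right (Nat.cast_nonneg _) t.2.2)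
  have hPb : ∀ t : unitInterval, f ⌊(T : ℝ) * t⌋₊ < P.size := fun t => by
    have := hf.monotone (hfl t)
    rw [hf.finish] at this
    have := P.size_pos
    omega
  have hQb : ∀ t : unitInterval, g ⌊(T : ℝ) * t⌋₊ < Q.size := fun t => by
    have := hg.monotone (hfl t)
    rw [hg.finish] at this
    have := Q.size_pos
    omega
  refine ⟨_, floor_walk_mem_discReparam hT P.size_pos hf hPb, _,
    floor_walk_mem_discReparam hT Q.size_pos hg hQb, fun t => ?_⟩
  have := hD _ (hfl t)
  rwa [P.vertexAt_of_lt (hPb t), Q.vertexAt_of_lt (hQb t)] at this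

end walk

theorem frechetDist_le {P Q : Curve Plane} {D : ℝ}
    (h : ∃ F ∈ contReparam P.size, ∃ G ∈ contReparam Q.size,
      ∀ t : unitInterval, dist (P.point (F t)) (Q.point (G t)) ≤ D) : frechetDist P Q ≤ D := by
  refine csInf_le ⟨0, ?_⟩ h
  rintro E ⟨F, _, G, _, hE⟩
  exact dist_nonneg.trans (hE 0)

theorem discreteFrechetDist_le {P Q : Curve Plane} {D : ℝ}
    (h : ∃ F ∈ discReparam P.size, ∃ G ∈ discReparam Q.size,
      ∀ t : unitInterval, dist (P.vertex (F t)) (Q.vertex (G t)) ≤ D) :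
    discreteFrechetDist P Q ≤ D := by
  refine csInf_le ⟨0, ?_⟩ h
  rintro E ⟨F, _, G, _, hE⟩
  exact dist_nonneg.trans (hE 0)

theorem frechetDist_nonneg (P Q : Curve Plane) : 0 ≤ frechetDist P Q := by
  refine Real.sInf_nonneg ?_
  rintro E ⟨F, _, G, _, hE⟩
  exact dist_nonneg.trans (hE 0)

theorem discreteFrechetDist_nonneg (P Q : Curve Plane) : 0 ≤ discreteFrechetDist P Q := by
  refine Real.sInf_nonneg ?_
  rintro E ⟨F, _, G, _, hE⟩
  exact dist_nonneg.trans (hE 0)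

/-! ## The two curves built from a pair of assignment tables -/

/-- The abscissa of the clause vertices with index `i`. -/
def zigzag (i : ℕ) : ℕ := 2 + 28 * (i % 2)

/-- The vertices of the first curve: for each row `a` the points `(12, 16)`, one point per clause
`1, …, M`, and `(20, 16)`. -/
def leftVertex (M : ℕ) (A : ℕ → ℕ → Bool) (x : ℕ) : ℕ × ℕ :=
  if x % (M + 2) < 1 then (12, 16)
  else if x % (M + 2) < M + 1 then
    (zigzag (x % (M + 2)), if A (x / (M + 2)) (x % (M + 2)) then 29 else 31)
  else (20, 16)

/-- The vertices of the second curve: two initial points, for each row the point `(16, 0)`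
and one point per clause, then `(16, 0)` and two final points. -/
def rightVertex (M L : ℕ) (B : ℕ → ℕ → Bool) (y : ℕ) : ℕ × ℕ :=
  if y < 1 then (16, 20)
  else if y < 2 then (0, 0)
  else if y < L * (M + 1) + 3 then
    if (y - 2) % (M + 1) < 1 then (16, 0)
    else (zigzag ((y - 2) % (M + 1)), if B ((y - 2) / (M + 1)) ((y - 2) % (M + 1)) then 11 else 9)
  else if y < L * (M + 1) + 4 then (32, 0)
  else (16, 20)

/-! ### Values of the two vertex functions -/

section vertices

variable {M L : ℕ} {A B : ℕ → ℕ → Bool}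

theorem leftVertex_start (k : ℕ) : leftVertex M A (k * (M + 2)) = (12, 16) := by
  simp [leftVertex]

theorem leftVertex_clause (k : ℕ) {i : ℕ} (h1 : 1 ≤ i) (hM : i ≤ M) :
    leftVertex M A (k * (M + 2) + i) = (zigzag i, if A k i then 29 else 31) := by
  have h2 : (k * (M + 2) + i) % (M + 2) = i := by
    rw [Nat.mul_add_mod_self_right, Nat.mod_eq_of_lt (by omega)]
  have h3 : (k * (M + 2) + i) / (M + 2) = k := by
    rw [mul_comm, Nat.mul_add_div (by omega), Nat.div_eq_of_lt (by omega), add_zero]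
  rw [leftVertex, h2, h3, if_neg (by omega), if_pos (by omega)]

theorem leftVertex_final (k : ℕ) : leftVertex M A (k * (M + 2) + (M + 1)) = (20, 16) := by
  have h2 : (k * (M + 2) + (M + 1)) % (M + 2) = M + 1 := by
    rw [Nat.mul_add_mod_self_right, Nat.mod_eq_of_lt (by omega)]
  rw [leftVertex, h2, if_neg (by omega), if_neg (by omega)]

theorem rightVertex_zero : rightVertex M L B 0 = (16, 20) := by simp [rightVertex]

theorem rightVertex_one : rightVertex M L B 1 = (0, 0) := by simp [rightVertex]

theorem rightVertex_sep {l : ℕ} (hl : l ≤ L) :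
    rightVertex M L B (2 + l * (M + 1)) = (16, 0) := by
  have h : l * (M + 1) ≤ L * (M + 1) := Nat.mul_le_mul_right _ hl
  have h2 : (2 + l * (M + 1) - 2) % (M + 1) = 0 := by simp
  rw [rightVertex, if_neg (by omega), if_neg (by omega), if_pos (by omega), h2, if_pos one_pos]

theorem rightVertex_clause {l j : ℕ} (hl : l < L) (h1 : 1 ≤ j) (hM : j ≤ M) :
    rightVertex M L B (2 + l * (M + 1) + j) = (zigzag j, if B l j then 11 else 9) := by
  have h : (l + 1) * (M + 1) ≤ L * (M + 1) := Nat.mul_le_mul_right _ hl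
  rw [add_mul] at h
  have h0 : 2 + l * (M + 1) + j - 2 = l * (M + 1) + j := by omega
  have h2 : (l * (M + 1) + j) % (M + 1) = j := by
    rw [Nat.mul_add_mod_self_right, Nat.mod_eq_of_lt (by omega)]
  have h3 : (l * (M + 1) + j) / (M + 1) = l := by
    rw [mul_comm, Nat.mul_add_div (by omega), Nat.div_eq_of_lt (by omega), add_zero]
  rw [rightVertex, h0, h2, h3, if_neg (by omega), if_neg (by omega), if_pos (by omega),
    if_neg (by omega)]

theorem rightVertex_penultimate : rightVertex M L B (L * (M + 1) + 3) = (32, 0) := by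
  simp [rightVertex]

theorem rightVertex_last : rightVertex M L B (L * (M + 1) + 4) = (16, 20) := by
  simp [rightVertex]

theorem zigzag_eq (i : ℕ) :
    (zigzag i = 2 ∧ zigzag (i + 1) = 30) ∨ (zigzag i = 30 ∧ zigzag (i + 1) = 2) := by
  unfold zigzag
  omega

theorem zigzag_eq_zigzag {i j : ℕ} : zigzag i = zigzag j ↔ i % 2 = j % 2 := by
  unfold zigzag
  omega

theorem leftVertex_mem (x : ℕ) : leftVertex M A x = (12, 16) ∨ leftVertex M A x = (20, 16) ∨
    (((leftVertex M A x).1 = 2 ∨ (leftVertex M A x).1 = 30) ∧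
      ((leftVertex M A x).2 = 29 ∨ (leftVertex M A x).2 = 31)) := by
  unfold leftVertex
  have := zigzag_eq (x % (M + 2))
  split_ifs <;> simp <;> omega

theorem rightVertex_mem (y : ℕ) : rightVertex M L B y = (16, 20) ∨ rightVertex M L B y = (0, 0) ∨
    rightVertex M L B y = (16, 0) ∨ rightVertex M L B y = (32, 0) ∨
    (((rightVertex M L B y).1 = 2 ∨ (rightVertex M L B y).1 = 30) ∧
      ((rightVertex M L B y).2 = 9 ∨ (rightVertex M L B y).2 = 11)) := by
  unfold rightVertex
  have := zigzag_eq ((y - 2) % (M + 1))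
  split_ifs <;> simp <;> omega

/-- These vertices are all within 20 of (12, 16); the missing vertex (32, 0) is the only one that is
not. -/
theorem rightVertex_ne_last {y : ℕ} (h1 : 1 ≤ y) (h2 : y < L * (M + 1) + 3) :
    rightVertex M L B y = (0, 0) ∨ rightVertex M L B y = (16, 0) ∨
    (((rightVertex M L B y).1 = 2 ∨ (rightVertex M L B y).1 = 30) ∧
      ((rightVertex M L B y).2 = 9 ∨ (rightVertex M L B y).2 = 11)) := by
  unfold rightVertex
  have := zigzag_eq ((y - 2) % (M + 1))
  rw [if_neg (by omega), if_pos h2]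
  split_ifs <;> simp <;> omega

/-- Dually, these vertices are all within 20 of (20, 16), and the missing (0, 0) is not. -/
theorem rightVertex_ne_second {y : ℕ} (h1 : 2 ≤ y) :
    rightVertex M L B y = (16, 20) ∨
    rightVertex M L B y = (16, 0) ∨ rightVertex M L B y = (32, 0) ∨
    (((rightVertex M L B y).1 = 2 ∨ (rightVertex M L B y).1 = 30) ∧
      ((rightVertex M L B y).2 = 9 ∨ (rightVertex M L B y).2 = 11)) := by
  unfold rightVertex
  have := zigzag_eq ((y - 2) % (M + 1))
  rw [if_neg (by omega), if_neg (by omega)]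
  split_ifs <;> simp <;> omega

end vertices

/-- The first curve. -/
def leftCurve (M L : ℕ) (hL : 0 < L) (A : ℕ → ℕ → Bool) : Curve (ℕ × ℕ) :=
  ⟨L * (M + 2), by positivity, fun i => leftVertex M A i⟩

/-- The second curve. -/
def rightCurve (M L : ℕ) (B : ℕ → ℕ → Bool) : Curve (ℕ × ℕ) :=
  ⟨L * (M + 1) + 5, by positivity, fun i => rightVertex M L B i⟩

theorem dist_ofNat_point (a b : ℕ × ℕ) :
    dist (!₂[(a.1 : ℝ), (a.2 : ℝ)] : Plane) !₂[(b.1 : ℝ), (b.2 : ℝ)] =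
      Real.sqrt (((a.1 : ℝ) - b.1) ^ 2 + ((a.2 : ℝ) - b.2) ^ 2) := by
  simp [EuclideanSpace.dist_eq, Real.dist_eq, sq_abs]

/-! ### A traversal of width 20 for compatible rows, and a crude one for arbitrary rows -/

section upper

variable {M L : ℕ} {A B : ℕ → ℕ → Bool} {hL : 0 < L}

theorem left_vertexAt {i : ℕ} (hi : i < L * (M + 2)) : (leftCurve M L hL A).ofNat.vertexAt i =
    !₂[((leftVertex M A i).1 : ℝ), ((leftVertex M A i).2 : ℝ)] := by
  rw [Curve.vertexAt_of_lt _ hi]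
  rfl

theorem right_vertexAt {i : ℕ} (hi : i < L * (M + 1) + 5) :
    (rightCurve M L B).ofNat.vertexAt i =
    !₂[((rightVertex M L B i).1 : ℝ), ((rightVertex M L B i).2 : ℝ)] := by
  rw [Curve.vertexAt_of_lt _ hi]
  rfl

/-- The traversals that walk along the second curve while the first curve goes through its
`k`-th row, in lockstep with the `l`-th row of the second curve. -/
theorem exists_walks {k l : ℕ} (hk : k < L) (hl : l < L) {D : ℝ}
    (h0 : ∀ i, dist (!₂[((leftVertex M A i).1 : ℝ), ((leftVertex M A i).2 : ℝ)] : Plane)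
      !₂[(16 : ℝ), (20 : ℝ)] ≤ D)
    (h1 : ∀ j ≤ 2 + l * (M + 1), dist (!₂[(12 : ℝ), (16 : ℝ)] : Plane)
      !₂[((rightVertex M L B j).1 : ℝ), ((rightVertex M L B j).2 : ℝ)] ≤ D)
    (h2 : ∀ j, 2 + l * (M + 1) ≤ j → dist (!₂[(20 : ℝ), (16 : ℝ)] : Plane)
      !₂[((rightVertex M L B j).1 : ℝ), ((rightVertex M L B j).2 : ℝ)] ≤ D)
    (h3 : ∀ i, 1 ≤ i → i ≤ M →
      dist (!₂[(zigzag i : ℝ), (((if A k i then 29 else 31) : ℕ) : ℝ)] : Plane)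
        !₂[(zigzag i : ℝ), (((if B l i then 11 else 9) : ℕ) : ℝ)] ≤ D) :
    ∃ T f g, 0 < T ∧ IsUnitWalk f T (L * (M + 2) - 1) ∧ IsUnitWalk g T (L * (M + 1) + 5 - 1) ∧
      ∀ i ≤ T, dist ((leftCurve M L hL A).ofNat.vertexAt (f i))
        ((rightCurve M L B).ofNat.vertexAt (g i)) ≤ D := by
  have hk' : (k + 1) * (M + 2) ≤ L * (M + 2) := Nat.mul_le_mul_right _ hk
  have hl' : (l + 1) * (M + 1) ≤ L * (M + 1) := Nat.mul_le_mul_right _ hl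
  rw [add_mul, one_mul] at hk' hl'
  have e0 := leftVertex_start (M := M) (A := A) k
  have e1 := leftVertex_final (M := M) (A := A) k
  have e2 := rightVertex_last (M := M) (L := L) (B := B)
  have e3 := rightVertex_zero (M := M) (L := L) (B := B)
  have e4 := rightVertex_sep (M := M) (L := L) (B := B) (l := l) (by omega)
  have hcl : ∀ i, 1 ≤ i → i ≤ M → dist
      (!₂[((leftVertex M A (k * (M + 2) + i)).1 : ℝ),
        ((leftVertex M A (k * (M + 2) + i)).2 : ℝ)] : Plane)
      !₂[((rightVertex M L B (2 + l * (M + 1) + i)).1 : ℝ),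
        ((rightVertex M L B (2 + l * (M + 1) + i)).2 : ℝ)] ≤ D := by
    intro i hi1 hi2
    rw [leftVertex_clause k hi1 hi2, rightVertex_clause hl hi1 hi2]
    exact h3 i hi1 hi2
  set X := k * (M + 2)
  set Y := l * (M + 1)
  set p := L * (M + 2)
  set q := L * (M + 1)
  -- The left curve makes `p - 1` moves and the right one `q + 4`, of which `M + 1` are joint.
  -- Truncated subtraction encodes waiting: the left curve moves up to time `X`, for `M + 1` units
  -- from time `X + 2 + Y` on, and again once the right curve has arrived, at time `X + (q + 4)`.
  refine ⟨p + q + 5 - 2 - (M + 1),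
    fun n => min n X + min (n - (X + 2 + Y)) (M + 1) + (n - (X + (q + 4))),
    fun n => min (n - X) (q + 4), by omega,
    ⟨by simp, by omega, fun i => by omega, fun i => by omega⟩,
    ⟨by simp, by omega, fun i => by omega, fun i => by omega⟩,
    fun n hn => ?_⟩
  rw [left_vertexAt (by simp only [p] at *; omega), right_vertexAt (by simp only [q] at *; omega)]
  rcases le_or_gt n X with c1 | c1
  · have : min (n - X) (q + 4) = 0 := by omega
    simp only [this, e3]
    exact h0 _
  rcases le_or_gt n (X + 2 + Y) with c2 | c2
  · have : min n X + min (n - (X + 2 + Y)) (M + 1) + (n - (X + (q + 4))) = X := by omega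
    simp only [this, e0]
    exact h1 _ (by omega)
  rcases lt_or_ge n (X + 2 + Y + (M + 1)) with c3 | c3
  · have := hcl (n - (X + 2 + Y)) (by omega) (by omega)
    have e5 : min n X + min (n - (X + 2 + Y)) (M + 1) + (n - (X + (q + 4))) =
      X + (n - (X + 2 + Y)) := by omega
    have e6 : min (n - X) (q + 4) = 2 + Y + (n - (X + 2 + Y)) := by omega
    simp only [e5, e6]
    exact this
  rcases le_or_gt n (X + (q + 4)) with c4 | c4
  · have : min n X + min (n - (X + 2 + Y)) (M + 1) + (n - (X + (q + 4))) = X + (M + 1) := by omega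
    simp only [this, e1]
    exact h2 _ (by omega)
  · have : min (n - X) (q + 4) = q + 4 := by omega
    simp only [this, e2]
    exact h0 _

theorem sqrt_le_twenty {x : ℝ} (h : x ≤ 400) : Real.sqrt x ≤ 20 :=
  Real.sqrt_le_iff.2 ⟨by norm_num, by linarith⟩

/-- The bound 20 is attained, for instance between (12, 16) and (0, 0) and between (20, 16) and (32,
0). In lockstep the abscissas agree, and the heights differ by more than 20 only for 31 against 9,
which compatibility excludes. -/
theorem exists_walks_of_compatible {k l : ℕ} (hk : k < L) (hl : l < L)
    (h : ∀ i, 1 ≤ i → i ≤ M → A k i = true ∨ B l i = true) :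
    ∃ T f g, 0 < T ∧ IsUnitWalk f T (L * (M + 2) - 1) ∧ IsUnitWalk g T (L * (M + 1) + 5 - 1) ∧
      ∀ i ≤ T, dist ((leftCurve M L hL A).ofNat.vertexAt (f i))
        ((rightCurve M L B).ofNat.vertexAt (g i)) ≤ 20 := by
  have hl' : (l + 1) * (M + 1) ≤ L * (M + 1) := Nat.mul_le_mul_right _ hl
  rw [add_mul, one_mul] at hl'
  refine exists_walks hk hl (fun i => ?_) (fun j hj => ?_) (fun j hj => ?_) (fun i hi1 hi2 => ?_)
  · have := dist_ofNat_point (leftVertex M A i) (16, 20)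
    push_cast at this
    rw [this]
    refine sqrt_le_twenty ?_
    rcases leftVertex_mem (M := M) (A := A) i with h | h | ⟨h | h, h' | h'⟩ <;> simp [h] <;>
      (try simp [h']) <;> norm_num
  · have := dist_ofNat_point (12, 16) (rightVertex M L B j)
    push_cast at this
    rw [this]
    refine sqrt_le_twenty ?_
    rcases Nat.eq_zero_or_pos j with rfl | hj0
    · rw [rightVertex_zero]; norm_num
    rcases rightVertex_ne_last (M := M) (L := L) (B := B) hj0 (by omega) with
      h | h | ⟨h | h, h' | h'⟩ <;> simp [h] <;> (try simp [h']) <;> norm_num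
  · have := dist_ofNat_point (20, 16) (rightVertex M L B j)
    push_cast at this
    rw [this]
    refine sqrt_le_twenty ?_
    rcases rightVertex_ne_second (M := M) (L := L) (B := B) (y := j) (by omega) with
      h | h | h | ⟨h | h, h' | h'⟩ <;> simp [h] <;> (try simp [h']) <;> norm_num
  · have := dist_ofNat_point (zigzag i, if A k i then 29 else 31)
      (zigzag i, if B l i then 11 else 9)
    simp only at this
    rw [this]
    refine sqrt_le_twenty ?_
    rcases h i hi1 hi2 with h | h <;> simp only [h] <;> split_ifs <;> norm_num

/-- This makes the set in the definition of a distance nonempty; the infimum of the empty set is 0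
by convention and would spoil the lower bound. All coordinates are at most 32, so 100 suffices. -/
theorem exists_walks_crude (hL : 0 < L) :
    ∃ T f g, 0 < T ∧ IsUnitWalk f T (L * (M + 2) - 1) ∧ IsUnitWalk g T (L * (M + 1) + 5 - 1) ∧
      ∀ i ≤ T, dist ((leftCurve M L hL A).ofNat.vertexAt (f i))
        ((rightCurve M L B).ofNat.vertexAt (g i)) ≤ 100 := by
  have key : ∀ a b : ℕ × ℕ, a.1 ≤ 32 → a.2 ≤ 32 → b.1 ≤ 32 → b.2 ≤ 32 →
      dist (!₂[(a.1 : ℝ), (a.2 : ℝ)] : Plane) !₂[(b.1 : ℝ), (b.2 : ℝ)] ≤ 100 := by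
    intro a b h1 h2 h3 h4
    rw [dist_ofNat_point]
    refine Real.sqrt_le_iff.2 ⟨by norm_num, ?_⟩
    have h1' : (a.1 : ℝ) ≤ 32 := by exact_mod_cast h1
    have h2' : (a.2 : ℝ) ≤ 32 := by exact_mod_cast h2
    have h3' : (b.1 : ℝ) ≤ 32 := by exact_mod_cast h3
    have h4' : (b.2 : ℝ) ≤ 32 := by exact_mod_cast h4
    have : (0 : ℝ) ≤ a.1 := by positivity
    have : (0 : ℝ) ≤ a.2 := by positivity
    have : (0 : ℝ) ≤ b.1 := by positivity
    have : (0 : ℝ) ≤ b.2 := by positivity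
    nlinarith
  have hA : ∀ i, (leftVertex M A i).1 ≤ 32 ∧ (leftVertex M A i).2 ≤ 32 := by
    intro i
    rcases leftVertex_mem (M := M) (A := A) i with h | h | ⟨h, h'⟩
    · simp [h]
    · simp [h]
    · omega
  have hB : ∀ i, (rightVertex M L B i).1 ≤ 32 ∧ (rightVertex M L B i).2 ≤ 32 := by
    intro i
    rcases rightVertex_mem (M := M) (L := L) (B := B) i with h | h | h | h | ⟨h, h'⟩
    iterate 4 simp [h]
    omega
  refine exists_walks hL hL (fun i => ?_) (fun j _ => ?_) (fun j _ => ?_) (fun i _ _ => ?_)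
  · exact_mod_cast key (leftVertex M A i) (16, 20) (hA i).1 (hA i).2 (by norm_num) (by norm_num)
  · exact_mod_cast key (12, 16) (rightVertex M L B j) (by norm_num) (by norm_num) (hB j).1 (hB j).2
  · exact_mod_cast key (20, 16) (rightVertex M L B j) (by norm_num) (by norm_num) (hB j).1 (hB j).2
  · have := zigzag_eq i
    exact key (zigzag i, if A 0 i then 29 else 31) (zigzag i, if B 0 i then 11 else 9)
      (by simp only; omega) (by simp only; split_ifs <;> norm_num) (by simp only; omega)
      (by simp only; split_ifs <;> norm_num)

end upper

/-! ## Traversals of small width force a compatible pair of rows -/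

/-- The abscissa of the polygonal curve with the given vertices. -/
noncomputable def interpX (v : ℕ → ℕ × ℕ) (s : ℝ) : ℝ :=
  (1 - (s - ⌊s⌋₊)) * (v ⌊s⌋₊).1 + (s - ⌊s⌋₊) * (v (⌊s⌋₊ + 1)).1

/-- The ordinate of the polygonal curve with the given vertices. -/
noncomputable def interpY (v : ℕ → ℕ × ℕ) (s : ℝ) : ℝ :=
  (1 - (s - ⌊s⌋₊)) * (v ⌊s⌋₊).2 + (s - ⌊s⌋₊) * (v (⌊s⌋₊ + 1)).2

theorem floor_natCast_add {n : ℕ} {u : ℝ} (h0 : 0 ≤ u) (h1 : u < 1) : ⌊(n : ℝ) + u⌋₊ = n := by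
  rw [Nat.floor_eq_iff (by positivity)]
  constructor <;> linarith

theorem interpX_add (v : ℕ → ℕ × ℕ) (n : ℕ) {u : ℝ} (h0 : 0 ≤ u) (h1 : u < 1) :
    interpX v (n + u) = (1 - u) * (v n).1 + u * (v (n + 1)).1 := by
  rw [interpX, floor_natCast_add h0 h1, add_sub_cancel_left]

theorem interpY_add (v : ℕ → ℕ × ℕ) (n : ℕ) {u : ℝ} (h0 : 0 ≤ u) (h1 : u < 1) :
    interpY v (n + u) = (1 - u) * (v n).2 + u * (v (n + 1)).2 := by
  rw [interpY, floor_natCast_add h0 h1, add_sub_cancel_left]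

theorem interpX_natCast (v : ℕ → ℕ × ℕ) (n : ℕ) : interpX v n = (v n).1 := by
  simp [interpX]

theorem interpY_natCast (v : ℕ → ℕ × ℕ) (n : ℕ) : interpY v n = (v n).2 := by
  simp [interpY]

theorem exists_eq_natCast_add {s : ℝ} (hs : 0 ≤ s) :
    ∃ (n : ℕ) (u : ℝ), 0 ≤ u ∧ u < 1 ∧ s = n + u :=
  ⟨⌊s⌋₊, s - ⌊s⌋₊, sub_nonneg.2 (Nat.floor_le hs), by linarith [Nat.lt_floor_add_one s], by ring⟩

/-- The squared distance of two points of the two curves. -/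
noncomputable def interpSqDist (v v' : ℕ → ℕ × ℕ) (s s' : ℝ) : ℝ :=
  (interpX v s - interpX v' s') ^ 2 + (interpY v s - interpY v' s') ^ 2

theorem point_ofNat_of_lt {P : Curve (ℕ × ℕ)} {v : ℕ → ℕ × ℕ}
    (hv : ∀ i : Fin P.size, P.vertex i = v i) {s : ℝ} (h0 : 0 ≤ s) (h1 : s ≤ (P.size : ℝ) - 1) :
    P.ofNat.point s = !₂[interpX v s, interpY v s] := by
  have hat : ∀ i < P.size, P.ofNat.vertexAt i = !₂[((v i).1 : ℝ), ((v i).2 : ℝ)] := by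
    intro i hi
    rw [Curve.vertexAt_of_lt (P := P.ofNat) hi]
    simp [Curve.ofNat, Curve.map, hv]
  obtain ⟨n, u, hu0, hu1, rfl⟩ := exists_eq_natCast_add h0
  have hn : n < P.size := by
    have : (n : ℝ) < P.size := by linarith
    exact_mod_cast this
  -- The last vertex has no successor: there `vertexAt` repeats it whereas `v` goes on, so `u = 0`
  -- is separate.
  rcases hu0.eq_or_lt with rfl | hu
  · rw [add_zero, Curve.point_natCast, hat n hn, interpX_natCast, interpY_natCast]
  · have hn' : n + 1 < P.size := by
      have : ((n + 1 : ℕ) : ℝ) < P.size := by push_cast; linarith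
      exact_mod_cast this
    rw [Curve.point_add _ _ hu0 hu1, hat n hn, hat _ hn', interpX_add v n hu0 hu1,
      interpY_add v n hu0 hu1, AffineMap.lineMap_apply_module]
    ext i
    fin_cases i <;> simp

theorem dist_point_ofNat_sq {P Q : Curve (ℕ × ℕ)} {v v' : ℕ → ℕ × ℕ}
    (hv : ∀ i : Fin P.size, P.vertex i = v i) (hv' : ∀ i : Fin Q.size, Q.vertex i = v' i)
    {s s' : ℝ} (h0 : 0 ≤ s) (h1 : s ≤ (P.size : ℝ) - 1)
    (h0' : 0 ≤ s') (h1' : s' ≤ (Q.size : ℝ) - 1) :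
    dist (P.ofNat.point s) (Q.ofNat.point s') ^ 2 = interpSqDist v v' s s' := by
  rw [point_ofNat_of_lt hv h0 h1, point_ofNat_of_lt hv' h0' h1', EuclideanSpace.dist_eq,
    Real.sq_sqrt (by positivity)]
  simp [interpSqDist, Real.dist_eq, sq_abs]

/-! ### Positions on the two curves at squared distance below 480 -/

section forcing

variable {M L : ℕ} {A B : ℕ → ℕ → Bool}

theorem zigzag_cast (i : ℕ) : ((zigzag i : ℝ) = 2 ∧ (zigzag (i + 1) : ℝ) = 30) ∨
    ((zigzag i : ℝ) = 30 ∧ (zigzag (i + 1) : ℝ) = 2) := by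
  rcases zigzag_eq i with ⟨h, h'⟩ | ⟨h, h'⟩ <;> simp [h, h']

theorem left_ordinate (c : Bool) : (((if c then 29 else 31 : ℕ) : ℕ) : ℝ) = 29 ∨
    (((if c then 29 else 31 : ℕ) : ℕ) : ℝ) = 31 := by
  cases c <;> simp

theorem right_ordinate (c : Bool) : (((if c then 11 else 9 : ℕ) : ℕ) : ℝ) = 9 ∨
    (((if c then 11 else 9 : ℕ) : ℕ) : ℝ) = 11 := by
  cases c <;> simp

/-- The possible positions on the first curve. -/
theorem left_position (hM : 1 ≤ M) {s : ℝ} (hs : 0 ≤ s) : ∃ (k : ℕ) (u : ℝ), 0 ≤ u ∧ u < 1 ∧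
    ((s = ((k * (M + 2) : ℕ) : ℝ) + u ∧
      ∃ x y : ℝ, (x = 2 ∨ x = 30) ∧ (y = 29 ∨ y = 31) ∧
        interpX (leftVertex M A) s = (1 - u) * 12 + u * x ∧
        interpY (leftVertex M A) s = (1 - u) * 16 + u * y) ∨
    29 ≤ interpY (leftVertex M A) s ∨
    (s = ((k * (M + 2) + M : ℕ) : ℝ) + u ∧ 0 < u ∧
      ∃ x y : ℝ, (x = 2 ∨ x = 30) ∧ (y = 29 ∨ y = 31) ∧
        interpX (leftVertex M A) s = (1 - u) * x + u * 20 ∧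
        interpY (leftVertex M A) s = (1 - u) * y + u * 16) ∨
    (s = ((k * (M + 2) + (M + 1) : ℕ) : ℝ) + u ∧
        interpX (leftVertex M A) s = (1 - u) * 20 + u * 12 ∧
        interpY (leftVertex M A) s = 16)) := by
  obtain ⟨n, u, hu0, hu1, rfl⟩ := exists_eq_natCast_add hs
  obtain ⟨k, i, hi, rfl⟩ : ∃ k i, i < M + 2 ∧ n = k * (M + 2) + i :=
    ⟨n / (M + 2), n % (M + 2), Nat.mod_lt _ (by omega), (Nat.div_add_mod' _ _).symm⟩
  refine ⟨k, u, hu0, hu1, ?_⟩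
  rw [interpX_add _ _ hu0 hu1, interpY_add _ _ hu0 hu1]
  have hz : ∀ j, (zigzag j : ℝ) = 2 ∨ (zigzag j : ℝ) = 30 := fun j => by
    rcases zigzag_cast j with h | h <;> simp [h]
  rcases Nat.eq_zero_or_pos i with rfl | hi0
  · left
    rw [add_zero, leftVertex_start, leftVertex_clause k le_rfl hM]
    exact ⟨rfl, _, _, hz 1, left_ordinate _, by push_cast; rfl, by push_cast; rfl⟩
  rcases lt_trichotomy i M with hiM | rfl | hiM
  · right; left
    rw [leftVertex_clause k hi0 hiM.le, add_assoc, leftVertex_clause k (by omega) (by omega)]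
    rcases left_ordinate (A k i) with h | h <;> rcases left_ordinate (A k (i + 1)) with h' | h' <;>
      simp only [h, h'] <;> linarith
  · right
    rw [leftVertex_clause k hi0 le_rfl, add_assoc, leftVertex_final]
    rcases hu0.eq_or_lt with rfl | hu
    · left
      rcases left_ordinate (A k i) with h | h <;> simp only [h] <;> norm_num
    · right; left
      exact ⟨rfl, hu, _, _, hz i, left_ordinate _, by push_cast; rfl, by push_cast; rfl⟩
  · right; right; right
    obtain rfl : i = M + 1 := by omega
    have : k * (M + 2) + (M + 1) + 1 = (k + 1) * (M + 2) := by ring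
    rw [this, leftVertex_final, leftVertex_start]
    exact ⟨rfl, by push_cast; rfl, by push_cast; ring⟩

/-- Heights from 29 on and the edge down to (20, 16) are too far from the origin. On the edge from
(20, 16) to the next (12, 16), at height 16, the squared abscissa is below 480 - 256 = 224, which
leaves only the half beyond abscissa 16; this gives the margin 1/2 before the start of a row. -/
theorem left_of_near_origin (hM : 1 ≤ M) {s : ℝ} (hs : 0 ≤ s)
    (h : interpX (leftVertex M A) s ^ 2 + interpY (leftVertex M A) s ^ 2 < 480) :
    ∃ k : ℕ, ((k * (M + 2) : ℕ) : ℝ) - 1 / 2 < s ∧ s < ((k * (M + 2) : ℕ) : ℝ) + 1 := by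
  obtain ⟨k, u, hu0, hu1, ⟨rfl, -⟩ | hY | ⟨rfl, hu, x, y, hx, hy, hX, hY⟩ | ⟨rfl, hX, hY⟩⟩ :=
    left_position (A := A) hM hs
  · exact ⟨k, by linarith, by linarith⟩
  · nlinarith [sq_nonneg (interpX (leftVertex M A) s)]
  · exfalso
    rw [hX, hY] at h
    -- The squares are centred near the minimisers in `u` for `x = 2` with `y = 29` and `y = 31`;
    -- both minima exceed 600.
    rcases hx with rfl | rfl <;> rcases hy with rfl | rfl <;>
      nlinarith [sq_nonneg (u - 7 / 10), sq_nonneg (u - 4 / 5)]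
  · refine ⟨k + 1, ?_, ?_⟩
    · rw [hX, hY] at h
      have : 1 / 2 < u := by nlinarith
      push_cast
      linarith
    · push_cast
      linarith

/-- Mirror image of `left_of_near_origin`: reflection in the vertical line at abscissa 16 exchanges
(0, 0) with (32, 0) and (12, 16) with (20, 16). -/
theorem left_of_near_corner (hM : 1 ≤ M) {s : ℝ} (hs : 0 ≤ s)
    (h : (interpX (leftVertex M A) s - 32) ^ 2 + interpY (leftVertex M A) s ^ 2 < 480) :
    ∃ k : ℕ, ((k * (M + 2) + M : ℕ) : ℝ) < s ∧
      s < ((k * (M + 2) + (M + 1) : ℕ) : ℝ) + 1 / 2 := by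
  obtain ⟨k, u, hu0, hu1, ⟨rfl, x, y, hx, hy, hX, hY⟩ | hY | ⟨rfl, hu, -⟩ | ⟨rfl, hX, hY⟩⟩ :=
    left_position (A := A) hM hs
  · exfalso
    rw [hX, hY] at h
    rcases hx with rfl | rfl <;> rcases hy with rfl | rfl <;>
      nlinarith [sq_nonneg (u - 3 / 10), sq_nonneg (u - 1 / 5)]
  · nlinarith [sq_nonneg (interpX (leftVertex M A) s - 32)]
  · exact ⟨k, by linarith, by push_cast; linarith⟩
  · refine ⟨k, by push_cast; linarith, ?_⟩
    rw [hX, hY] at h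
    have : u < 1 / 2 := by nlinarith
    linarith

/-- Positions on the first curve inside row `k`. -/
theorem left_row_position (k : ℕ) {s : ℝ} (h1 : ((k * (M + 2) + 1 : ℕ) : ℝ) ≤ s)
    (h2 : s ≤ ((k * (M + 2) + M : ℕ) : ℝ)) : ∃ (i : ℕ) (u : ℝ), 0 ≤ u ∧ u < 1 ∧ 1 ≤ i ∧ i ≤ M ∧
      s = ((k * (M + 2) + i : ℕ) : ℝ) + u ∧ 29 ≤ interpY (leftVertex M A) s ∧
      interpX (leftVertex M A) s = (1 - u) * zigzag i + u * zigzag (i + 1) := by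
  obtain ⟨n, u, hu0, hu1, rfl⟩ := exists_eq_natCast_add (s := s) (le_trans (Nat.cast_nonneg _) h1)
  have hn1 : k * (M + 2) + 1 < n + 1 := by
    have : ((k * (M + 2) + 1 : ℕ) : ℝ) < ((n + 1 : ℕ) : ℝ) := by push_cast at *; linarith
    exact_mod_cast this
  have hn2 : n ≤ k * (M + 2) + M := by
    have : (n : ℝ) ≤ ((k * (M + 2) + M : ℕ) : ℝ) := by linarith
    exact_mod_cast this
  obtain ⟨i, rfl⟩ : ∃ i, n = k * (M + 2) + i := ⟨n - k * (M + 2), by omega⟩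
  refine ⟨i, u, hu0, hu1, by omega, by omega, rfl, ?_⟩
  rw [interpX_add _ _ hu0 hu1, interpY_add _ _ hu0 hu1,
    leftVertex_clause k (by omega) (by omega)]
  -- For `i = M` only `u = 0` is possible; then vertex `i + 1`, which is no clause vertex, has
  -- weight 0.
  rcases hu0.eq_or_lt with rfl | hu
  · rcases left_ordinate (A k i) with h | h <;> simp only [h] <;> norm_num
  · have : k * (M + 2) + i < k * (M + 2) + M := by
      have : ((k * (M + 2) + i : ℕ) : ℝ) < ((k * (M + 2) + M : ℕ) : ℝ) := by linarith
      exact_mod_cast this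
    rw [add_assoc, leftVertex_clause k (i := i + 1) (by omega) (by omega)]
    refine ⟨?_, by push_cast; rfl⟩
    rcases left_ordinate (A k i) with h | h <;> rcases left_ordinate (A k (i + 1)) with h' | h' <;>
      simp only [h, h'] <;> linarith

/-- High positions on the second curve lie inside a row. -/
theorem right_row_of_high {s : ℝ} (h1 : 1 ≤ s) (h2 : s ≤ ((L * (M + 1) + 3 : ℕ) : ℝ))
    (hY : 0 < interpY (rightVertex M L B) s) : ∃ l < L,
      ((2 + l * (M + 1) : ℕ) : ℝ) < s ∧ s < ((2 + (l + 1) * (M + 1) : ℕ) : ℝ) := by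
  obtain ⟨n, u, hu0, hu1, rfl⟩ := exists_eq_natCast_add (s := s) (by linarith)
  rw [interpY_add _ _ hu0 hu1] at hY
  have hn1 : 1 < n + 1 := by
    have : ((1 : ℕ) : ℝ) < ((n + 1 : ℕ) : ℝ) := by push_cast; linarith
    exact_mod_cast this
  have hn2 : n ≤ L * (M + 1) + 3 := by
    have : (n : ℝ) ≤ ((L * (M + 1) + 3 : ℕ) : ℝ) := by linarith
    exact_mod_cast this
  have hsep0 := rightVertex_sep (M := M) (B := B) (Nat.zero_le L)
  rw [zero_mul, add_zero] at hsep0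
  rcases (show 2 ≤ n ∨ n = 1 by omega) with hn | rfl
  · obtain ⟨m, rfl⟩ : ∃ m, n = 2 + m := ⟨n - 2, by omega⟩
    obtain ⟨l, j, hj, rfl⟩ : ∃ l j, j < M + 1 ∧ m = l * (M + 1) + j :=
      ⟨m / (M + 1), m % (M + 1), Nat.mod_lt _ (by omega), (Nat.div_add_mod' _ _).symm⟩
    rcases lt_or_ge l L with hl | hl
    · refine ⟨l, hl, ?_, ?_⟩
      · rcases Nat.eq_zero_or_pos j with rfl | hj0
        · rcases hu0.eq_or_lt with rfl | hu
          · rw [add_zero, rightVertex_sep hl.le] at hY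
            norm_num at hY
          · push_cast
            linarith
        · have : (1 : ℝ) ≤ j := by exact_mod_cast hj0
          push_cast
          linarith
      · have : (j : ℝ) + 1 ≤ M + 1 := by exact_mod_cast hj
        push_cast
        linarith
    -- Beyond the last row only the edge from (16, 0) to (32, 0) is left, at height 0.
    · exfalso
      have hlL : L * (M + 1) ≤ l * (M + 1) := Nat.mul_le_mul_right _ hl
      rcases lt_or_ge (2 + (l * (M + 1) + j)) (L * (M + 1) + 3) with h | h
      · have e : 2 + (l * (M + 1) + j) = 2 + L * (M + 1) := by omega
        have e' : 2 + (l * (M + 1) + j) + 1 = L * (M + 1) + 3 := by omega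
        rw [e', rightVertex_penultimate, e, rightVertex_sep le_rfl] at hY
        norm_num at hY
      · have e : 2 + (l * (M + 1) + j) = L * (M + 1) + 3 := by omega
        rw [e] at h2 hY
        obtain rfl : u = 0 := by linarith
        rw [rightVertex_penultimate] at hY
        norm_num at hY
  · rw [rightVertex_one, hsep0] at hY
    norm_num at hY

/-- Positions on the second curve inside row `l`. -/
theorem right_row_position {l : ℕ} (hM : 1 ≤ M) (hl : l < L) {s : ℝ}
    (h1 : ((2 + l * (M + 1) : ℕ) : ℝ) < s) (h2 : s < ((2 + (l + 1) * (M + 1) : ℕ) : ℝ)) :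
    ∃ (j : ℕ) (u : ℝ), 0 ≤ u ∧ u < 1 ∧ j ≤ M ∧ s = ((2 + l * (M + 1) + j : ℕ) : ℝ) + u ∧
      ((j = 0 ∧ interpX (rightVertex M L B) s = (1 - u) * 16 + u * zigzag 1 ∧
        interpY (rightVertex M L B) s = u * ((if B l 1 then 11 else 9 : ℕ) : ℕ)) ∨
      (1 ≤ j ∧ j < M ∧
        interpX (rightVertex M L B) s = (1 - u) * zigzag j + u * zigzag (j + 1) ∧
        interpY (rightVertex M L B) s = (1 - u) * ((if B l j then 11 else 9 : ℕ) : ℕ) +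
          u * ((if B l (j + 1) then 11 else 9 : ℕ) : ℕ)) ∨
      (j = M ∧ interpX (rightVertex M L B) s = (1 - u) * zigzag j + u * 16 ∧
        interpY (rightVertex M L B) s = (1 - u) * ((if B l j then 11 else 9 : ℕ) : ℕ))) := by
  obtain ⟨n, u, hu0, hu1, rfl⟩ := exists_eq_natCast_add (s := s)
    (le_trans (Nat.cast_nonneg _) h1.le)
  have hn1 : 2 + l * (M + 1) < n + 1 := by
    have : ((2 + l * (M + 1) : ℕ) : ℝ) < ((n + 1 : ℕ) : ℝ) := by push_cast at *; linarith
    exact_mod_cast this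
  have hn2 : n < 2 + (l + 1) * (M + 1) := by
    have : (n : ℝ) < ((2 + (l + 1) * (M + 1) : ℕ) : ℝ) := by linarith
    exact_mod_cast this
  rw [add_mul, one_mul] at hn2
  obtain ⟨j, rfl⟩ : ∃ j, n = 2 + l * (M + 1) + j := ⟨n - (2 + l * (M + 1)), by omega⟩
  refine ⟨j, u, hu0, hu1, by omega, rfl, ?_⟩
  rw [interpX_add _ _ hu0 hu1, interpY_add _ _ hu0 hu1]
  rcases Nat.eq_zero_or_pos j with rfl | hj0
  · left
    rw [add_zero, rightVertex_sep hl.le, rightVertex_clause hl le_rfl hM]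
    exact ⟨rfl, by push_cast; rfl, by push_cast; ring⟩
  rcases lt_or_ge j M with hjM | hjM
  · right; left
    rw [rightVertex_clause hl hj0 hjM.le, add_assoc _ j 1, rightVertex_clause hl (by omega) hjM]
    exact ⟨hj0, hjM, rfl, rfl⟩
  · right; right
    obtain rfl : j = M := by omega
    have e : 2 + l * (j + 1) + j + 1 = 2 + (l + 1) * (j + 1) := by ring
    rw [rightVertex_clause hl hj0 le_rfl, e, rightVertex_sep (by omega)]
    exact ⟨rfl, by push_cast; ring, by push_cast; ring⟩

theorem zigzag_cast_eq {i j : ℕ} (h : (zigzag i : ℝ) = zigzag j) : i % 2 = j % 2 :=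
  zigzag_eq_zigzag.1 (by exact_mod_cast h)

theorem zigzag_cast_eq_or (i j : ℕ) :
    (zigzag i : ℝ) = zigzag j ∨ (zigzag i : ℝ) = zigzag (j + 1) := by
  rcases zigzag_cast j with ⟨e, e'⟩ | ⟨e, e'⟩ <;> rcases zigzag_cast i with ⟨e'', -⟩ | ⟨e'', -⟩ <;>
    simp [e, e', e'']

/-- A clause that both rows fail costs 22 ^ 2 = 484 at the vertices themselves, but the right curve
may come closer by sliding towards a vertex of height 11. The minimum, at `u = 11 / 197`, still
exceeds 481; hence the threshold 480. -/
theorem clause_gap (u : ℝ) {y : ℝ} (hy : y = 9 ∨ y = 11) :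
    480 ≤ (28 * u) ^ 2 + (31 - ((1 - u) * 9 + u * y)) ^ 2 := by
  rcases hy with rfl | rfl <;> nlinarith [sq_nonneg (u - 11 / 197)]

/-- At fraction `w` of the way from (16, 0) to a clause vertex, the horizontal offset is `14 * (1 -
w)` on the correct side and `14 * (1 + w)` on the wrong one, and the vertical offset is at least `29
- 11 * w`. The wrong side and the first half of the edge are too far. For heights 31 and 9 the
squared distance decreases in `w`, but only to 484. -/
theorem near_of_separator_edge {x z a y w : ℝ} (hx : x = 2 ∨ x = 30) (hz : z = 2 ∨ z = 30)
    (ha : a = 29 ∨ a = 31) (hy : y = 9 ∨ y = 11) (h0 : 0 ≤ w) (h1 : w ≤ 1)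
    (h : (x - ((1 - w) * 16 + w * z)) ^ 2 + (a - w * y) ^ 2 < 480) :
    x = z ∧ 1 / 2 < w ∧ (a = 29 ∨ y = 11) := by
  have hwy : w * y ≤ w * 11 := by rcases hy with rfl | rfl <;> linarith
  have ha' : 29 ≤ a := by rcases ha with rfl | rfl <;> norm_num
  have hsq : (29 - w * 11) ^ 2 ≤ (a - w * y) ^ 2 := pow_le_pow_left₀ (by linarith) (by linarith) 2
  have hxz : x = z := by
    have hfar : (14 + 14 * w) ^ 2 + (29 - w * 11) ^ 2 < 480 → False := fun h => by nlinarith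
    rcases hx with rfl | rfl <;> rcases hz with rfl | rfl <;>
      first | rfl | (exfalso; apply hfar; linarith)
  have hdx : (x - ((1 - w) * 16 + w * z)) ^ 2 = (14 * (1 - w)) ^ 2 := by
    rw [hxz]
    rcases hz with rfl | rfl <;> ring
  rw [hdx] at h
  refine ⟨hxz, by nlinarith, ?_⟩
  rcases ha with rfl | rfl
  · exact Or.inl rfl
  rcases hy with rfl | rfl
  · nlinarith
  · exact Or.inr rfl

/-- When the first curve is at clause vertex `i`, the second one is close to a clause vertex of
the same parity, and one of the two rows satisfies the clause. -/
theorem right_near_of_left_clause {k l i : ℕ} (hM : 1 ≤ M) (hl : l < L) (hi1 : 1 ≤ i) (hi : i ≤ M)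
    {s : ℝ} (h1 : ((2 + l * (M + 1) : ℕ) : ℝ) < s) (h2 : s < ((2 + (l + 1) * (M + 1) : ℕ) : ℝ))
    (h : interpSqDist (leftVertex M A) (rightVertex M L B) ((k * (M + 2) + i : ℕ) : ℝ) s < 480) :
    ∃ j, 1 ≤ j ∧ j ≤ M ∧ j % 2 = i % 2 ∧ ((2 + l * (M + 1) + j : ℕ) : ℝ) - 1 / 2 < s ∧
      s < ((2 + l * (M + 1) + j : ℕ) : ℝ) + 1 / 2 ∧ (A k i = true ∨ B l j = true) := by
  rw [interpSqDist, interpX_natCast, interpY_natCast, leftVertex_clause k hi1 hi] at h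
  simp only at h
  have hzz : ∀ j, (zigzag j : ℝ) = 2 ∨ (zigzag j : ℝ) = 30 := fun j => by
    rcases zigzag_cast j with h | h <;> simp [h]
  have hzi := hzz i
  have hsat : ∀ j, ((if A k i then 29 else 31 : ℕ) : ℝ) = 29 ∨
      ((if B l j then 11 else 9 : ℕ) : ℝ) = 11 → (A k i = true ∨ B l j = true) := by
    intro j
    cases A k i <;> cases B l j <;> norm_num
  have hyA : A k i = true ∧ ((if A k i then 29 else 31 : ℕ) : ℝ) = 29 ∨
      ((if A k i then 29 else 31 : ℕ) : ℝ) = 31 := by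
    cases A k i <;> simp
  have hyB : ∀ j, B l j = true ∧ ((if B l j then 11 else 9 : ℕ) : ℝ) = 11 ∨
      ((if B l j then 11 else 9 : ℕ) : ℝ) = 9 := by
    intro j
    cases B l j <;> simp
  obtain ⟨j, u, hu0, hu1, hjM, rfl, hpos⟩ := right_row_position (B := B) hM hl h1 h2
  rcases hpos with ⟨rfl, hX, hY⟩ | ⟨hj1, hjM', hX, hY⟩ | ⟨rfl, hX, hY⟩
  · rw [hX, hY] at h
    obtain ⟨hxz, hu, hor⟩ := near_of_separator_edge hzi (hzz 1) (left_ordinate _)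
      (right_ordinate _) hu0 hu1.le h
    exact ⟨1, le_rfl, hM, (zigzag_cast_eq hxz).symm, by push_cast; linarith, by push_cast; linarith,
      hsat 1 hor⟩
  · rw [hX, hY] at h
    -- Since 480 - 18 ^ 2 < 14 ^ 2, the abscissas differ by less than 14, half the amplitude 28 of
    -- the zigzag; so the nearest clause vertex on the same side is less than half an edge away. The
    -- vertical offset is at least 29 - 11 = 18.
    have hsmall : ∀ x y : ℝ, x ^ 2 + y ^ 2 < 480 → 18 ≤ y → x < 14 ∧ -14 < x := by
      intro x y hxy hy
      constructor <;> nlinarith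
    have hy18 : 18 ≤ ((if A k i then 29 else 31 : ℕ) : ℝ) -
        ((1 - u) * ((if B l j then 11 else 9 : ℕ) : ℝ) +
          u * ((if B l (j + 1) then 11 else 9 : ℕ) : ℝ)) := by
      rcases hyA with ⟨_, ha⟩ | ha <;> rcases hyB j with ⟨_, hb⟩ | hb <;>
        rcases hyB (j + 1) with ⟨_, hb'⟩ | hb' <;> rw [ha, hb, hb'] <;> linarith
    have hx := hsmall _ _ h hy18
    rcases zigzag_cast_eq_or i j with hij | hij'
    · refine ⟨j, hj1, hjM, (zigzag_cast_eq hij).symm, by linarith, ?_, ?_⟩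
      · rcases zigzag_cast j with ⟨e, e'⟩ | ⟨e, e'⟩ <;> rw [hij, e, e'] at hx <;> linarith
      · rcases hyA with ⟨a, ha⟩ | ha
        · exact Or.inl a
        rcases hyB j with ⟨b, hb⟩ | hb
        · exact Or.inr b
        exfalso
        rw [ha, hb] at h
        have := clause_gap u (right_ordinate (B l (j + 1)))
        rcases zigzag_cast j with ⟨e, e'⟩ | ⟨e, e'⟩ <;> rw [hij, e, e'] at h <;> linarith
    · refine ⟨j + 1, by omega, hjM', (zigzag_cast_eq hij').symm, ?_, by push_cast; linarith, ?_⟩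
      · rcases zigzag_cast j with ⟨e, e'⟩ | ⟨e, e'⟩ <;> rw [hij', e, e'] at hx <;> push_cast <;>
          linarith
      · rcases hyA with ⟨a, ha⟩ | ha
        · exact Or.inl a
        rcases hyB (j + 1) with ⟨b, hb⟩ | hb
        · exact Or.inr b
        exfalso
        rw [ha, hb] at h
        have := clause_gap (1 - u) (right_ordinate (B l j))
        rcases zigzag_cast j with ⟨e, e'⟩ | ⟨e, e'⟩ <;> rw [hij', e, e'] at h <;> linarith
  · have hu : (1 - u) * zigzag j + u * 16 = (1 - (1 - u)) * 16 + (1 - u) * (zigzag j : ℝ) := by ring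
    rw [hX, hY, hu] at h
    obtain ⟨hxz, hu, hor⟩ := near_of_separator_edge hzi (hzz j) (left_ordinate _)
      (right_ordinate _) (sub_nonneg.2 hu1.le) (sub_le_self 1 hu0) h
    exact ⟨j, by omega, le_rfl, (zigzag_cast_eq hxz).symm, by linarith, by linarith, hsat j hor⟩

/-- When the second curve is at clause vertex `j`, the first one is close to a clause vertex of
the same parity. -/
theorem left_near_of_right_clause {k l j : ℕ} (hl : l < L) (hj1 : 1 ≤ j) (hj : j ≤ M)
    {s : ℝ} (h1 : ((k * (M + 2) + 1 : ℕ) : ℝ) ≤ s) (h2 : s ≤ ((k * (M + 2) + M : ℕ) : ℝ))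
    (h : interpSqDist (leftVertex M A) (rightVertex M L B) s
      ((2 + l * (M + 1) + j : ℕ) : ℝ) < 480) :
    ∃ i, i % 2 = j % 2 ∧ ((k * (M + 2) + i : ℕ) : ℝ) - 1 / 2 < s ∧
      s < ((k * (M + 2) + i : ℕ) : ℝ) + 1 / 2 := by
  rw [interpSqDist, interpX_natCast, interpY_natCast, rightVertex_clause hl hj1 hj] at h
  simp only at h
  obtain ⟨i, u, hu0, hu1, hi1, hiM, rfl, hY, hX⟩ := left_row_position (A := A) k h1 h2
  rw [hX] at h
  have hy : 18 ≤ interpY (leftVertex M A) (((k * (M + 2) + i : ℕ) : ℝ) + u) -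
      ((if B l j then 11 else 9 : ℕ) : ℝ) := by
    rcases right_ordinate (B l j) with e | e <;> rw [e] <;> linarith
  have hsmall : ∀ x y : ℝ, x ^ 2 + y ^ 2 < 480 → 18 ≤ y → x < 14 ∧ -14 < x := by
    intro x y hxy hy
    constructor <;> nlinarith
  have hx := hsmall _ _ h hy
  rcases zigzag_cast_eq_or j i with hij | hij'
  · refine ⟨i, (zigzag_cast_eq hij).symm, by linarith, ?_⟩
    rcases zigzag_cast i with ⟨e, e'⟩ | ⟨e, e'⟩ <;> rw [hij, e, e'] at hx <;> linarith
  · refine ⟨i + 1, (zigzag_cast_eq hij').symm, ?_, by push_cast; linarith⟩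
    rcases zigzag_cast i with ⟨e, e'⟩ | ⟨e, e'⟩ <;> rw [hij', e, e'] at hx <;> push_cast <;>
      linarith

end forcing

/-! ### From a cheap traversal to compatible rows; the gap between 400 and 480 -/

section lower

variable {M L : ℕ} {A B : ℕ → ℕ → Bool}

/-- Continuity is not needed: monotonicity and the fact that every vertex is visited suffice. The
discrete case, where all positions are integers, is therefore covered as well. -/
theorem exists_compatible_rows (hM : 1 ≤ M) {f g : unitInterval → ℝ} (hf : Monotone f)
    (hg : Monotone g) (hf0 : ∀ t, 0 ≤ f t) (hf1 : ∀ t, f t ≤ ((L * (M + 2) : ℕ) : ℝ) - 1)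
    (hitf : ∀ i < L * (M + 2), ∃ t, f t = i) (hitg : ∀ j < L * (M + 1) + 5, ∃ t, g t = j)
    (h : ∀ t, interpSqDist (leftVertex M A) (rightVertex M L B) (f t) (g t) < 480) :
    ∃ k < L, ∃ l < L, ∀ i, 1 ≤ i → i ≤ M → A k i = true ∨ B l i = true := by
  obtain ⟨t0, ht0⟩ := hitg 1 (by omega)
  obtain ⟨t1, ht1⟩ := hitg (L * (M + 1) + 3) (by omega)
  have ht01 : t0 ≤ t1 := by
    refine (hg.reflect_lt ?_).le
    rw [ht0, ht1]
    exact_mod_cast (by omega : 1 < L * (M + 1) + 3)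
  obtain ⟨k, hk1, hk2⟩ := left_of_near_origin (A := A) hM (hf0 t0) (by
    have := h t0
    rw [ht0, interpSqDist, interpX_natCast, interpY_natCast, rightVertex_one] at this
    simpa using this)
  obtain ⟨k', hk1', hk2'⟩ := left_of_near_corner (A := A) hM (hf0 t1) (by
    have := h t1
    rw [ht1, interpSqDist, interpX_natCast, interpY_natCast, rightVertex_penultimate] at this
    simpa using this)
  have hkL : k < L := by
    have h1 : ((k * (M + 2) : ℕ) : ℝ) < ((L * (M + 2) : ℕ) : ℝ) := by linarith [hf1 t0]
    exact lt_of_mul_lt_mul_right (by exact_mod_cast h1) (Nat.zero_le (M + 2))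
  have hkk : k ≤ k' := by
    -- The two margins of 1/2 add up to exactly the edge from (20, 16) of row `k'` to (12, 16) of
    -- row `k' + 1`.
    have h1 : ((k * (M + 2) : ℕ) : ℝ) < (((k' + 1) * (M + 2) : ℕ) : ℝ) := by
      have := hf ht01
      push_cast at *
      linarith
    have h2 : k < k' + 1 := lt_of_mul_lt_mul_right (by exact_mod_cast h1) (Nat.zero_le (M + 2))
    omega
  have hkB : (k + 1) * (M + 2) ≤ L * (M + 2) := Nat.mul_le_mul_right _ hkL
  rw [add_mul, one_mul] at hkB
  have hft1 : ((k * (M + 2) + M : ℕ) : ℝ) < f t1 := by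
    refine lt_of_le_of_lt ?_ hk1'
    exact_mod_cast Nat.add_le_add_right (Nat.mul_le_mul_right _ hkk) M
  have hft0 : f t0 < ((k * (M + 2) + 1 : ℕ) : ℝ) := by push_cast at *; linarith
  -- while the first curve is in row `k`, the second one is in a row
  have hrow : ∀ t, ((k * (M + 2) + 1 : ℕ) : ℝ) ≤ f t → f t ≤ ((k * (M + 2) + M : ℕ) : ℝ) →
      ∃ l < L, ((2 + l * (M + 1) : ℕ) : ℝ) < g t ∧ g t < ((2 + (l + 1) * (M + 1) : ℕ) : ℝ) := by
    intro t h1 h2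
    refine right_row_of_high (B := B) ?_ ?_ ?_
    · have := hg (hf.reflect_lt (lt_of_lt_of_le hft0 h1)).le
      rw [ht0] at this
      simpa using this
    · have := hg (hf.reflect_lt (lt_of_le_of_lt h2 hft1)).le
      rwa [ht1] at this
    · obtain ⟨_, _, _, _, _, _, _, hY, _⟩ := left_row_position (A := A) k h1 h2
      have := h t
      rw [interpSqDist] at this
      nlinarith [sq_nonneg (interpX (leftVertex M A) (f t) - interpX (rightVertex M L B) (g t))]
  have hcast : ∀ {a b : ℕ}, a ≤ b → ((k * (M + 2) + a : ℕ) : ℝ) ≤ ((k * (M + 2) + b : ℕ) : ℝ) :=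
    fun hab => by exact_mod_cast Nat.add_le_add_left hab _
  have hτ : ∀ i, ∃ t, 1 ≤ i → i ≤ M → f t = ((k * (M + 2) + i : ℕ) : ℝ) := by
    intro i
    by_cases hi : i ≤ M
    · obtain ⟨t, ht⟩ := hitf (k * (M + 2) + i) (by omega)
      exact ⟨t, fun _ _ => ht⟩
    · exact ⟨t0, fun _ h => absurd h hi⟩
  choose τ hτ using hτ
  have hτ1 := hτ 1 le_rfl hM
  obtain ⟨l, hl, hl1, hl2⟩ := hrow (τ 1) (by rw [hτ1]) (by rw [hτ1]; exact hcast hM)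
  have hlL : (l + 1) * (M + 1) ≤ L * (M + 1) := Nat.mul_le_mul_right _ hl
  -- the second curve stays in row `l`
  have hstay : ∀ t, τ 1 ≤ t → f t ≤ ((k * (M + 2) + M : ℕ) : ℝ) →
      ((2 + l * (M + 1) : ℕ) : ℝ) < g t ∧ g t < ((2 + (l + 1) * (M + 1) : ℕ) : ℝ) := by
    intro t ht htM
    refine ⟨hl1.trans_le (hg ht), ?_⟩
    by_contra hcon
    rw [not_lt] at hcon
    -- To leave row `l`, the right curve has to visit the next separator, at height 0, while the
    -- left curve is still in row `k`; `hrow` forbids this.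
    obtain ⟨t', ht'⟩ := hitg (2 + (l + 1) * (M + 1)) (by omega)
    have h1 : τ 1 ≤ t' := (hg.reflect_lt (by rw [ht']; exact hl2)).le
    have h2 : f t' ≤ ((k * (M + 2) + M : ℕ) : ℝ) := by
      rcases hcon.eq_or_lt with e | hlt
      · rcases le_total t' t with hle | hle
        · exact (hf hle).trans htM
        · obtain ⟨l', _, h3, h4⟩ := hrow t (by rw [← hτ1]; exact hf ht) htM
          exfalso
          rw [← e] at h3 h4
          have h3' : l' * (M + 1) < (l + 1) * (M + 1) := by
            have : 2 + l' * (M + 1) < 2 + (l + 1) * (M + 1) := by exact_mod_cast h3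
            omega
          have h4' : (l + 1) * (M + 1) < (l' + 1) * (M + 1) := by
            have : 2 + (l + 1) * (M + 1) < 2 + (l' + 1) * (M + 1) := by exact_mod_cast h4
            omega
          have := lt_of_mul_lt_mul_right h3' (Nat.zero_le _)
          have := lt_of_mul_lt_mul_right h4' (Nat.zero_le _)
          omega
      · exact (hf (hg.reflect_lt (by rw [ht']; exact hlt)).le).trans htM
    obtain ⟨l', _, h3, h4⟩ := hrow t' (by rw [← hτ1]; exact hf h1) h2
    rw [ht'] at h3 h4
    have h3' : l' * (M + 1) < (l + 1) * (M + 1) := by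
      have : 2 + l' * (M + 1) < 2 + (l + 1) * (M + 1) := by exact_mod_cast h3
      omega
    have h4' : (l + 1) * (M + 1) < (l' + 1) * (M + 1) := by
      have : 2 + (l + 1) * (M + 1) < 2 + (l' + 1) * (M + 1) := by exact_mod_cast h4
      omega
    have := lt_of_mul_lt_mul_right h3' (Nat.zero_le _)
    have := lt_of_mul_lt_mul_right h4' (Nat.zero_le _)
    omega
  have hτle : ∀ i, 1 ≤ i → i ≤ M → τ 1 ≤ τ i := by
    intro i h1 h2
    rcases h1.eq_or_lt with rfl | hlt
    · exact le_rfl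
    · refine (hf.reflect_lt ?_).le
      rw [hτ1, hτ i h1 h2]
      exact_mod_cast Nat.add_lt_add_left hlt _
  have hnear : ∀ i, ∃ j, 1 ≤ i → i ≤ M → 1 ≤ j ∧ j ≤ M ∧ j % 2 = i % 2 ∧
      ((2 + l * (M + 1) + j : ℕ) : ℝ) - 1 / 2 < g (τ i) ∧
      g (τ i) < ((2 + l * (M + 1) + j : ℕ) : ℝ) + 1 / 2 ∧ (A k i = true ∨ B l j = true) := by
    intro i
    by_cases hi : 1 ≤ i ∧ i ≤ M
    · obtain ⟨h1, h2⟩ := hstay (τ i) (hτle i hi.1 hi.2) (by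
        rw [hτ i hi.1 hi.2]
        exact hcast hi.2)
      have h3 := h (τ i)
      rw [hτ i hi.1 hi.2] at h3
      obtain ⟨j, hj⟩ := right_near_of_left_clause hM hl hi.1 hi.2 h1 h2 h3
      exact ⟨j, fun _ _ => hj⟩
    · exact ⟨0, fun h1 h2 => absurd ⟨h1, h2⟩ hi⟩
  choose j hj using hnear
  -- The difference `j (i + 1) - j i` is nonnegative by monotonicity and odd by parity. If it were 3
  -- or more, the left curve, between its vertices `i` and `i + 1`, would be closer to `i + 1` when
  -- the right one visits `j i + 1`, and closer to `i` when it visits `j i + 2`: it would move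
  -- backwards.
  have hstep : ∀ i, 1 ≤ i → i + 1 ≤ M → j (i + 1) = j i + 1 := by
    intro i h1 h2
    obtain ⟨a1, a2, a3, a4, a5, -⟩ := hj i h1 (by omega)
    obtain ⟨b1, b2, b3, b4, b5, -⟩ := hj (i + 1) (by omega) h2
    have hfi := hτ i h1 (by omega)
    have hfi' := hτ (i + 1) (by omega) h2
    have hlt : τ i < τ (i + 1) := by
      refine hf.reflect_lt ?_
      rw [hfi, hfi']
      exact_mod_cast Nat.lt_succ_self _
    have hge : j i < j (i + 1) + 1 := by
      have := hg hlt.le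
      have h3 : (j i : ℝ) < ((j (i + 1) + 1 : ℕ) : ℝ) := by push_cast at *; linarith
      exact_mod_cast h3
    by_contra hne
    have h3 : j i + 3 ≤ j (i + 1) := by omega
    have h3' : (j i : ℝ) + 3 ≤ j (i + 1) := by exact_mod_cast h3
    have hbetween : ∀ d : ℕ, 1 ≤ d → d ≤ 2 → ∃ t, g t = ((2 + l * (M + 1) + (j i + d) : ℕ) : ℝ) ∧
        ((k * (M + 2) + i : ℕ) : ℝ) ≤ f t ∧ f t ≤ ((k * (M + 2) + (i + 1) : ℕ) : ℝ) ∧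
        ∃ i', i' % 2 = (j i + d) % 2 ∧ ((k * (M + 2) + i' : ℕ) : ℝ) - 1 / 2 < f t ∧
          f t < ((k * (M + 2) + i' : ℕ) : ℝ) + 1 / 2 := by
      intro d hd1 hd2
      obtain ⟨t, ht⟩ := hitg (2 + l * (M + 1) + (j i + d)) (by
        rw [add_mul, one_mul] at hlL
        omega)
      have hd1' : (1 : ℝ) ≤ d := by exact_mod_cast hd1
      have hd2' : (d : ℝ) ≤ 2 := by exact_mod_cast hd2
      have c1 : τ i ≤ t := (hg.reflect_lt (by rw [ht]; push_cast at *; linarith)).le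
      have c2 : t ≤ τ (i + 1) := (hg.reflect_lt (by rw [ht]; push_cast at *; linarith)).le
      have c3 := hf c1
      have c4 := hf c2
      rw [hfi] at c3
      rw [hfi'] at c4
      have c5 := h t
      rw [ht] at c5
      exact ⟨t, ht, c3, c4, left_near_of_right_clause hl (by omega) (by omega)
        ((hcast h1).trans c3) (c4.trans (hcast h2)) c5⟩
    obtain ⟨s, hs, s1, s2, i1, hi1, hi1a, hi1b⟩ := hbetween 1 le_rfl one_le_two
    obtain ⟨t, ht, r1, r2, i2, hi2, hi2a, hi2b⟩ := hbetween 2 one_le_two le_rfl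
    have hst : f s ≤ f t := hf (hg.reflect_lt (by rw [hs, ht]; push_cast; linarith)).le
    have e1 : i < i1 + 1 ∧ i1 < i + 2 := by
      constructor
      · have : (i : ℝ) < ((i1 + 1 : ℕ) : ℝ) := by push_cast at *; linarith
        exact_mod_cast this
      · have : (i1 : ℝ) < ((i + 2 : ℕ) : ℝ) := by push_cast at *; linarith
        exact_mod_cast this
    have e2 : i < i2 + 1 ∧ i2 < i + 2 := by
      constructor
      · have : (i : ℝ) < ((i2 + 1 : ℕ) : ℝ) := by push_cast at *; linarith
        exact_mod_cast this
      · have : (i2 : ℝ) < ((i + 2 : ℕ) : ℝ) := by push_cast at *; linarith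
        exact_mod_cast this
    obtain rfl : i1 = i + 1 := by omega
    obtain rfl : i2 = i := by omega
    push_cast at *
    linarith
  have hlin : ∀ i, 1 ≤ i → i ≤ M → j i + 1 = j 1 + i := by
    intro i h1
    induction i, h1 using Nat.le_induction with
    | base => intro _; rfl
    | succ i h1 ih =>
      intro h2
      have := hstep i h1 h2
      have := ih (by omega)
      omega
  -- From `1 ≤ j 1` and `j M ≤ M` no room for a shift is left.
  have hji : ∀ i, 1 ≤ i → i ≤ M → j i = i := by
    intro i h1 h2
    have := hlin i h1 h2
    have := hlin M hM le_rfl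
    have := (hj M hM le_rfl).2.1
    have := (hj 1 le_rfl hM).1
    omega
  refine ⟨k, hkL, l, hl, fun i h1 h2 => ?_⟩
  have := (hj i h1 h2).2.2.2.2.2
  rwa [hji i h1 h2] at this

variable {hL : 0 < L}

theorem exists_compatible_of_cont (hM : 1 ≤ M) {D : ℝ} (hD : D ^ 2 < 480)
    (h : ∃ f ∈ contReparam (leftCurve M L hL A).ofNat.size,
      ∃ g ∈ contReparam (rightCurve M L B).ofNat.size, ∀ t : unitInterval,
        dist ((leftCurve M L hL A).ofNat.point (f t)) ((rightCurve M L B).ofNat.point (g t)) ≤ D) :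
    ∃ k < L, ∃ l < L, ∀ i, 1 ≤ i → i ≤ M → A k i = true ∨ B l i = true := by
  obtain ⟨f, ⟨-, hfm, hfr⟩, g, ⟨-, hgm, hgr⟩, hw⟩ := h
  have hf : ∀ t, f t ∈ Set.Icc (0 : ℝ) (((L * (M + 2) : ℕ) : ℝ) - 1) := fun t =>
    hfr ▸ Set.mem_range_self t
  have hg : ∀ t, g t ∈ Set.Icc (0 : ℝ) (((L * (M + 1) + 5 : ℕ) : ℝ) - 1) := fun t =>
    hgr ▸ Set.mem_range_self t
  refine exists_compatible_rows hM hfm hgm (fun t => (hf t).1) (fun t => (hf t).2)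
    (fun i hi => ?_) (fun i hi => ?_) fun t => ?_
  · have : (i : ℝ) ∈ Set.range f := by
      rw [hfr]
      refine ⟨by positivity, le_sub_iff_add_le.2 ?_⟩
      exact_mod_cast hi
    exact this
  · have : (i : ℝ) ∈ Set.range g := by
      rw [hgr]
      refine ⟨by positivity, le_sub_iff_add_le.2 ?_⟩
      exact_mod_cast hi
    exact this
  · rw [← dist_point_ofNat_sq (P := leftCurve M L hL A) (Q := rightCurve M L B) (fun _ => rfl)
      (fun _ => rfl) (hf t).1 (hf t).2 (hg t).1 (hg t).2]
    exact (pow_le_pow_left₀ dist_nonneg (hw t) 2).trans_lt hD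

theorem exists_compatible_of_disc (hM : 1 ≤ M) {D : ℝ} (hD : D ^ 2 < 480)
    (h : ∃ f ∈ discReparam (leftCurve M L hL A).ofNat.size,
      ∃ g ∈ discReparam (rightCurve M L B).ofNat.size, ∀ t : unitInterval,
        dist ((leftCurve M L hL A).ofNat.vertex (f t))
          ((rightCurve M L B).ofNat.vertex (g t)) ≤ D) :
    ∃ k < L, ∃ l < L, ∀ i, 1 ≤ i → i ≤ M → A k i = true ∨ B l i = true := by
  obtain ⟨f, ⟨hfm, hfs⟩, g, ⟨hgm, hgs⟩, hw⟩ := h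
  have hf : ∀ t, ((f t : ℕ) : ℝ) ≤ ((L * (M + 2) : ℕ) : ℝ) - 1 := fun t => by
    have : (f t : ℕ) + 1 ≤ L * (M + 2) := (f t).2
    rw [le_sub_iff_add_le]
    exact_mod_cast this
  have hg : ∀ t, ((g t : ℕ) : ℝ) ≤ ((L * (M + 1) + 5 : ℕ) : ℝ) - 1 := fun t => by
    have : (g t : ℕ) + 1 ≤ L * (M + 1) + 5 := (g t).2
    rw [le_sub_iff_add_le]
    exact_mod_cast this
  refine exists_compatible_rows (f := fun t => ((f t : ℕ) : ℝ)) (g := fun t => ((g t : ℕ) : ℝ)) hM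
    (fun s t hst => Nat.cast_le.2 (hfm hst)) (fun s t hst => Nat.cast_le.2 (hgm hst))
    (fun t => Nat.cast_nonneg _) hf (fun i hi => ?_) (fun i hi => ?_) fun t => ?_
  · obtain ⟨t, ht⟩ := hfs ⟨i, hi⟩
    exact ⟨t, by simp [ht]⟩
  · obtain ⟨t, ht⟩ := hgs ⟨i, hi⟩
    exact ⟨t, by simp [ht]⟩
  · rw [← dist_point_ofNat_sq (P := leftCurve M L hL A) (Q := rightCurve M L B) (fun _ => rfl)
      (fun _ => rfl) (Nat.cast_nonneg _) (hf t) (Nat.cast_nonneg _) (hg t), Curve.point_natCast,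
      Curve.point_natCast, Curve.vertexAt_of_lt _ (f t).2, Curve.vertexAt_of_lt _ (g t).2]
    exact (pow_le_pow_left₀ dist_nonneg (hw t) 2).trans_lt hD

/-- A distance of planar curves that tells compatible pairs of tables from incompatible ones. -/
structure Separates (d : Curve Plane → Curve Plane → ℝ) : Prop where
  upper : ∀ {M L : ℕ} (hL : 0 < L) (A B : ℕ → ℕ → Bool),
    (∃ k < L, ∃ l < L, ∀ i, 1 ≤ i → i ≤ M → A k i = true ∨ B l i = true) →
      d (leftCurve M L hL A).ofNat (rightCurve M L B).ofNat ^ 2 ≤ 400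
  lower : ∀ {M L : ℕ} (hL : 0 < L) (A B : ℕ → ℕ → Bool),
    (¬ ∃ k < L, ∃ l < L, ∀ i, 1 ≤ i → i ≤ M → A k i = true ∨ B l i = true) →
      480 ≤ d (leftCurve M L hL A).ofNat (rightCurve M L B).ofNat ^ 2

theorem one_le_of_not_compatible (hL : 0 < L)
    (h : ¬ ∃ k < L, ∃ l < L, ∀ i, 1 ≤ i → i ≤ M → A k i = true ∨ B l i = true) : 1 ≤ M := by
  by_contra hM
  exact h ⟨0, hL, 0, hL, fun i h1 h2 => by omega⟩

theorem le_sq_sInf {S : Set ℝ} {c : ℝ} (hne : S.Nonempty) (h0 : ∀ D ∈ S, 0 ≤ D)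
    (hc : ∀ D ∈ S, c ≤ D ^ 2) : c ≤ sInf S ^ 2 := by
  rw [← Real.sqrt_le_left (Real.sInf_nonneg h0)]
  exact le_csInf hne fun D hD => (Real.sqrt_le_left (h0 D hD)).2 (hc D hD)

theorem separates_frechetDist : Separates frechetDist where
  upper := by
    rintro M L hL A B ⟨k, hk, l, hl, h⟩
    obtain ⟨T, f, g, hT, hf, hg, hD⟩ := exists_walks_of_compatible (hL := hL) hk hl h
    have h1 := frechetDist_le (exists_contReparam_of_walk hT hf hg hD)
    nlinarith [frechetDist_nonneg (leftCurve M L hL A).ofNat (rightCurve M L B).ofNat]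
  lower := by
    intro M L hL A B h
    have hM := one_le_of_not_compatible hL h
    obtain ⟨T, f, g, hT, hf, hg, hD⟩ := exists_walks_crude (M := M) (A := A) (B := B) hL
    refine le_sq_sInf ⟨100, exists_contReparam_of_walk hT hf hg hD⟩ ?_ fun D hD => ?_
    · rintro D ⟨F, _, G, _, hE⟩
      exact dist_nonneg.trans (hE 0)
    · by_contra hlt
      exact h (exists_compatible_of_cont hM (not_le.1 hlt) hD)

theorem separates_discreteFrechetDist : Separates discreteFrechetDist where
  upper := by
    rintro M L hL A B ⟨k, hk, l, hl, h⟩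
    obtain ⟨T, f, g, hT, hf, hg, hD⟩ := exists_walks_of_compatible (hL := hL) hk hl h
    have h1 := discreteFrechetDist_le (exists_discReparam_of_walk hT hf hg hD)
    nlinarith [discreteFrechetDist_nonneg (leftCurve M L hL A).ofNat (rightCurve M L B).ofNat]
  lower := by
    intro M L hL A B h
    have hM := one_le_of_not_compatible hL h
    obtain ⟨T, f, g, hT, hf, hg, hD⟩ := exists_walks_crude (M := M) (A := A) (B := B) hL
    refine le_sq_sInf ⟨100, exists_discReparam_of_walk hT hf hg hD⟩ ?_ fun D hD => ?_
    · rintro D ⟨F, _, G, _, hE⟩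
      exact dist_nonneg.trans (hE 0)
    · by_contra hlt
      exact h (exists_compatible_of_disc hM (not_le.1 hlt) hD)

end lower

/-! ## Composing programs -/

/-- With words of `w` bits, `p` started in `s` halts after at most `T` steps in a state that
satisfies `Q`. -/
def Runs (w : ℕ) (p : Prog) (s : State) (T : ℕ) (Q : State → Prop) : Prop :=
  ∃ t s', Exec w p s t s' ∧ t ≤ T ∧ Q s'

namespace Runs

variable {w : ℕ} {p q : Prog} {s : State} {T T₁ T₂ : ℕ} {Q R : State → Prop}

theorem mono (h : Runs w p s T₁ Q) (hT : T₁ ≤ T₂) (hQ : ∀ s, Q s → R s) : Runs w p s T₂ R := by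
  obtain ⟨t, s', h1, h2, h3⟩ := h
  exact ⟨t, s', h1, h2.trans hT, hQ _ h3⟩

theorem instr {i : Instr} (h : Q (i.exec w s)) : Runs w (.instr i) s 1 Q :=
  ⟨_, _, .instr i s, le_rfl, h⟩

theorem skip (h : Q s) : Runs w .skip s 0 Q := ⟨_, _, .skip s, le_rfl, h⟩

theorem seq (h : Runs w p s T₁ fun s' => Runs w q s' T₂ Q) : Runs w (.seq p q) s (T₁ + T₂) Q := by
  obtain ⟨t, s', h1, h2, t', s'', h3, h4, h5⟩ := h
  exact ⟨_, _, .seq h1 h3, by omega, h5⟩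

theorem ite {c : Test} (ht : c.holds s → Runs w p s T Q) (hf : ¬ c.holds s → Runs w q s T Q) :
    Runs w (.ite c p q) s (T + 1) Q := by
  by_cases hc : c.holds s
  · obtain ⟨t, s', h1, h2, h3⟩ := ht hc
    exact ⟨_, _, .ite_true hc h1, by omega, h3⟩
  · obtain ⟨t, s', h1, h2, h3⟩ := hf hc
    exact ⟨_, _, .ite_false hc h1, by omega, h3⟩

/-- The invariant carries the iteration number and decides the test, so there are exactly `n - k`
rounds of cost `T + 1`, plus one failing test. The induction runs downwards from `n`. -/
theorem while_count {c : Test} (I : ℕ → State → Prop) (n : ℕ) {k : ℕ} (hk : k ≤ n)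
    (hc : ∀ k s, I k s → (c.holds s ↔ k < n))
    (hbody : ∀ k < n, ∀ s, I k s → Runs w p s T (I (k + 1))) (h : I k s) :
    Runs w (.while c p) s ((n - k) * (T + 1) + 1) (I n) := by
  induction hk using Nat.decreasingInduction generalizing s with
  | self =>
    exact ⟨_, _, .while_false (by rw [hc n s h]; exact lt_irrefl n), by omega, h⟩
  | of_succ k hkn ih =>
    obtain ⟨t, s', h1, h2, h3⟩ := hbody k hkn s h
    obtain ⟨t', s'', h4, h5, h6⟩ := ih h3
    refine ⟨_, _, .while_true ((hc k s h).2 hkn) h1 h4, ?_, h6⟩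
    obtain ⟨m, rfl⟩ : ∃ m, n = k + 1 + m := ⟨n - (k + 1), by omega⟩
    have e1 : k + 1 + m - (k + 1) = m := by omega
    have e2 : k + 1 + m - k = m + 1 := by omega
    rw [e1] at h5
    rw [e2, add_mul]
    omega

end Runs

/-! ## Frame properties -/

/-- The target of an instruction on words, if it is a register, is below `n`. -/
def Instr.IsLocal (n : ℕ) : Instr → Bool
  | .const r _ | .op _ r _ _ | .load r _ => r < n
  | .store _ _ => true
  | _ => false

/-- The test concerns words. -/
def Test.IsLocal : Test → Bool
  | .lt _ _ | .eq _ _ => true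
  | _ => false

/-- A program of the word RAM that changes only registers below `n`, and memory. -/
def Prog.IsLocal (n : ℕ) : Prog → Bool
  | .skip => true
  | .instr i => i.IsLocal n
  | .seq p q => p.IsLocal n && q.IsLocal n
  | .ite c p q => c.IsLocal && p.IsLocal n && q.IsLocal n
  | .while c p => c.IsLocal && p.IsLocal n

theorem Prog.IsLocal.isWord {n : ℕ} {p : Prog} (h : p.IsLocal n = true) : p.IsWord := by
  have ht : ∀ c : Test, c.IsLocal = true → c.IsWord := by
    intro c
    cases c <;> simp [Test.IsLocal, Test.IsWord]
  induction p with
  | skip => trivial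
  | instr i => cases i <;> simp_all [Prog.IsLocal, Instr.IsLocal, Prog.IsWord, Instr.IsWord]
  | seq p q ihp ihq =>
    simp only [Prog.IsLocal, Bool.and_eq_true] at h
    exact ⟨ihp h.1, ihq h.2⟩
  | ite c p q ihp ihq =>
    simp only [Prog.IsLocal, Bool.and_eq_true] at h
    exact ⟨ht c h.1.1, ihp h.1.2, ihq h.2⟩
  | _ c p ihp =>
    simp only [Prog.IsLocal, Bool.and_eq_true] at h
    exact ⟨ht c h.1, ihp h.2⟩

/-- The parts of the state that programs local to registers below `n` preserve. -/
def SameOutside (n : ℕ) (s s' : State) : Prop :=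
  (∀ r, n ≤ r → s'.reg r = s.reg r) ∧ s'.realReg = s.realReg ∧ s'.realMem = s.realMem

theorem SameOutside.trans {n : ℕ} {s s' s'' : State} (h : SameOutside n s s')
    (h' : SameOutside n s' s'') : SameOutside n s s'' :=
  ⟨fun r hr => (h'.1 r hr).trans (h.1 r hr), h'.2.1.trans h.2.1, h'.2.2.trans h.2.2⟩

/-- With this the building program is known to dirty only registers that are cleared afterwards, and
nothing real, without inspecting its run. -/
theorem Exec.sameOutside {w n : ℕ} {p : Prog} {s s' : State} {t : ℕ} (h : Exec w p s t s')
    (hp : p.IsLocal n = true) : SameOutside n s s' := by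
  induction h with
  | skip s => exact ⟨fun _ _ => rfl, rfl, rfl⟩
  | instr i s =>
    have hupd : ∀ (f : ℕ → ℕ) (r v : ℕ), r < n → ∀ r', n ≤ r' → Function.update f r v r' = f r' :=
      fun f r v hr r' hr' => Function.update_of_ne (by omega) _ _
    cases i <;> simp_all [Prog.IsLocal, Instr.IsLocal, SameOutside, Instr.exec]
  | seq h1 h2 ih1 ih2 =>
    simp only [Prog.IsLocal, Bool.and_eq_true] at hp
    exact (ih1 hp.1).trans (ih2 hp.2)
  | ite_true hc h1 ih =>
    simp only [Prog.IsLocal, Bool.and_eq_true] at hp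
    exact ih hp.1.2
  | ite_false hc h1 ih =>
    simp only [Prog.IsLocal, Bool.and_eq_true] at hp
    exact ih hp.2
  | while_true hc h1 h2 ih1 ih2 =>
    have hp' := hp
    simp only [Prog.IsLocal, Bool.and_eq_true] at hp
    exact (ih1 hp.2).trans (ih2 hp')
  | while_false hc => exact ⟨fun _ _ => rfl, rfl, rfl⟩

/-- All words of the state have `w` bits. -/
def State.Bounded (w : ℕ) (s : State) : Prop :=
  (∀ r, s.reg r < 2 ^ w) ∧ ∀ a, s.mem a < 2 ^ w

/-- The distance algorithm is an arbitrary program; its output words are known to be below `2 ^ w`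
only through this, and the division in the final test needs it. -/
theorem Exec.bounded {w : ℕ} {p : Prog} {s s' : State} {t : ℕ} (h : Exec w p s t s')
    (hs : s.Bounded w) : s'.Bounded w := by
  induction h with
  | skip s => exact hs
  | instr i s =>
    have hupd : ∀ (f : ℕ → ℕ) (r v : ℕ), (∀ r, f r < 2 ^ w) → v < 2 ^ w →
        ∀ r', Function.update f r v r' < 2 ^ w := by
      intro f r v hf hv r'
      rcases eq_or_ne r' r with rfl | hne
      · simpa using hv
      · simpa [Function.update_of_ne hne] using hf r'
    have hpos : 0 < 2 ^ w := by positivity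
    cases i with
    | const r k => exact ⟨hupd _ _ _ hs.1 (Nat.mod_lt _ hpos), hs.2⟩
    | op o r a b => exact ⟨hupd _ _ _ hs.1 (Nat.mod_lt _ hpos), hs.2⟩
    | load r a => exact ⟨hupd _ _ _ hs.1 (hs.2 _), hs.2⟩
    | store a r => exact ⟨hs.1, hupd _ _ _ hs.2 (hs.1 _)⟩
    | _ => exact hs
  | seq h1 h2 ih1 ih2 => exact ih2 (ih1 hs)
  | ite_true hc h1 ih => exact ih hs
  | ite_false hc h1 ih => exact ih hs
  | while_true hc h1 h2 ih1 ih2 => exact ih2 (ih1 hs)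
  | while_false hc => exact hs

/-! ## Expressions -/

/-- Expressions on words. -/
inductive WExpr
  | lit (k : ℕ)
  | reg (r : ℕ)
  | bin (o : WordOp) (a b : WExpr)
  | load (a : WExpr)

namespace WExpr

/-- The value of an expression. -/
def val (w : ℕ) (ρ m : ℕ → ℕ) : WExpr → ℕ
  | lit k => k % 2 ^ w
  | reg r => ρ r
  | bin o a b => o.eval w (a.val w ρ m) (b.val w ρ m)
  | load a => m (a.val w ρ m)

/-- The register that holds the value, when registers from `d` on are used for evaluation. -/
def out (d : ℕ) : WExpr → ℕ
  | reg r => r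
  | _ => d

/-- The program that evaluates an expression, using the registers from `d` on. -/
def code : WExpr → ℕ → Prog
  | lit k, d => .instr (.const d k)
  | reg _, _ => .skip
  | bin o a b, d => .seq (a.code d) (.seq (b.code (d + 1))
      (.instr (.op o d (a.out d) (b.out (d + 1)))))
  | load a, d => .seq (a.code d) (.instr (.load d (a.out d)))

/-- The number of steps for the evaluation. -/
def cost : WExpr → ℕ
  | lit _ => 1
  | reg _ => 0
  | bin _ a b => a.cost + (b.cost + 1)
  | load a => a.cost + 1

/-- All registers are below `n`. -/
def Below (n : ℕ) : WExpr → Prop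
  | lit _ => True
  | reg r => r < n
  | bin _ a b => a.Below n ∧ b.Below n
  | load a => a.Below n

theorem Below.mono {e : WExpr} {n n' : ℕ} (h : e.Below n) (hn : n ≤ n') : e.Below n' := by
  induction e with
  | lit k => trivial
  | reg r => exact lt_of_lt_of_le (h : r < n) hn
  | bin o a b iha ihb => exact ⟨iha h.1, ihb h.2⟩
  | load a ih => exact ih h

theorem val_congr {e : WExpr} {n : ℕ} (h : e.Below n) {w : ℕ} {ρ ρ' m : ℕ → ℕ}
    (hρ : ∀ r < n, ρ r = ρ' r) : e.val w ρ m = e.val w ρ' m := by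
  induction e with
  | lit k => rfl
  | reg r => exact hρ r h
  | bin o a b iha ihb => simp only [val, iha h.1, ihb h.2]
  | load a ih => simp only [val, ih h]

theorem out_le {e : WExpr} {d : ℕ} (h : e.Below d) : e.out d ≤ d := by
  cases e with
  | reg r => exact (h : r < d).le
  | _ => exact le_rfl

/-- The second operand is evaluated with scratch registers from `d + 1` on, so the first result, in
register `d` or in a register below, survives. -/
theorem runs_code (w : ℕ) (e : WExpr) : ∀ (d : ℕ) (s : State), e.Below d →
    Runs w (e.code d) s e.cost fun s' => s'.reg (e.out d) = e.val w s.reg s.mem ∧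
      (∀ r < d, s'.reg r = s.reg r) ∧ s'.mem = s.mem := by
  induction e with
  | lit k =>
    intro d s _
    refine .instr ⟨by simp [Instr.exec, out, val], fun r hr => ?_, rfl⟩
    exact Function.update_of_ne hr.ne _ _
  | reg r => exact fun d s _ => .skip ⟨rfl, fun _ _ => rfl, rfl⟩
  | bin o a b iha ihb =>
    intro d s hd
    refine .seq ((iha d s hd.1).mono le_rfl fun s1 h1 => .seq
      ((ihb (d + 1) s1 (hd.2.mono (Nat.le_succ d))).mono le_rfl fun s2 h2 => .instr ⟨?_, ?_, ?_⟩))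
    · change Function.update s2.reg d (o.eval w (s2.reg (a.out d)) (s2.reg (b.out (d + 1)))) d = _
      rw [Function.update_self, val, h2.2.1 _ (Nat.lt_succ_of_le (out_le hd.1)), h1.1, h2.1,
        h1.2.2, val_congr hd.2 h1.2.1]
    · intro r hr
      exact (Function.update_of_ne hr.ne _ _).trans ((h2.2.1 r (by omega)).trans (h1.2.1 r hr))
    · exact h2.2.2.trans h1.2.2
  | load a ih =>
    intro d s hd
    refine .seq ((ih d s hd).mono le_rfl fun s1 h1 => .instr ⟨?_, ?_, h1.2.2⟩)
    · change Function.update s1.reg d (s1.mem (s1.reg (a.out d))) d = _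
      rw [Function.update_self, val, h1.1, h1.2.2]
    · intro r hr
      exact (Function.update_of_ne hr.ne _ _).trans (h1.2.1 r hr)

end WExpr

/-! ## Structured programs -/

/-- Register `r` := expression. Registers from `20` on are for evaluation. -/
def assign (r : ℕ) (e : WExpr) : Prog :=
  .seq (e.code 20) (.instr (.op .or r (e.out 20) (e.out 20)))

/-- Memory at the first expression := second expression. -/
def storeAt (a e : WExpr) : Prog :=
  .seq (a.code 20) (.seq (e.code 21) (.instr (.store (a.out 20) (e.out 21))))

/-- Branch on whether the first expression is smaller than the second one. -/
def ifLt (a e : WExpr) (p q : Prog) : Prog :=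
  .seq (a.code 20) (.seq (e.code 21) (.ite (.lt (a.out 20) (e.out 21)) p q))

/-- While register `i` is smaller than register `b`, run `p` and then increase register `i`. -/
def forUp (i b : ℕ) (p : Prog) : Prog :=
  .while (.lt i b) (.seq p (assign i (.bin .add (.reg i) (.lit 1))))

/-- `p` started with registers `ρ` (below `20`) and memory `m` halts after at most `T` steps with
registers and memory that satisfy `Q`. -/
def Halts (w : ℕ) (p : Prog) (ρ m : ℕ → ℕ) (T : ℕ) (Q : (ℕ → ℕ) → (ℕ → ℕ) → Prop) : Prop :=
  ∀ s : State, (∀ r < 20, s.reg r = ρ r) → s.mem = m →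
    Runs w p s T fun s' => ∃ ρ', (∀ r < 20, s'.reg r = ρ' r) ∧ Q ρ' s'.mem

namespace Halts

variable {w : ℕ} {p q : Prog} {ρ m : ℕ → ℕ} {T T₁ T₂ : ℕ} {Q R : (ℕ → ℕ) → (ℕ → ℕ) → Prop}

theorem mono (h : Halts w p ρ m T₁ Q) (hT : T₁ ≤ T₂) (hQ : ∀ ρ m, Q ρ m → R ρ m) :
    Halts w p ρ m T₂ R := fun s h1 h2 =>
  (h s h1 h2).mono hT fun _ ⟨ρ', h3, h4⟩ => ⟨ρ', h3, hQ _ _ h4⟩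

theorem time (h : Halts w p ρ m T₁ Q) (hT : T₁ ≤ T₂) : Halts w p ρ m T₂ Q :=
  h.mono hT fun _ _ => id

theorem skip (h : Q ρ m) : Halts w .skip ρ m 0 Q := fun _ h1 h2 =>
  .skip ⟨ρ, h1, h2 ▸ h⟩

theorem seq (h : Halts w p ρ m T₁ fun ρ' m' => Halts w q ρ' m' T₂ Q) :
    Halts w (.seq p q) ρ m (T₁ + T₂) Q := fun s h1 h2 =>
  .seq ((h s h1 h2).mono le_rfl fun s' ⟨_, h3, h4⟩ => h4 s' h3 rfl)

/-- The `or` of a register with itself serves as a move instruction; since results are reduced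
modulo `2 ^ w`, the value has to be a word. -/
theorem assign {r : ℕ} {e : WExpr} (v : ℕ) (he : e.Below 20) (hv : e.val w ρ m = v)
    (hw : v < 2 ^ w) (h : Q (Function.update ρ r v) m) :
    Halts w (assign r e) ρ m (e.cost + 1) Q := by
  intro s h1 h2
  refine .seq ((e.runs_code w 20 s he).mono le_rfl fun s' h3 => .instr
    ⟨Function.update ρ r v, fun r' hr' => ?_, ?_⟩)
  · have h4 : s'.reg (e.out 20) = v := by rw [h3.1, h2, WExpr.val_congr he h1, hv]
    simp only [Instr.exec, WordOp.eval, h4, Nat.or_self, Nat.mod_eq_of_lt hw]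
    rcases eq_or_ne r' r with rfl | hne
    · simp
    · rw [Function.update_of_ne hne, Function.update_of_ne hne, h3.2.1 r' hr', h1 r' hr']
  · change Q _ s'.mem
    rw [h3.2.2, h2]
    exact h

theorem storeAt {a e : WExpr} (i v : ℕ) (ha : a.Below 20) (he : e.Below 20)
    (hi : a.val w ρ m = i) (hv : e.val w ρ m = v) (h : Q ρ (Function.update m i v)) :
    Halts w (storeAt a e) ρ m (a.cost + (e.cost + 1)) Q := by
  intro s h1 h2
  refine .seq ((a.runs_code w 20 s ha).mono le_rfl fun s' h3 => .seq
    ((e.runs_code w 21 s' (he.mono (by norm_num))).mono le_rfl fun s'' h4 => .instr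
      ⟨ρ, fun r' hr' => ?_, ?_⟩))
  · change s''.reg r' = ρ r'
    rw [h4.2.1 r' (by omega), h3.2.1 r' hr', h1 r' hr']
  · change Q ρ (Function.update s''.mem _ _)
    have h5 : s''.reg (a.out 20) = i := by
      rw [h4.2.1 _ (Nat.lt_succ_of_le (WExpr.out_le ha)), h3.1, h2, WExpr.val_congr ha h1, hi]
    have h6 : s''.reg (e.out 21) = v := by
      rw [h4.1, h3.2.2, h2, WExpr.val_congr he h3.2.1, WExpr.val_congr he h1, hv]
    rw [h5, h6, h4.2.2, h3.2.2, h2]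
    exact h

theorem ifLt {a e : WExpr} (i v : ℕ) (ha : a.Below 20) (he : e.Below 20)
    (hi : a.val w ρ m = i) (hv : e.val w ρ m = v) (ht : i < v → Halts w p ρ m T Q)
    (hf : ¬ i < v → Halts w q ρ m T Q) :
    Halts w (ifLt a e p q) ρ m (a.cost + (e.cost + (T + 1))) Q := by
  intro s h1 h2
  refine .seq ((a.runs_code w 20 s ha).mono le_rfl fun s' h3 => .seq
    ((e.runs_code w 21 s' (he.mono (by norm_num))).mono le_rfl fun s'' h4 => ?_))
  have h5 : s''.reg (a.out 20) = i := by
    rw [h4.2.1 _ (Nat.lt_succ_of_le (WExpr.out_le ha)), h3.1, h2, WExpr.val_congr ha h1, hi]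
  have h6 : s''.reg (e.out 21) = v := by
    rw [h4.1, h3.2.2, h2, WExpr.val_congr he h3.2.1, WExpr.val_congr he h1, hv]
  have h7 : ∀ r < 20, s''.reg r = ρ r := fun r hr => by
    rw [h4.2.1 r (by omega), h3.2.1 r hr, h1 r hr]
  have h8 : s''.mem = m := by rw [h4.2.2, h3.2.2, h2]
  refine .ite (fun hc => ?_) (fun hc => ?_)
  · simp only [Test.holds, h5, h6] at hc
    exact ht hc s'' h7 h8
  · simp only [Test.holds, h5, h6] at hc
    exact hf hc s'' h7 h8

/-- A round costs `T` for the body, 3 for the increment and 1 for the test. The body has to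
establish the next invariant for the registers after the increment. -/
theorem forUp {i b : ℕ} (hi : i < 20) (hb : b < 20) (I : ℕ → (ℕ → ℕ) → (ℕ → ℕ) → Prop)
    (n : ℕ) {k : ℕ} (hk : k ≤ n) (hn : n < 2 ^ w)
    (hI : ∀ k ρ m, I k ρ m → ρ i = k ∧ ρ b = n)
    (hbody : ∀ k < n, ∀ ρ m, I k ρ m → Halts w p ρ m T fun ρ' m' =>
      ρ' i = k ∧ I (k + 1) (Function.update ρ' i (k + 1)) m')
    (h : I k ρ m) : Halts w (forUp i b p) ρ m ((n - k) * (T + 4) + 1) (I n) := by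
  intro s h1 h2
  refine Runs.while_count (T := T + 3)
    (fun k s => ∃ ρ', (∀ r < 20, s.reg r = ρ' r) ∧ I k ρ' s.mem) n hk ?_ ?_ ⟨ρ, h1, h2 ▸ h⟩
  · rintro k s ⟨ρ', h3, h4⟩
    obtain ⟨h5, h6⟩ := hI _ _ _ h4
    simp only [Test.holds, h3 i hi, h3 b hb, h5, h6]
  · rintro k hkn s ⟨ρ', h3, h4⟩
    refine Halts.seq ((hbody k hkn _ _ h4).mono le_rfl fun ρ'' m'' h5 => ?_) s h3 rfl
    refine Halts.assign (e := .bin .add (.reg i) (.lit 1)) (k + 1) ⟨hi, trivial⟩ ?_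
      (show k + 1 < 2 ^ w by omega) h5.2
    have : 1 < 2 ^ w := by omega
    simp only [WExpr.val, WordOp.eval, h5.1, Nat.mod_eq_of_lt this]
    exact Nat.mod_eq_of_lt (by omega)

end Halts

/-! ## The program that builds the two curves -/

instance : Add WExpr := ⟨.bin .add⟩
instance : Sub WExpr := ⟨.bin .sub⟩
instance : Mul WExpr := ⟨.bin .mul⟩
instance : Div WExpr := ⟨.bin .div⟩
instance : Mod WExpr := ⟨.bin .mod⟩
instance (n : ℕ) : OfNat WExpr n := ⟨.lit n⟩

namespace WExpr

section val

variable {w : ℕ} {ρ m : ℕ → ℕ} {a b : WExpr} {x y : ℕ}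

theorem val_ofNat {n : ℕ} (h : n < 2 ^ w) : (OfNat.ofNat n : WExpr).val w ρ m = n :=
  Nat.mod_eq_of_lt h

theorem val_load (ha : a.val w ρ m = x) : (load a).val w ρ m = m x := by rw [val, ha]

theorem val_add (ha : a.val w ρ m = x) (hb : b.val w ρ m = y) (h : x + y < 2 ^ w) :
    (a + b).val w ρ m = x + y := by
  change (a.val w ρ m + b.val w ρ m) % 2 ^ w = _
  rw [ha, hb, Nat.mod_eq_of_lt h]

theorem val_mul (ha : a.val w ρ m = x) (hb : b.val w ρ m = y) (h : x * y < 2 ^ w) :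
    (a * b).val w ρ m = x * y := by
  change (a.val w ρ m * b.val w ρ m) % 2 ^ w = _
  rw [ha, hb, Nat.mod_eq_of_lt h]

theorem val_sub (ha : a.val w ρ m = x) (hb : b.val w ρ m = y) (h : y ≤ x) (hx : x < 2 ^ w) :
    (a - b).val w ρ m = x - y := by
  change (a.val w ρ m + 2 ^ w - b.val w ρ m) % 2 ^ w = _
  rw [ha, hb, Nat.sub_add_comm h, Nat.add_mod_right, Nat.mod_eq_of_lt (by omega)]

theorem val_div (ha : a.val w ρ m = x) (hb : b.val w ρ m = y) (hx : x < 2 ^ w) :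
    (a / b).val w ρ m = x / y := by
  change (a.val w ρ m / b.val w ρ m) % 2 ^ w = _
  rw [ha, hb, Nat.mod_eq_of_lt ((Nat.div_le_self _ _).trans_lt hx)]

theorem val_mod (ha : a.val w ρ m = x) (hb : b.val w ρ m = y) (hx : x < 2 ^ w) :
    (a % b).val w ρ m = x % y := by
  change (a.val w ρ m % b.val w ρ m) % 2 ^ w = _
  rw [ha, hb, Nat.mod_eq_of_lt ((Nat.mod_le _ _).trans_lt hx)]

theorem val_shr (ha : a.val w ρ m = x) (hb : b.val w ρ m = y) (hx : x < 2 ^ w) :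
    (bin .shr a b).val w ρ m = x / 2 ^ y := by
  change (a.val w ρ m / 2 ^ b.val w ρ m) % 2 ^ w = _
  rw [ha, hb, Nat.mod_eq_of_lt ((Nat.div_le_self _ _).trans_lt hx)]

theorem val_shl (ha : a.val w ρ m = x) (hb : b.val w ρ m = y) (h : x * 2 ^ y < 2 ^ w) :
    (bin .shl a b).val w ρ m = x * 2 ^ y := by
  change (a.val w ρ m * 2 ^ b.val w ρ m) % 2 ^ w = _
  rw [ha, hb, Nat.mod_eq_of_lt h]

end val

/-- Whether all registers are below `n`. -/
def usesBelow (n : ℕ) : WExpr → Bool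
  | lit _ => true
  | reg r => r < n
  | bin _ a b => a.usesBelow n && b.usesBelow n
  | load a => a.usesBelow n

theorem below_of_usesBelow {n : ℕ} {e : WExpr} (h : e.usesBelow n = true) : e.Below n := by
  induction e with
  | lit k => trivial
  | reg r => exact of_decide_eq_true (p := r < n) h
  | bin o a b iha ihb =>
    simp only [usesBelow, Bool.and_eq_true] at h
    exact ⟨iha h.1, ihb h.2⟩
  | load a ih => exact ih h

end WExpr

/-- Assign expressions to consecutive registers. -/
def assignAll (d : ℕ) : List WExpr → Prog
  | [] => .skip
  | e :: es => .seq (assign d e) (assignAll (d + 1) es)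

/-- Change the values at consecutive arguments. -/
def updateAll (ρ : ℕ → ℕ) (d : ℕ) : List ℕ → ℕ → ℕ
  | [] => ρ
  | v :: vs => updateAll (Function.update ρ d v) (d + 1) vs

theorem updateAll_of_lt {r d : ℕ} (h : r < d) (vs : List ℕ) (ρ : ℕ → ℕ) :
    updateAll ρ d vs r = ρ r := by
  induction vs generalizing d ρ with
  | nil => rfl
  | cons v vs ih => rw [updateAll, ih (by omega), Function.update_of_ne h.ne]

namespace Halts

variable {w : ℕ} {p q : Prog} {ρ m : ℕ → ℕ} {T : ℕ} {Q : (ℕ → ℕ) → (ℕ → ℕ) → Prop}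

/-- The expressions read only registers below `n ≤ d`, which the assignments do not touch; hence all
values may refer to the registers `ρ₀` at the start. -/
theorem assignAll {n d : ℕ} {es : List WExpr} {vs : List ℕ} {ρ₀ : ℕ → ℕ} (hn : n ≤ d)
    (hn' : n ≤ 20) (hρ : ∀ r < n, ρ r = ρ₀ r)
    (h : List.Forall₂ (fun e v => e.usesBelow n = true ∧ e.val w ρ₀ m = v ∧ v < 2 ^ w) es vs)
    (hQ : Q (updateAll ρ d vs) m) :
    Halts w (assignAll d es) ρ m (es.map fun e => e.cost + 1).sum Q := by
  induction h generalizing ρ d with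
  | nil => exact .skip hQ
  | @cons e v es vs hev h ih =>
    have he := WExpr.below_of_usesBelow hev.1
    refine .seq (Halts.assign v (he.mono hn') ((WExpr.val_congr he hρ).trans hev.2.1) hev.2.2
      (ih (by omega) (fun r hr => ?_) hQ))
    rw [Function.update_of_ne (by omega), hρ r hr]

theorem ifLt_le {T' : ℕ} {a e : WExpr} (i v : ℕ) (hT : a.cost + (e.cost + (T + 1)) ≤ T')
    (ha : a.usesBelow 20 = true) (he : e.usesBelow 20 = true)
    (hi : a.val w ρ m = i) (hv : e.val w ρ m = v) (ht : i < v → Halts w p ρ m T Q)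
    (hf : ¬ i < v → Halts w q ρ m T Q) : Halts w (_root_.ifLt a e p q) ρ m T' Q :=
  (Halts.ifLt i v (WExpr.below_of_usesBelow ha) (WExpr.below_of_usesBelow he) hi hv ht hf).time hT

end Halts

theorem WExpr.val_small {w : ℕ} (hw : 100 < 2 ^ w) {ρ m : ℕ → ℕ} (n : ℕ)
    (hn : Nat.ble n 100 = true) : (OfNat.ofNat n : WExpr).val w ρ m = n :=
  val_ofNat ((Nat.le_of_ble_eq_true hn).trans_lt hw)

open WExpr in
/-- Registers `10` to `16` := abscissa, ordinate if the clause is satisfied, ordinate if not,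
first variable, bound for the variables, assignment, and offset of the clause, for vertex
number `reg 8`. -/
def vertexSpecProg : Prog :=
  ifLt (reg 8) (reg 4)
    (ifLt (reg 8 % (reg 1 + 2)) 1 (assignAll 10 [12, 16, 16, 0, 0, 0, 0])
      (ifLt (reg 8 % (reg 1 + 2)) (reg 1 + 1)
        (assignAll 10 [2 + 28 * (reg 8 % (reg 1 + 2) % 2), 29, 31, 0, reg 2, reg 8 / (reg 1 + 2),
          (reg 8 % (reg 1 + 2) - 1) * reg 0])
        (assignAll 10 [20, 16, 16, 0, 0, 0, 0])))
    (ifLt (reg 8 - reg 4) 1 (assignAll 10 [16, 20, 20, 0, 0, 0, 0])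
      (ifLt (reg 8 - reg 4) 2 (assignAll 10 [0, 0, 0, 0, 0, 0, 0])
        (ifLt (reg 8 - reg 4) (reg 3 * (reg 1 + 1) + 3)
          (ifLt ((reg 8 - reg 4 - 2) % (reg 1 + 1)) 1 (assignAll 10 [16, 0, 0, 0, 0, 0, 0])
            (assignAll 10 [2 + 28 * ((reg 8 - reg 4 - 2) % (reg 1 + 1) % 2), 11, 9, reg 2, reg 0,
              (reg 8 - reg 4 - 2) / (reg 1 + 1) * reg 3,
              ((reg 8 - reg 4 - 2) % (reg 1 + 1) - 1) * reg 0]))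
          (ifLt (reg 8 - reg 4) (reg 3 * (reg 1 + 1) + 4) (assignAll 10 [32, 0, 0, 0, 0, 0, 0])
            (assignAll 10 [16, 20, 20, 0, 0, 0, 0])))))

open WExpr in
/-- Register `17` := number of literals over the variables from `reg 13` to `reg 14` that the
assignment `reg 15` satisfies in the clause at offset `reg 16`. -/
def clauseProg : Prog :=
  .seq (assign 17 0) (forUp 13 14
    (ifLt (bin .shr (reg 15) (reg 13) % 2) 1
      (assign 17 (reg 17 + load (reg 6 + (3 + 2 * (reg 16 + reg 13)))))
      (assign 17 (reg 17 + load (reg 6 + (2 + 2 * (reg 16 + reg 13)))))))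

open WExpr in
/-- Write the coordinates of vertex number `reg 8`. -/
def vertexProg : Prog :=
  .seq vertexSpecProg (.seq clauseProg (.seq (storeAt (2 + 2 * reg 8) (reg 10))
    (ifLt 0 (reg 17) (storeAt (3 + 2 * reg 8) (reg 11)) (storeAt (3 + 2 * reg 8) (reg 12)))))

/-- The numbers that govern the construction: the formula has `N` variables and `M` clauses, there
are `L` assignments of the first `h` variables, the curves have `p` and `q` vertices, and the copy
of the formula, of length `K`, stands at address `H`. -/
structure Layout (w : ℕ) where
  (N M h L p q H K : ℕ)
  L_eq : L = 2 ^ h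
  h_le : h ≤ N
  p_eq : p = L * (M + 2)
  q_eq : q = L * (M + 1) + 5
  H_eq : H = 2 + 2 * (p + q)
  K_eq : K = 2 + 2 * (M * N)
  K_le : K ≤ H
  bound : 2 * H + K + L * L + N + M + 100 < 2 ^ w

/-- The registers hold the numbers of the layout. -/
structure Layout.Loaded {w : ℕ} (l : Layout w) (ρ : ℕ → ℕ) : Prop where
  N : ρ 0 = l.N
  M : ρ 1 = l.M
  h : ρ 2 = l.h
  L : ρ 3 = l.L
  p : ρ 4 = l.p
  q : ρ 5 = l.q
  H : ρ 6 = l.H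
  K : ρ 7 = l.K
  t : ρ 9 = l.p + l.q

theorem Layout.Loaded.congr {w : ℕ} {l : Layout w} {ρ ρ' : ℕ → ℕ} (h : l.Loaded ρ)
    (h' : ∀ r < 10, r ≠ 8 → ρ' r = ρ r) : l.Loaded ρ' := by
  constructor <;> rw [h' _ (by norm_num) (by norm_num)]
  exacts [h.N, h.M, h.h, h.L, h.p, h.q, h.H, h.K, h.t]

/-- What has to be known of a vertex. -/
structure VertexSpec where
  (x sat unsat lo hi num base : ℕ)

namespace VertexSpec

/-- The components as a list. -/
def toList (d : VertexSpec) : List ℕ := [d.x, d.sat, d.unsat, d.lo, d.hi, d.num, d.base]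

/-- A vertex that does not depend on a clause. -/
def fixed (x y : ℕ) : VertexSpec := ⟨x, y, y, 0, 0, 0, 0⟩

end VertexSpec

/-! ### Specifications of the vertices and the program that computes them -/

namespace Layout

variable {w : ℕ} (l : Layout w)

theorem L_pos : 0 < l.L := by
  rw [l.L_eq]
  positivity

/-- The specification of vertex number `x`, where the vertices of the second curve come after
those of the first one. -/
def vertexSpec (x : ℕ) : VertexSpec :=
  if x < l.p then
    if x % (l.M + 2) < 1 then .fixed 12 16
    else if x % (l.M + 2) < l.M + 1 then
      ⟨2 + 28 * (x % (l.M + 2) % 2), 29, 31, 0, l.h, x / (l.M + 2), (x % (l.M + 2) - 1) * l.N⟩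
    else .fixed 20 16
  else if x - l.p < 1 then .fixed 16 20
  else if x - l.p < 2 then .fixed 0 0
  else if x - l.p < l.L * (l.M + 1) + 3 then
    if (x - l.p - 2) % (l.M + 1) < 1 then .fixed 16 0
    else ⟨2 + 28 * ((x - l.p - 2) % (l.M + 1) % 2), 11, 9, l.h, l.N,
      (x - l.p - 2) / (l.M + 1) * l.L, ((x - l.p - 2) % (l.M + 1) - 1) * l.N⟩
  else if x - l.p < l.L * (l.M + 1) + 4 then .fixed 32 0
  else .fixed 16 20

/-- These bounds make the clause evaluation safe: a loop of length at most `N`, an assignment number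
that fits into a word, and reads inside the formula. -/
structure SpecBounds (d : VertexSpec) : Prop where
  lo_le : d.lo ≤ d.hi
  hi_le : d.hi ≤ l.N
  num : d.num ≤ l.H + l.L * l.L
  offset : ∀ v < d.hi, d.base + v < l.M * l.N

theorem specBounds_fixed (x y : ℕ) : l.SpecBounds (.fixed x y) :=
  ⟨le_rfl, Nat.zero_le _, Nat.zero_le _, fun _ h => absurd h (by simp [VertexSpec.fixed])⟩

theorem offset_lt {i v : ℕ} (h0 : ¬ i < 1) (h1 : i < l.M + 1) (hv : v < l.N) :
    (i - 1) * l.N + v < l.M * l.N := by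
  have : (i - 1 + 1) * l.N ≤ l.M * l.N := Nat.mul_le_mul_right _ (by omega)
  rw [add_mul, one_mul] at this
  omega

theorem base_le {i : ℕ} (h1 : i < l.M + 1) : (i - 1) * l.N ≤ l.M * l.N :=
  Nat.mul_le_mul_right _ (by omega)

/-- The only position in this range with quotient `L` is the last separator, whose remainder is 0.
-/
theorem row_lt {x : ℕ} (h0 : ¬ x < 2) (h : x < l.L * (l.M + 1) + 3)
    (h1 : ¬ (x - 2) % (l.M + 1) < 1) : (x - 2) / (l.M + 1) < l.L := by
  rw [Nat.div_lt_iff_lt_mul (by omega)]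
  rcases lt_or_eq_of_le (show x - 2 ≤ l.L * (l.M + 1) by omega) with h2 | h2
  · exact h2
  · rw [h2] at h1
    simp at h1

theorem specBounds {x : ℕ} (hx : x < l.p + l.q) : l.SpecBounds (l.vertexSpec x) := by
  have hH := l.H_eq
  unfold vertexSpec
  split_ifs with h1 h2 h3 h4 h5 h6 h7 h8
  · exact l.specBounds_fixed _ _
  · exact ⟨Nat.zero_le _, l.h_le, by have := Nat.div_le_self x (l.M + 2); simp only; omega,
      fun v hv => l.offset_lt h2 h3 (lt_of_lt_of_le hv l.h_le)⟩
  · exact l.specBounds_fixed _ _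
  · exact l.specBounds_fixed _ _
  · exact l.specBounds_fixed _ _
  · exact l.specBounds_fixed _ _
  · exact ⟨l.h_le, le_rfl,
      (Nat.mul_le_mul_right _ (l.row_lt h5 h6 h7).le).trans (Nat.le_add_left _ _),
      fun v hv => l.offset_lt h7 (Nat.mod_lt _ (by omega)) hv⟩
  · exact l.specBounds_fixed _ _
  · exact l.specBounds_fixed _ _

/-- A vertex without clause gets an empty range of variables and equal ordinates for both outcomes,
so that the same clause evaluation can follow in all cases. -/
theorem halts_fixed {w : ℕ} (hb : 100 < 2 ^ w) {x y : ℕ} (hx : x ≤ 32) (hy : y ≤ 32) {ρ m : ℕ → ℕ}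
    {Q : (ℕ → ℕ) → (ℕ → ℕ) → Prop} (hQ : Q (updateAll ρ 10 (VertexSpec.fixed x y).toList) m) :
    Halts w (assignAll 10 [OfNat.ofNat x, OfNat.ofNat y, OfNat.ofNat y, 0, 0, 0, 0]) ρ m 100 Q := by
  have h0 : (0 : WExpr).usesBelow 10 = true ∧ (0 : WExpr).val w ρ m = 0 ∧ 0 < 2 ^ w :=
    ⟨rfl, WExpr.val_small hb 0 rfl, by omega⟩
  have h1 : ∀ z ≤ 32, (OfNat.ofNat z : WExpr).usesBelow 10 = true ∧
      (OfNat.ofNat z : WExpr).val w ρ m = z ∧ z < 2 ^ w := fun z hz =>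
    ⟨rfl, WExpr.val_ofNat (by omega), by omega⟩
  refine (Halts.assignAll (n := 10) le_rfl (by norm_num) (fun _ _ => rfl)
    (.cons (h1 x hx) (.cons (h1 y hy) (.cons (h1 y hy) (.cons h0 (.cons h0 (.cons h0
    (.cons h0 .nil))))))) hQ).time ?_
  simp +decide [OfNat.ofNat, WExpr.cost]

/-- Program and specification make the same case distinction. The numbers `T` are generous budgets
that shrink with each nested test. -/
theorem halts_vertexSpecProg {x : ℕ} (hx : x < l.p + l.q) {ρ m : ℕ → ℕ} (hρ : l.Loaded ρ)
    (h8 : ρ 8 = x) : Halts w vertexSpecProg ρ m 300 fun ρ' m' =>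
      m' = m ∧ ρ' = updateAll ρ 10 (l.vertexSpec x).toList := by
  have hb := l.bound
  have hH := l.H_eq
  have hK := l.K_eq
  have hq := l.q_eq
  have hw : 100 < 2 ^ w := by omega
  have hlit := fun n => WExpr.val_small hw (ρ := ρ) (m := m) n
  have hM2 : (WExpr.reg 1 + 2 : WExpr).val w ρ m = l.M + 2 :=
    WExpr.val_add hρ.M (hlit 2 rfl) (by omega)
  have hM1 : (WExpr.reg 1 + 1 : WExpr).val w ρ m = l.M + 1 :=
    WExpr.val_add hρ.M (hlit 1 rfl) (by omega)
  have hi : (WExpr.reg 8 % (WExpr.reg 1 + 2) : WExpr).val w ρ m = x % (l.M + 2) :=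
    WExpr.val_mod h8 hM2 (by omega)
  have hi' := Nat.mod_lt x (show 0 < l.M + 2 by omega)
  have hpar : ∀ {e : WExpr} {i : ℕ}, e.val w ρ m = i → i < 2 ^ w →
      (2 + 28 * (e % 2) : WExpr).val w ρ m = 2 + 28 * (i % 2) := fun he hi =>
    WExpr.val_add (hlit 2 rfl) (WExpr.val_mul (hlit 28 rfl)
      (WExpr.val_mod he (hlit 2 rfl) hi) (by omega)) (by omega)
  have hbase : ∀ {e : WExpr} {i : ℕ}, e.val w ρ m = i → ¬ i < 1 → i < l.M + 1 →
      ((e - 1) * WExpr.reg 0 : WExpr).val w ρ m = (i - 1) * l.N := fun he hi1 hi2 =>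
    WExpr.val_mul (WExpr.val_sub he (hlit 1 rfl) (by omega) (by omega)) hρ.N
      (by have := l.base_le hi2; omega)
  unfold vertexSpecProg vertexSpec
  refine Halts.ifLt_le (T := 290) x l.p (by decide) rfl rfl h8 hρ.p (fun c1 => ?_) (fun c1 => ?_)
  · rw [if_pos c1]
    refine Halts.ifLt_le (T := 270) _ 1 (by decide) rfl rfl hi (hlit 1 rfl) (fun c2 => ?_)
      (fun c2 => ?_)
    · rw [if_pos c2]
      exact (halts_fixed hw (x := 12) (y := 16) (by norm_num) (by norm_num) ⟨rfl, rfl⟩).time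
        (by norm_num)
    rw [if_neg c2]
    refine Halts.ifLt_le (T := 250) _ (l.M + 1) (by decide) rfl rfl hi hM1 (fun c3 => ?_)
      (fun c3 => ?_)
    · rw [if_pos c3]
      have hdiv := Nat.div_le_self x (l.M + 2)
      have hbl := l.base_le c3
      have hhN := l.h_le
      refine Halts.time (Halts.assignAll (n := 10) (vs := [_, _, _, _, _, _, _])
        le_rfl (by norm_num)
        (fun _ _ => rfl)
        (.cons ⟨rfl, hpar hi (by omega), by omega⟩ (.cons ⟨rfl, hlit 29 rfl, by omega⟩
        (.cons ⟨rfl, hlit 31 rfl, by omega⟩ (.cons ⟨rfl, hlit 0 rfl, by omega⟩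
        (.cons ⟨rfl, hρ.h, by omega⟩ (.cons ⟨rfl, WExpr.val_div h8 hM2 (by omega), by omega⟩
        (.cons ⟨rfl, hbase hi c2 c3, by omega⟩ .nil))))))) ⟨rfl, rfl⟩) (by decide)
    · rw [if_neg c3]
      exact (halts_fixed hw (x := 20) (y := 16) (by norm_num) (by norm_num) ⟨rfl, rfl⟩).time
        (by norm_num)
  · rw [if_neg c1]
    have hy : (WExpr.reg 8 - WExpr.reg 4 : WExpr).val w ρ m = x - l.p :=
      WExpr.val_sub h8 hρ.p (by omega) (by omega)
    refine Halts.ifLt_le (T := 280) _ 1 (by decide) rfl rfl hy (hlit 1 rfl) (fun c2 => ?_)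
      (fun c2 => ?_)
    · rw [if_pos c2]
      exact (halts_fixed hw (x := 16) (y := 20) (by norm_num) (by norm_num) ⟨rfl, rfl⟩).time
        (by norm_num)
    rw [if_neg c2]
    refine Halts.ifLt_le (T := 260) _ 2 (by decide) rfl rfl hy (hlit 2 rfl) (fun c3 => ?_)
      (fun c3 => ?_)
    · rw [if_pos c3]
      exact (halts_fixed hw (x := 0) (y := 0) (by norm_num) (by norm_num) ⟨rfl, rfl⟩).time
        (by norm_num)
    rw [if_neg c3]
    have hLM : (WExpr.reg 3 * (WExpr.reg 1 + 1) : WExpr).val w ρ m = l.L * (l.M + 1) :=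
      WExpr.val_mul hρ.L hM1 (by omega)
    refine Halts.ifLt_le (T := 240) _ (l.L * (l.M + 1) + 3) (by decide) rfl rfl hy
      (WExpr.val_add hLM (hlit 3 rfl) (by omega)) (fun c4 => ?_) (fun c4 => ?_)
    · rw [if_pos c4]
      have hz : (WExpr.reg 8 - WExpr.reg 4 - 2 : WExpr).val w ρ m = x - l.p - 2 :=
        WExpr.val_sub hy (hlit 2 rfl) (by omega) (by omega)
      have hj : ((WExpr.reg 8 - WExpr.reg 4 - 2) % (WExpr.reg 1 + 1) : WExpr).val w ρ m =
        (x - l.p - 2) % (l.M + 1) := WExpr.val_mod hz hM1 (by omega)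
      have hj' := Nat.mod_lt (x - l.p - 2) (show 0 < l.M + 1 by omega)
      refine Halts.ifLt_le (T := 220) _ 1 (by decide) rfl rfl hj (hlit 1 rfl)
        (fun c5 => ?_) (fun c5 => ?_)
      · rw [if_pos c5]
        exact (halts_fixed hw (x := 16) (y := 0) (by norm_num) (by norm_num) ⟨rfl, rfl⟩).time
          (by norm_num)
      rw [if_neg c5]
      have hbl := l.base_le hj'
      have hhN := l.h_le
      have hrow := Nat.mul_le_mul_right l.L (l.row_lt c3 c4 c5).le
      refine Halts.time (Halts.assignAll (n := 10) (vs := [_, _, _, _, _, _, _])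
        le_rfl (by norm_num)
        (fun _ _ => rfl)
        (.cons ⟨rfl, hpar hj (by omega), by omega⟩ (.cons ⟨rfl, hlit 11 rfl, by omega⟩
        (.cons ⟨rfl, hlit 9 rfl, by omega⟩ (.cons ⟨rfl, hρ.h, by omega⟩
        (.cons ⟨rfl, hρ.N, by omega⟩ (.cons ⟨rfl, WExpr.val_mul (WExpr.val_div hz hM1 (by omega))
          hρ.L (by omega), by omega⟩
        (.cons ⟨rfl, hbase hj c5 hj', by omega⟩ .nil))))))) ⟨rfl, rfl⟩) (by decide)
    · rw [if_neg c4]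
      refine Halts.ifLt_le (T := 220) _ (l.L * (l.M + 1) + 4) (by decide) rfl rfl hy
        (WExpr.val_add hLM (hlit 4 rfl) (by omega)) (fun c5 => ?_) (fun c5 => ?_)
      · rw [if_pos c5]
        exact (halts_fixed hw (x := 32) (y := 0) (by norm_num) (by norm_num) ⟨rfl, rfl⟩).time
          (by norm_num)
      · rw [if_neg c5]
        exact (halts_fixed hw (x := 16) (y := 20) (by norm_num) (by norm_num) ⟨rfl, rfl⟩).time
          (by norm_num)

end Layout

/-- The bit of the formula `fm` that says whether the assignment `num` makes true a literal of
variable `v` in the clause at offset `base`. -/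
def literalBit (fm : ℕ → ℕ) (num base v : ℕ) : ℕ :=
  if num / 2 ^ v % 2 < 1 then fm (3 + 2 * (base + v)) else fm (2 + 2 * (base + v))

/-- Whether the assignment `num` satisfies the clause at offset `base` by one of the variables from
`lo` to `hi`. -/
def clauseSat (fm : ℕ → ℕ) (lo hi num base : ℕ) : Bool :=
  decide (∃ v < hi, lo ≤ v ∧ 0 < literalBit fm num base v)

/-- The coordinates of a vertex. -/
def VertexSpec.eval (fm : ℕ → ℕ) (d : VertexSpec) : ℕ × ℕ :=
  (d.x, if clauseSat fm d.lo d.hi d.num d.base then d.sat else d.unsat)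

/-! ### Evaluating a clause under a partial assignment -/

namespace Layout

variable {w : ℕ} (l : Layout w)

/-- The memory from address `l.H` on is a copy of `fm`. -/
def Copied (fm m : ℕ → ℕ) : Prop := ∀ a, m (l.H + a) = fm a

/-- The part of `fm` that describes the clauses consists of bits. -/
def IsBits (fm : ℕ → ℕ) : Prop := ∀ a < 2 * (l.M * l.N), fm (2 + a) ≤ 1

theorem literalBit_le_one {fm : ℕ → ℕ} (hfm : l.IsBits fm) {base v : ℕ} (num : ℕ)
    (h : base + v < l.M * l.N) : literalBit fm num base v ≤ 1 := by
  unfold literalBit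
  split_ifs
  · have := hfm (1 + 2 * (base + v)) (by omega)
    rwa [show 2 + (1 + 2 * (base + v)) = 3 + 2 * (base + v) by omega] at this
  · exact hfm (2 * (base + v)) (by omega)

theorem halts_clauseProg {fm ρ m : ℕ → ℕ} {d : VertexSpec} (hfm : l.IsBits fm)
    (hd : l.SpecBounds d) (hm : l.Copied fm m) (h6 : ρ 6 = l.H) (h13 : ρ 13 = d.lo)
    (h14 : ρ 14 = d.hi) (h15 : ρ 15 = d.num) (h16 : ρ 16 = d.base) :
    Halts w clauseProg ρ m (l.N * 30 + 3) fun ρ' m' => m' = m ∧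
      (0 < ρ' 17 ↔ clauseSat fm d.lo d.hi d.num d.base = true) ∧
      ∀ r < 20, r ≠ 13 → r ≠ 17 → ρ' r = ρ r := by
  have hb := l.bound
  have hK := l.K_eq
  have hw : 100 < 2 ^ w := by omega
  refine (Halts.seq (T₁ := 2) (T₂ := (d.hi - d.lo) * (26 + 4) + 1)
    (Halts.assign (e := 0) 0 trivial (WExpr.val_small hw 0 rfl) (by omega) ?_)).time
    (by have := Nat.mul_le_mul_right 30 ((Nat.sub_le d.hi d.lo).trans hd.hi_le); omega)
  -- Each round adds a bit, so `ρ' 17 ≤ k` excludes an overflow, after which a positive count could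
  -- look like 0.
  let I : ℕ → (ℕ → ℕ) → (ℕ → ℕ) → Prop := fun k ρ' m' => m' = m ∧ d.lo ≤ k ∧ ρ' 13 = k ∧ ρ' 17 ≤ k ∧
    (0 < ρ' 17 ↔ ∃ v < k, d.lo ≤ v ∧ 0 < literalBit fm d.num d.base v) ∧
    ∀ r < 20, r ≠ 13 → r ≠ 17 → ρ' r = ρ r
  refine Halts.mono (Halts.forUp (by norm_num) (by norm_num) I d.hi hd.lo_le
    (by have := hd.hi_le; omega) ?_ ?_ ?_) le_rfl ?_
  · rintro k ρ' m' ⟨-, -, h1, -, -, h5⟩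
    exact ⟨h1, (h5 14 (by norm_num) (by norm_num) (by norm_num)).trans h14⟩
  · rintro k hk ρ' m' ⟨rfl, h0, h1, h2, h3, h4⟩
    have hk' := hd.offset k hk
    have hkN := hd.hi_le
    have hnum := hd.num
    have e6 := (h4 6 (by norm_num) (by norm_num) (by norm_num)).trans h6
    have e15 := (h4 15 (by norm_num) (by norm_num) (by norm_num)).trans h15
    have e16 := (h4 16 (by norm_num) (by norm_num) (by norm_num)).trans h16
    have hlit := fun n => WExpr.val_small hw (ρ := ρ') (m := m') n
    have hstep : ∀ {e : WExpr}, e.usesBelow 20 = true →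
        e.val w ρ' m' = literalBit fm d.num d.base k → ∀ {T}, e.cost + 2 ≤ T →
        Halts w (assign 17 (WExpr.reg 17 + e)) ρ' m' T fun ρ'' m'' =>
          ρ'' 13 = k ∧ I (k + 1) (Function.update ρ'' 13 (k + 1)) m'' := by
      intro e he hev T hT
      have hbit := l.literalBit_le_one hfm d.num hk'
      refine Halts.time (Halts.assign (ρ' 17 + literalBit fm d.num d.base k)
        ⟨by simp [WExpr.Below], WExpr.below_of_usesBelow he⟩
        (WExpr.val_add rfl hev (by omega)) (by omega) ⟨by simpa using h1, rfl, by omega, by simp,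
          ?_, ?_, ?_⟩)
        ?_
      · simp
        omega
      · rw [Function.update_of_ne (show 17 ≠ 13 by norm_num), Function.update_self]
        constructor
        · intro hpos
          rcases Nat.eq_zero_or_pos (literalBit fm d.num d.base k) with h0 | h0
          · obtain ⟨v, hv, hv'⟩ := h3.1 (by omega)
            exact ⟨v, by omega, hv'⟩
          · exact ⟨k, by omega, by assumption, h0⟩
        · rintro ⟨v, hv, hv'⟩
          rcases Nat.lt_succ_iff_lt_or_eq.1 hv with hlt | rfl
          · have := h3.2 ⟨v, hlt, hv'⟩
            omega
          · omega
      · intro r hr h13 h17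
        rw [Function.update_of_ne h13, Function.update_of_ne h17, h4 r hr h13 h17]
      · change 0 + (e.cost + 1) + 1 ≤ T
        omega
    have hvar : (WExpr.reg 16 + WExpr.reg 13 : WExpr).val w ρ' m' = d.base + k :=
      WExpr.val_add e16 h1 (by omega)
    have htwo : (2 * (WExpr.reg 16 + WExpr.reg 13) : WExpr).val w ρ' m' = 2 * (d.base + k) :=
      WExpr.val_mul (hlit 2 rfl) hvar (by omega)
    refine Halts.ifLt_le (T := 15) (d.num / 2 ^ k % 2) 1 (by decide) rfl rfl
      (WExpr.val_mod (WExpr.val_shr e15 h1 (by omega)) (hlit 2 rfl)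
        ((Nat.div_le_self _ _).trans_lt (by omega))) (hlit 1 rfl) (fun hc => ?_) (fun hc => ?_)
    · refine hstep ?_ ?_ ?_
      · rfl
      swap
      · decide
      rw [literalBit, if_pos hc, ← hm]
      exact WExpr.val_load (WExpr.val_add e6 (WExpr.val_add (hlit 3 rfl) htwo (by omega))
        (by omega))
    · refine hstep ?_ ?_ ?_
      · rfl
      swap
      · decide
      rw [literalBit, if_neg hc, ← hm]
      exact WExpr.val_load (WExpr.val_add e6 (WExpr.val_add (hlit 2 rfl) htwo (by omega))
        (by omega))
  · refine ⟨rfl, le_rfl, by simpa using h13, by simp, ?_, fun r _ _ h17 =>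
      Function.update_of_ne h17 _ _⟩
    simp only [Function.update_self, lt_irrefl, false_iff]
    rintro ⟨v, hv, hv', -⟩
    exact absurd hv (not_lt.2 hv')
  · rintro ρ' m' ⟨hm', -, -, -, h4, h5⟩
    refine ⟨hm', by rw [h4, clauseSat, decide_eq_true_iff], fun r hr hr13 hr17 => ?_⟩
    rw [h5 r hr hr13 hr17]

end Layout

open WExpr in
/-- Compute the numbers of the layout. -/
def setupProg : Prog :=
  .seq (assign 0 (load 0)) (.seq (assign 1 (load 1)) (.seq (assign 2 ((reg 0 + 1) / 2))
    (.seq (assign 3 (bin .shl 1 (reg 2))) (.seq (assign 4 (reg 3 * (reg 1 + 2)))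
      (.seq (assign 5 (reg 3 * (reg 1 + 1) + 5)) (.seq (assign 9 (reg 4 + reg 5))
        (.seq (assign 6 (2 + 2 * reg 9)) (assign 7 (2 + 2 * (reg 1 * reg 0))))))))))

open WExpr in
/-- Copy the formula, replace it by the two curves, and delete the copy. -/
def buildProg : Prog :=
  .seq setupProg (.seq (assign 8 0) (.seq (forUp 8 7 (storeAt (reg 6 + reg 8) (load (reg 8))))
    (.seq (assign 8 0) (.seq (forUp 8 9 vertexProg) (.seq (storeAt 0 (reg 4)) (.seq
      (storeAt 1 (reg 5)) (.seq (assign 8 0) (forUp 8 7 (storeAt (reg 6 + reg 8) 0)))))))))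

theorem WExpr.val_of_reg {w r v : ℕ} {ρ m : ℕ → ℕ} (h : ρ r = v) : (reg r).val w ρ m = v := h

theorem Halts.assign_seq {w r : ℕ} {e : WExpr} {p : Prog} {ρ m : ℕ → ℕ} {T T' : ℕ}
    {Q : (ℕ → ℕ) → (ℕ → ℕ) → Prop} (v : ℕ) (he : e.usesBelow 20 = true) (hv : e.val w ρ m = v)
    (hw : v < 2 ^ w) (hT : e.cost + 1 + T ≤ T')
    (h : ∀ ρ', (∀ r', r' ≠ r → ρ' r' = ρ r') → ρ' r = v → Halts w p ρ' m T Q) :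
    Halts w (.seq (_root_.assign r e) p) ρ m T' Q :=
  (Halts.seq (Halts.assign v (WExpr.below_of_usesBelow he) hv hw
    (h _ (fun _ hr => Function.update_of_ne hr _ _) (Function.update_self _ _ _)))).time hT

/-! ### Correctness of the construction of the curves -/

namespace Layout

variable {w : ℕ} (l : Layout w)

theorem Loaded.update {l : Layout w} {ρ : ℕ → ℕ} (h : l.Loaded ρ) (v : ℕ) :
    l.Loaded (Function.update ρ 8 v) :=
  h.congr fun _ _ h8 => Function.update_of_ne h8 _ _

theorem halts_vertexProg {fm ρ m : ℕ → ℕ} {x : ℕ} (hx : x < l.p + l.q) (hfm : l.IsBits fm)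
    (hρ : l.Loaded ρ) (h8 : ρ 8 = x) (hm : l.Copied fm m) :
    Halts w vertexProg ρ m (l.N * 30 + 400) fun ρ' m' =>
      (∀ r < 10, ρ' r = ρ r) ∧ m' = Function.update (Function.update m (2 + 2 * x)
        ((l.vertexSpec x).eval fm).1) (3 + 2 * x) ((l.vertexSpec x).eval fm).2 := by
  have hb := l.bound
  have hH := l.H_eq
  have hw : 100 < 2 ^ w := by omega
  have hd := l.specBounds hx
  set d := l.vertexSpec x with hdef
  refine (Halts.seq (T₂ := l.N * 30 + 3 + (10 + 40))
    ((l.halts_vertexSpecProg hx hρ h8).mono le_rfl ?_)).time (by omega)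
  rintro ρ₁ m₁ ⟨rfl, hρ₁⟩
  have hlow : ∀ r < 10, ρ₁ r = ρ r := fun r hr => by rw [hρ₁, updateAll_of_lt hr]
  have e10 : ρ₁ 10 = d.x := by rw [hρ₁]; rfl
  have e11 : ρ₁ 11 = d.sat := by rw [hρ₁]; rfl
  have e12 : ρ₁ 12 = d.unsat := by rw [hρ₁]; rfl
  refine Halts.seq ((l.halts_clauseProg hfm hd hm ((hlow 6 (by norm_num)).trans hρ.H)
    (by rw [hρ₁]; rfl) (by rw [hρ₁]; rfl) (by rw [hρ₁]; rfl) (by rw [hρ₁]; rfl)).mono le_rfl ?_)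
  rintro ρ₂ m₂ ⟨rfl, hacc, hsame⟩
  have hlow' : ∀ r < 10, ρ₂ r = ρ r := fun r hr => by
    rw [hsame r (by omega) (by omega) (by omega), hlow r hr]
  have e8 : ρ₂ 8 = x := (hlow' 8 (by norm_num)).trans h8
  have e10' : ρ₂ 10 = d.x :=
    (hsame 10 (by norm_num) (by norm_num) (by norm_num)).trans e10
  have e11' : ρ₂ 11 = d.sat :=
    (hsame 11 (by norm_num) (by norm_num) (by norm_num)).trans e11
  have e12' : ρ₂ 12 = d.unsat :=
    (hsame 12 (by norm_num) (by norm_num) (by norm_num)).trans e12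
  have htwo : ∀ m, (2 * WExpr.reg 8 : WExpr).val w ρ₂ m = 2 * x := fun m =>
    WExpr.val_mul (WExpr.val_small hw 2 rfl) e8 (by omega)
  refine Halts.seq (Halts.time (Halts.storeAt (2 + 2 * x) d.x (WExpr.below_of_usesBelow rfl)
    (show 10 < 20 by norm_num) (WExpr.val_add (WExpr.val_small hw 2 rfl) (htwo _) (by omega))
      e10' ?_)
    (by decide))
  refine Halts.ifLt_le (T := 30) 0 (ρ₂ 17) (by decide) rfl rfl (WExpr.val_small hw 0 rfl) rfl
    (fun hc => ?_) (fun hc => ?_)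
  · refine Halts.time (Halts.storeAt (3 + 2 * x) d.sat (WExpr.below_of_usesBelow rfl)
      (show 11 < 20 by norm_num) (WExpr.val_add (WExpr.val_small hw 3 rfl) (htwo _) (by omega)) e11'
      ⟨hlow', ?_⟩) (by decide)
    simp only [VertexSpec.eval, hacc.1 hc, if_true]
  · refine Halts.time (Halts.storeAt (3 + 2 * x) d.unsat (WExpr.below_of_usesBelow rfl)
      (show 12 < 20 by norm_num) (WExpr.val_add (WExpr.val_small hw 3 rfl) (htwo _) (by omega)) e12'
      ⟨hlow', ?_⟩) (by decide)
    rw [VertexSpec.eval, if_neg (by rwa [← hacc])]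

theorem halts_setupProg (hh : l.h = (l.N + 1) / 2) {m : ℕ → ℕ} (h0 : m 0 = l.N) (h1 : m 1 = l.M) :
    Halts w setupProg (fun _ => 0) m 60 fun ρ' m' => m' = m ∧ l.Loaded ρ' := by
  have hb := l.bound
  have hH := l.H_eq
  have hK := l.K_eq
  have hq := l.q_eq
  have hp := l.p_eq
  have hLL : l.L ≤ l.L * l.L := Nat.le_mul_of_pos_left _ l.L_pos
  have hw : 100 < 2 ^ w := by omega
  have hlit : ∀ {ρ : ℕ → ℕ} n, Nat.ble n 100 = true → (OfNat.ofNat n : WExpr).val w ρ m = n :=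
    fun n hn => WExpr.val_small hw n hn
  refine Halts.assign_seq (T := 57) l.N rfl ((WExpr.val_load (hlit 0 rfl)).trans h0) (by omega)
    (by decide) fun ρ₁ s₁ e₁ => ?_
  refine Halts.assign_seq (T := 54) l.M rfl ((WExpr.val_load (hlit 1 rfl)).trans h1) (by omega)
    (by decide) fun ρ₂ s₂ e₂ => ?_
  have f₂ : ρ₂ 0 = l.N := by simp [s₂, e₁]
  have := l.h_le
  refine Halts.assign_seq (T := 47) l.h rfl (hh ▸ WExpr.val_div (WExpr.val_add f₂ (hlit 1 rfl)
    (by omega)) (hlit 2 rfl) (by omega)) (by omega) (by decide) fun ρ₃ s₃ e₃ => ?_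
  refine Halts.assign_seq (T := 43) l.L rfl ((WExpr.val_shl (hlit 1 rfl) (WExpr.val_of_reg e₃)
    (by rw [one_mul, ← l.L_eq]; omega)).trans (by rw [one_mul, ← l.L_eq])) (by omega) (by decide)
    fun ρ₄ s₄ e₄ => ?_
  have f₄ : ρ₄ 1 = l.M := by simp [s₄, s₃, e₂]
  refine Halts.assign_seq (T := 36) l.p rfl ((WExpr.val_mul (WExpr.val_of_reg e₄)
    (WExpr.val_add (WExpr.val_of_reg f₄) (hlit 2 rfl)
    (by omega)) (by omega)).trans hp.symm) (by omega) (by decide) fun ρ₅ s₅ e₅ => ?_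
  have f₅ : ρ₅ 1 = l.M := by simp [s₅, f₄]
  have g₅ : ρ₅ 3 = l.L := by simp [s₅, e₄]
  refine Halts.assign_seq (T := 28) l.q rfl ((WExpr.val_add (WExpr.val_mul (WExpr.val_of_reg g₅)
    (WExpr.val_add (WExpr.val_of_reg f₅)
    (hlit 1 rfl) (by omega)) (by omega)) (hlit 5 rfl) (by omega)).trans hq.symm) (by omega)
    (by decide) fun ρ₆ s₆ e₆ => ?_
  have f₆ : ρ₆ 4 = l.p := by simp [s₆, e₅]
  refine Halts.assign_seq (T := 24) (l.p + l.q) rfl (WExpr.val_add f₆ e₆ (by omega)) (by omega)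
    (by decide) fun ρ₇ s₇ e₇ => ?_
  refine Halts.assign_seq (T := 15) l.H rfl ((WExpr.val_add (hlit 2 rfl) (WExpr.val_mul
    (hlit 2 rfl) (WExpr.val_of_reg e₇) (by omega)) (by omega)).trans hH.symm) (by omega)
    (by decide) fun ρ₈ s₈ e₈ => ?_
  have f₈ : ρ₈ 0 = l.N := by simp [s₈, s₇, s₆, s₅, s₄, s₃, f₂]
  have g₈ : ρ₈ 1 = l.M := by simp [s₈, s₇, s₆, f₅]
  refine Halts.time (Halts.assign l.K (WExpr.below_of_usesBelow rfl) ((WExpr.val_add (hlit 2 rfl)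
    (WExpr.val_mul (hlit 2 rfl) (WExpr.val_mul (WExpr.val_of_reg g₈) (WExpr.val_of_reg f₈)
      (by omega)) (by omega)) (by omega)).trans
    hK.symm) (by omega) ⟨rfl, ?_⟩) (by decide)
  constructor <;> simp [s₈, s₇, s₆, s₅, s₄, s₃, f₂, e₂, e₃, e₄, e₅, e₆, e₇, e₈]

/-- The memory that holds the two curves. -/
structure Built (fm m : ℕ → ℕ) : Prop where
  zero : m 0 = l.p
  one : m 1 = l.q
  fst : ∀ x < l.p + l.q, m (2 + 2 * x) = ((l.vertexSpec x).eval fm).1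
  snd : ∀ x < l.p + l.q, m (3 + 2 * x) = ((l.vertexSpec x).eval fm).2
  rest : ∀ a, m (l.H + a) = 0

/-- The coordinates overwrite the formula, so the vertices are computed from a copy at `l.H`, beyond
all coordinates. By `K ≤ H` the copying never overwrites its source. Erasing the copy leaves a
memory that contains nothing but the two curves. -/
theorem halts_buildProg (hh : l.h = (l.N + 1) / 2) {fm : ℕ → ℕ} (h0 : fm 0 = l.N)
    (h1 : fm 1 = l.M) (hfm : l.IsBits fm) (hrest : ∀ a, l.K ≤ a → fm a = 0) :
    Halts w buildProg (fun _ => 0) fm (60 + (2 + (l.K * 14 + 1 + (2 +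
      ((l.p + l.q) * (l.N * 30 + 404) + 1 + (12 + (2 + (l.K * 14 + 1)))))))) fun ρ m =>
        l.Loaded ρ ∧ l.Built fm m := by
  have hb := l.bound
  have hH := l.H_eq
  have hK := l.K_le
  have hw : 100 < 2 ^ w := by omega
  have hlit : ∀ {ρ m : ℕ → ℕ} n, Nat.ble n 100 = true → (OfNat.ofNat n : WExpr).val w ρ m = n :=
    fun n hn => WExpr.val_small hw n hn
  refine Halts.seq ((l.halts_setupProg hh h0 h1).mono le_rfl ?_)
  rintro ρ m ⟨hm, hρ⟩
  rw [hm]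
  refine Halts.seq (Halts.assign (e := 0) 0 trivial (hlit 0 rfl) (by omega) ?_)
  -- copy the formula
  refine Halts.seq ((Halts.forUp (k := 0) (T := 10) (by norm_num) (by norm_num)
    (fun k ρ' m' => l.Loaded ρ' ∧ ρ' 8 = k ∧ (∀ a < l.H, m' a = fm a) ∧
      (∀ a < k, m' (l.H + a) = fm a) ∧ ∀ a, k ≤ a → m' (l.H + a) = fm (l.H + a)) l.K
    (Nat.zero_le _) (by omega) (fun k ρ' m' h => ⟨h.2.1, h.1.K⟩) ?_
    ⟨hρ.update 0, by simp, fun _ _ => rfl, fun a h => absurd h (Nat.not_lt_zero a),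
      fun _ _ => rfl⟩).mono le_rfl ?_)
  · rintro k hk ρ' m' ⟨a1, a2, a3, a4, a5⟩
    refine Halts.time (Halts.storeAt (l.H + k) (fm k) (WExpr.below_of_usesBelow rfl)
      (WExpr.below_of_usesBelow rfl) (WExpr.val_add a1.H a2 (by omega))
      ((WExpr.val_load (WExpr.val_of_reg a2)).trans (a3 k (by omega))) ⟨a2, a1.update _, by simp,
        ?_, ?_, ?_⟩)
      (by decide)
    · intro a ha
      rw [Function.update_of_ne (by omega), a3 a ha]
    · intro a ha
      rcases eq_or_ne a k with rfl | hne
      · simp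
      · rw [Function.update_of_ne (by omega), a4 a (by omega)]
    · intro a ha
      rw [Function.update_of_ne (by omega), a5 a (by omega)]
  rintro ρ₁ m₁ ⟨hρ₁, -, -, hc, hc'⟩
  have hcopy : l.Copied fm m₁ := by
    intro a
    rcases lt_or_ge a l.K with h | h
    · exact hc a h
    · rw [hc' a h, hrest a h, hrest _ (by omega)]
  clear hc hc'
  refine Halts.seq (Halts.assign (e := 0) 0 trivial (hlit 0 rfl) (by omega) ?_)
  -- write the vertices
  refine Halts.seq ((Halts.forUp (k := 0) (T := l.N * 30 + 400) (by norm_num) (by norm_num)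
    (fun k ρ' m' => l.Loaded ρ' ∧ ρ' 8 = k ∧ l.Copied fm m' ∧
      ∀ x < k, m' (2 + 2 * x) = ((l.vertexSpec x).eval fm).1 ∧
        m' (3 + 2 * x) = ((l.vertexSpec x).eval fm).2) (l.p + l.q)
    (Nat.zero_le _) (by omega) (fun k ρ' m' h => ⟨h.2.1, h.1.t⟩) ?_
    ⟨hρ₁.update 0, by simp, hcopy, fun a h => absurd h (Nat.not_lt_zero a)⟩).mono le_rfl ?_)
  · rintro k hk ρ' m' ⟨a1, a2, a3, a4⟩
    refine (l.halts_vertexProg hk hfm a1 a2 a3).mono le_rfl ?_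
    rintro ρ'' _ ⟨b1, rfl⟩
    refine ⟨(b1 8 (by norm_num)).trans a2, (a1.congr fun r hr _ => b1 r hr).update _, by simp,
      fun a => ?_, fun x hx => ⟨?_, ?_⟩⟩
    · rw [Function.update_of_ne (by omega), Function.update_of_ne (by omega), a3 a]
    · rw [Function.update_of_ne (by omega)]
      rcases eq_or_ne x k with rfl | hne
      · simp
      · rw [Function.update_of_ne (by omega), (a4 x (by omega)).1]
    · rcases eq_or_ne x k with rfl | hne
      · simp
      · rw [Function.update_of_ne (by omega), Function.update_of_ne (by omega),
          (a4 x (by omega)).2]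
  rintro ρ₂ m₂ ⟨hρ₂, -, hcopy₂, hvert⟩
  refine Halts.seq (T₁ := 6) (T₂ := 6 + (2 + (l.K * 14 + 1))) (Halts.time (Halts.storeAt 0 l.p
    (WExpr.below_of_usesBelow rfl) (WExpr.below_of_usesBelow rfl) (hlit 0 rfl)
    (WExpr.val_of_reg hρ₂.p) ?_)
    (by decide)) |>.time (by omega)
  refine Halts.seq (Halts.time (Halts.storeAt 1 l.q
    (WExpr.below_of_usesBelow rfl) (WExpr.below_of_usesBelow rfl) (hlit 1 rfl)
    (WExpr.val_of_reg hρ₂.q) ?_)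
    (by decide))
  refine Halts.seq (Halts.assign (e := 0) 0 trivial (hlit 0 rfl) (by omega) ?_)
  -- delete the copy
  refine (Halts.forUp (k := 0) (T := 10) (by norm_num) (by norm_num)
    (fun k ρ' m' => l.Loaded ρ' ∧ ρ' 8 = k ∧ m' 0 = l.p ∧ m' 1 = l.q ∧
      (∀ x < l.p + l.q, m' (2 + 2 * x) = ((l.vertexSpec x).eval fm).1 ∧
        m' (3 + 2 * x) = ((l.vertexSpec x).eval fm).2) ∧
      ∀ a, m' (l.H + a) = if a < k then 0 else fm a) l.K
    (Nat.zero_le _) (by omega) (fun k ρ' m' h => ⟨h.2.1, h.1.K⟩) ?_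
    ⟨hρ₂.update 0, by simp, by simp, by simp, fun x hx => ⟨?_, ?_⟩, fun a => ?_⟩).mono le_rfl ?_
  · rintro k hk ρ' m' ⟨a1, a2, a3, a4, a5, a6⟩
    refine Halts.time (Halts.storeAt (l.H + k) 0 (WExpr.below_of_usesBelow rfl)
      (WExpr.below_of_usesBelow rfl) (WExpr.val_add a1.H a2 (by omega)) (hlit 0 rfl)
      ⟨a2, a1.update _, by simp, ?_, ?_, fun x hx => ⟨?_, ?_⟩, fun a => ?_⟩) (by decide)
    · rw [Function.update_of_ne (by omega), a3]
    · rw [Function.update_of_ne (by omega), a4]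
    · rw [Function.update_of_ne (by omega), (a5 x hx).1]
    · rw [Function.update_of_ne (by omega), (a5 x hx).2]
    · rcases eq_or_ne a k with rfl | hne
      · simp
      · rw [Function.update_of_ne (by omega), a6]
        exact if_congr (by omega) rfl rfl
  · rw [Function.update_of_ne (by omega), Function.update_of_ne (by omega), (hvert x hx).1]
  · rw [Function.update_of_ne (by omega), Function.update_of_ne (by omega), (hvert x hx).2]
  · rw [Function.update_of_ne (by omega), Function.update_of_ne (by omega), hcopy₂ a,
      if_neg (Nat.not_lt_zero a)]
  · rintro ρ₃ m₃ ⟨hρ₃, -, c1, c2, c3, c4⟩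
    refine ⟨hρ₃, c1, c2, fun x hx => (c3 x hx).1, fun x hx => (c3 x hx).2, fun a => ?_⟩
    rw [c4]
    split_ifs with h
    · rfl
    · exact hrest a (not_lt.1 h)

theorem buildProg_isLocal : buildProg.IsLocal 32 = true := by decide

end Layout

/-! ## Inputs as lists -/

theorem List.getD_flatMap_of_length {α β : Type} {f : α → List β} {n : ℕ}
    (hf : ∀ a, (f a).length = n)
    (d : β) : ∀ (l : List α) {i r : ℕ} (hi : i < l.length), r < n →
      (l.flatMap f).getD (i * n + r) d = (f l[i]).getD r d
  | a :: l, 0, r, _, hr => by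
    rw [List.flatMap_cons, zero_mul, zero_add, List.getD_append _ _ _ _ (by rwa [hf])]
    rfl
  | a :: l, i + 1, r, hi, hr => by
    have e : (i + 1) * n + r - n = i * n + r := by
      rw [add_mul, one_mul]
      omega
    rw [List.flatMap_cons, List.getD_append_right _ _ _ _ (by rw [hf, add_mul]; omega), hf, e,
      List.getD_flatMap_of_length hf d l (by simpa using hi) hr]
    rfl

theorem List.length_flatMap_of_length {α β : Type} {f : α → List β} {n : ℕ}
    (hf : ∀ a, (f a).length = n) (l : List α) : (l.flatMap f).length = l.length * n := by
  induction l with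
  | nil => simp
  | cons a l ih => rw [List.flatMap_cons, List.length_append, hf, ih, List.length_cons]; ring

theorem CNF.length_encode {N M : ℕ} (φ : CNF N M) : φ.encode.length = 2 + 2 * (M * N) := by
  rw [CNF.encode, List.length_append, List.length_flatMap_of_length (n := N * 2),
    List.length_finRange]
  · simp only [List.length_cons, List.length_nil]
    ring
  · intro i
    rw [List.length_flatMap_of_length (n := 2) (fun _ => rfl), List.length_finRange]

theorem CNF.getD_encode {N M : ℕ} (φ : CNF N M) (i : Fin M) (j : Fin N) {b : ℕ} (hb : b < 2) :
    φ.encode.getD (2 + 2 * (i * N + j) + b) 0 =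
      [if j ∈ (φ i).1 then 1 else 0, if j ∈ (φ i).2 then 1 else 0].getD b 0 := by
  have hlen : ∀ i : Fin M, ((List.finRange N).flatMap fun j =>
      [if j ∈ (φ i).1 then 1 else 0, if j ∈ (φ i).2 then 1 else 0]).length = N * 2 := fun i => by
    rw [List.length_flatMap_of_length (n := 2) (fun _ => rfl), List.length_finRange]
  have e : 2 + 2 * ((i : ℕ) * N + j) + b - [N, M].length = i * (N * 2) + (j * 2 + b) := by
    have : (i : ℕ) * (N * 2) = 2 * (i * N) := by ring
    simp only [List.length_cons, List.length_nil]
    omega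
  rw [CNF.encode, List.getD_append_right _ _ _ _ (by
      simp only [List.length_cons, List.length_nil]
      omega), e,
    List.getD_flatMap_of_length hlen 0 _ (by simp) (by omega), List.getElem_finRange,
    List.getD_flatMap_of_length (n := 2) (fun _ => rfl) 0 _ (by simp) hb, List.getElem_finRange]
  rfl

theorem Curve.length_coords {α : Type} (P : Curve (α × α)) : P.coords.length = 2 * P.size := by
  rw [Curve.coords, List.length_flatMap_of_length (n := 2) (fun _ => rfl), List.length_ofFn,
    mul_comm]

theorem Curve.getD_coords {α : Type} (P : Curve (α × α)) {x b : ℕ} (hx : x < P.size) (hb : b < 2)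
    (d : α) : P.coords.getD (2 * x + b) d =
      [(P.vertex ⟨x, hx⟩).1, (P.vertex ⟨x, hx⟩).2].getD b d := by
  rw [Curve.coords, mul_comm, List.getD_flatMap_of_length (n := 2) (fun _ => rfl) d _ (by simpa) hb,
    List.getElem_ofFn]

theorem Curve.coords_map {α β : Type} (f : α → β) (P : Curve (α × α)) :
    (P.map (Prod.map f f)).coords = P.coords.map f := by
  simp only [Curve.coords, Curve.map, List.map_flatMap]
  rw [show (fun i => Prod.map f f (P.vertex i)) = Prod.map f f ∘ P.vertex from rfl, ← List.map_ofFn,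
    List.flatMap_map]
  rfl

/-! ## Formulas and tables -/

section link

variable {N M : ℕ} (φ : CNF N M)

/-- The memory content for a formula. -/
def CNF.memory (a : ℕ) : ℕ := φ.encode.getD a 0

theorem CNF.literalBit_pos {c v num : ℕ} (hc : c < M) (hv : v < N) :
    0 < literalBit φ.memory num (c * N) v ↔
      (num.testBit v = true ∧ (⟨v, hv⟩ : Fin N) ∈ (φ ⟨c, hc⟩).1) ∨
      (num.testBit v = false ∧ (⟨v, hv⟩ : Fin N) ∈ (φ ⟨c, hc⟩).2) := by
  have h0 := φ.getD_encode ⟨c, hc⟩ ⟨v, hv⟩ (b := 0) (by norm_num)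
  have h1 := φ.getD_encode ⟨c, hc⟩ ⟨v, hv⟩ (b := 1) (by norm_num)
  simp only [List.getD_cons_zero, List.getD_cons_succ, add_zero] at h0 h1
  rw [literalBit, CNF.memory, CNF.memory, h0,
    show 3 + 2 * (c * N + v) = 2 + 2 * (c * N + v) + 1 by omega, h1,
      Nat.testBit_eq_decide_div_mod_eq]
  have := Nat.mod_lt (num / 2 ^ v) (show 0 < 2 by norm_num)
  rcases (show num / 2 ^ v % 2 = 0 ∨ num / 2 ^ v % 2 = 1 by omega) with e | e <;> rw [e] <;>
    split_ifs <;> simp_all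

theorem exists_testBit (n : ℕ) (f : ℕ → Bool) : ∃ a < 2 ^ n, ∀ v < n, a.testBit v = f v :=
  ⟨Nat.ofBits fun i : Fin n => f i, Nat.ofBits_lt_two_pow _, fun v hv =>
    Nat.testBit_ofBits_lt _ v hv⟩

/-- Whether assignment `a` of the first `h` variables satisfies clause `i` (counted from `1`). -/
def CNF.leftTable (h a i : ℕ) : Bool := clauseSat φ.memory 0 h a ((i - 1) * N)

/-- Whether assignment `b` of the variables from `h` on satisfies clause `i` (counted
from `1`). -/
def CNF.rightTable (h b i : ℕ) : Bool := clauseSat φ.memory h N (b * 2 ^ h) ((i - 1) * N)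

/-- A clause holds iff a literal in one of the two halves of the variables holds. The second number
is shifted by `h` bits, so that its bits stand at the places of the variables from `h` on; `N ≤ 2 *
h` makes `h` bits enough for them, and a surplus bit is never read. -/
theorem CNF.satisfiable_iff {h : ℕ} (hN : h ≤ N) (hN' : N ≤ 2 * h) : φ.Satisfiable ↔
    ∃ k < 2 ^ h, ∃ l < 2 ^ h, ∀ i, 1 ≤ i → i ≤ M →
      φ.leftTable h k i = true ∨ φ.rightTable h l i = true := by
  have hshift : ∀ b v, h ≤ v → (b * 2 ^ h).testBit v = b.testBit (v - h) := by
    intro b v hv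
    rw [Nat.testBit_mul_two_pow]
    simp [hv]
  constructor
  · rintro ⟨f, hf⟩
    obtain ⟨a, ha, ha'⟩ := exists_testBit h fun v => if hv : v < N then f ⟨v, hv⟩ else false
    obtain ⟨b, hb, hb'⟩ := exists_testBit h fun v => if hv : h + v < N then f ⟨h + v, hv⟩ else false
    refine ⟨a, ha, b, hb, fun i h1 h2 => ?_⟩
    have key : ∃ v : Fin N, (f v = true ∧ v ∈ (φ ⟨i - 1, by omega⟩).1) ∨
        (f v = false ∧ v ∈ (φ ⟨i - 1, by omega⟩).2) := by
      rcases hf ⟨i - 1, by omega⟩ with ⟨v, hv, hv'⟩ | ⟨v, hv, hv'⟩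
      · exact ⟨v, Or.inl ⟨hv', hv⟩⟩
      · exact ⟨v, Or.inr ⟨hv', hv⟩⟩
    obtain ⟨v, hv⟩ := key
    rcases lt_or_ge (v : ℕ) h with hvh | hvh
    · left
      refine decide_eq_true ⟨v, hvh, Nat.zero_le _, ?_⟩
      rw [φ.literalBit_pos (by omega) v.2, ha' v hvh]
      simpa using hv
    · right
      refine decide_eq_true ⟨v, v.2, hvh, ?_⟩
      have e : h + ((v : ℕ) - h) = v := by omega
      rw [φ.literalBit_pos (by omega) v.2, hshift b v hvh, hb' _ (by omega)]
      simpa [e] using hv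
  · rintro ⟨a, -, b, -, hab⟩
    refine ⟨fun v => if (v : ℕ) < h then a.testBit v else (b * 2 ^ h).testBit v, fun i => ?_⟩
    have key : ∀ num : ℕ, ∀ v : Fin N, num.testBit v =
        (if (v : ℕ) < h then a.testBit v else (b * 2 ^ h).testBit v) →
        0 < literalBit φ.memory num (i * N) v →
        (∃ j ∈ (φ i).1, (if (j : ℕ) < h then a.testBit j else (b * 2 ^ h).testBit j) = true) ∨
        (∃ j ∈ (φ i).2, (if (j : ℕ) < h then a.testBit j else (b * 2 ^ h).testBit j) = false) := by
      intro num v hv hpos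
      rw [φ.literalBit_pos i.2 v.2, hv] at hpos
      exact hpos.imp (fun h => ⟨v, h.2, h.1⟩) (fun h => ⟨v, h.2, h.1⟩)
    rcases hab (i + 1) (by omega) (by omega) with hc | hc
    · obtain ⟨v, hv, -, hpos⟩ := of_decide_eq_true hc
      exact key a ⟨v, by omega⟩ (by simp [hv]) hpos
    · obtain ⟨v, hv, hv', hpos⟩ := of_decide_eq_true hc
      exact key (b * 2 ^ h) ⟨v, hv⟩ (by simp [not_lt.2 hv']) hpos

end link

/-! ### Agreement of the written memory with the coordinate lists -/

namespace Layout

variable {w : ℕ} (l : Layout w)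

theorem eval_fixed (fm : ℕ → ℕ) (x y : ℕ) : (VertexSpec.fixed x y).eval fm = (x, y) := by
  unfold VertexSpec.eval VertexSpec.fixed
  split_ifs <;> rfl

theorem eval_vertexSpec_left {φ : CNF l.N l.M} {x : ℕ} (hx : x < l.p) :
    (l.vertexSpec x).eval φ.memory = leftVertex l.M (φ.leftTable l.h) x := by
  rw [vertexSpec, if_pos hx, leftVertex]
  simp only [CNF.leftTable]
  split_ifs <;> first
    | exact eval_fixed _ _ _
    | simp [VertexSpec.eval, zigzag, *]

theorem eval_vertexSpec_right {φ : CNF l.N l.M} (y : ℕ) :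
    (l.vertexSpec (l.p + y)).eval φ.memory = rightVertex l.M l.L (φ.rightTable l.h) y := by
  rw [vertexSpec, if_neg (by omega), rightVertex, Nat.add_sub_cancel_left]
  simp only [CNF.rightTable]
  split_ifs <;> first
    | exact eval_fixed _ _ _
    | simp_all [VertexSpec.eval, zigzag, l.L_eq]

/-- The first curve for a formula. -/
def leftInput (φ : CNF l.N l.M) : Curve (ℕ × ℕ) := leftCurve l.M l.L l.L_pos (φ.leftTable l.h)

/-- The second curve for a formula. -/
def rightInput (φ : CNF l.N l.M) : Curve (ℕ × ℕ) := rightCurve l.M l.L (φ.rightTable l.h)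

theorem size_leftInput (φ : CNF l.N l.M) : (l.leftInput φ).size = l.p := l.p_eq.symm

theorem size_rightInput (φ : CNF l.N l.M) : (l.rightInput φ).size = l.q := l.q_eq.symm

/-- No restriction on `t`: past the coordinates the default value 0 of the list meets the erased
memory from `l.H` on. -/
theorem Built.getD_coords {l : Layout w} {φ : CNF l.N l.M} {m : ℕ → ℕ} (h : l.Built φ.memory m)
    (t : ℕ) :
    ((l.leftInput φ).coords ++ (l.rightInput φ).coords).getD t 0 = m (2 + t) := by
  have hl : (l.leftInput φ).coords.length = 2 * l.p := by
    rw [Curve.length_coords, size_leftInput]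
  have hr : (l.rightInput φ).coords.length = 2 * l.q := by
    rw [Curve.length_coords, size_rightInput]
  have hval : ∀ x < l.p + l.q, ∀ b < 2, m (2 + (2 * x + b)) =
      [((l.vertexSpec x).eval φ.memory).1, ((l.vertexSpec x).eval φ.memory).2].getD b 0 := by
    intro x hx b hb
    obtain rfl | rfl : b = 0 ∨ b = 1 := by omega
    · simpa using h.fst x hx
    · rw [show 2 + (2 * x + 1) = 3 + 2 * x by omega]
      simpa using h.snd x hx
  obtain ⟨x, b, hb, rfl⟩ : ∃ x b, b < 2 ∧ t = 2 * x + b :=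
    ⟨t / 2, t % 2, Nat.mod_lt _ (by norm_num), by omega⟩
  rcases lt_or_ge x l.p with hx | hx
  · rw [List.getD_append _ _ _ _ (by omega), Curve.getD_coords _ (by rwa [size_leftInput]) hb,
      hval x (by omega) b hb, l.eval_vertexSpec_left hx]
    rfl
  obtain ⟨y, rfl⟩ : ∃ y, x = l.p + y := ⟨x - l.p, by omega⟩
  rw [List.getD_append_right _ _ _ _ (by omega), hl,
    show 2 * (l.p + y) + b - 2 * l.p = 2 * y + b by omega]
  rcases lt_or_ge y l.q with hy | hy
  · rw [Curve.getD_coords _ (by rwa [size_rightInput]) hb, hval _ (by omega) b hb,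
      l.eval_vertexSpec_right]
    rfl
  · rw [List.getD_eq_default _ _ (by omega),
      show 2 + (2 * (l.p + y) + b) = l.H + (2 * (y - l.q) + b) by rw [l.H_eq]; omega, h.rest]

theorem isBits_memory (φ : CNF l.N l.M) : l.IsBits φ.memory := by
  intro a ha
  have hN : 0 < l.N := Nat.pos_of_ne_zero fun h => by simp [h] at ha
  obtain ⟨t, b, hb, rfl⟩ : ∃ t b, b < 2 ∧ a = 2 * t + b :=
    ⟨a / 2, a % 2, Nat.mod_lt _ (by norm_num), by omega⟩
  have ht : t < l.M * l.N := by omega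
  have h := φ.getD_encode ⟨t / l.N, by rwa [Nat.div_lt_iff_lt_mul hN]⟩ ⟨t % l.N, Nat.mod_lt _ hN⟩ hb
  simp only [Nat.div_add_mod'] at h
  rw [CNF.memory, ← add_assoc, h]
  obtain rfl | rfl : b = 0 ∨ b = 1 := by omega
  · simp only [List.getD_cons_zero]
    split_ifs <;> norm_num
  · simp only [List.getD_cons_zero, List.getD_cons_succ]
    split_ifs <;> norm_num

end Layout

/-! ## Building the input of a distance algorithm -/

theorem State.ext {s s' : State} (h1 : ∀ r, s.reg r = s'.reg r) (h2 : ∀ a, s.mem a = s'.mem a)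
    (h3 : ∀ r, s.realReg r = s'.realReg r) (h4 : ∀ a, s.realMem a = s'.realMem a) : s = s' := by
  cases s
  cases s'
  simp only [State.mk.injEq]
  exact ⟨funext h1, funext h2, funext h3, funext h4⟩

/-- Set the word registers below `n` to zero. -/
def clearProg : ℕ → Prog
  | 0 => .skip
  | n + 1 => .seq (clearProg n) (.instr (.const n 0))

theorem runs_clearProg (w : ℕ) (s : State) : ∀ n, Runs w (clearProg n) s n
    fun s' => s' = { s with reg := fun r => if r < n then 0 else s.reg r }
  | 0 => .skip (by simp)
  | n + 1 => .seq ((runs_clearProg w s n).mono le_rfl fun s' h => .instr (by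
      subst h
      refine State.ext (fun r => ?_) (fun _ => rfl) (fun _ => rfl) (fun _ => rfl)
      simp only [Instr.exec, Nat.zero_mod]
      rcases eq_or_ne r n with rfl | hne
      · simp
      · rw [Function.update_of_ne hne]
        exact if_congr (by omega) rfl rfl))

/-- Move the words at the addresses from `2` on and below `reg 6` to the real memory. -/
def transferProg : Prog :=
  .seq (.instr (.const 8 2)) <| .seq (.instr (.const 10 0)) <| .seq (.instr (.const 11 0)) <|
  .seq (.instr (.const 12 1)) <| .while (.lt 8 6) <|
    .seq (.instr (.load 13 8)) <| .seq (.instr (.ofWord 0 13)) <| .seq (.instr (.realStore 10 0)) <|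
    .seq (.instr (.store 8 11)) <| .seq (.instr (.op .add 8 8 12)) (.instr (.op .add 10 10 12))

/-- The situation after `transferProg` has moved `k` words. -/
structure Transferred (H : ℕ) (m : ℕ → ℕ) (k : ℕ) (s : State) : Prop where
  six : s.reg 6 = H
  eight : s.reg 8 = 2 + k
  ten : s.reg 10 = k
  eleven : s.reg 11 = 0
  twelve : s.reg 12 = 1
  high : ∀ r, 32 ≤ r → s.reg r = 0
  realReg : ∀ r, r ≠ 0 → s.realReg r = 0
  mem : ∀ a, s.mem a = if 2 ≤ a ∧ a < 2 + k then 0 else m a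
  realMem : ∀ a, s.realMem a = if a < k then (m (2 + a) : ℝ) else 0

/-- Each word is erased once it has been moved, since the word input on the real RAM consists of the
two sizes only. -/
theorem runs_transferProg {w H : ℕ} (hH : 2 ≤ H) (hw : H + 2 < 2 ^ w) {s : State} (h6 : s.reg 6 = H)
    (hreg : ∀ r, 32 ≤ r → s.reg r = 0) (hr : ∀ r, s.realReg r = 0) (ha : ∀ a, s.realMem a = 0) :
    Runs w transferProg s (H * 7 + 5) (Transferred H s.mem (H - 2)) := by
  refine Runs.mono (T₁ := 1 + (1 + (1 + (1 + ((H - 2 - 0) * (6 + 1) + 1)))))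
    (.seq <| .instr <| .seq <| .instr <| .seq <| .instr <| .seq <| .instr <|
      .while_count (Transferred H s.mem) (H - 2) (Nat.zero_le _) ?_ ?_ ?_) (by omega) fun _ => id
  · intro k t h
    rw [Test.holds, h.eight, h.six]
    omega
  · intro k hk t h
    have e1 : (2 + k + 1) % 2 ^ w = 2 + (k + 1) := by rw [Nat.mod_eq_of_lt (by omega)]; rfl
    have e2 : (k + 1) % 2 ^ w = k + 1 := Nat.mod_eq_of_lt (by omega)
    refine .seq (T₂ := 5) <| .instr <| .seq (T₂ := 4) <| .instr <| .seq (T₂ := 3) <| .instr <|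
      .seq (T₂ := 2) <| .instr <| .seq (T₂ := 1) <| .instr <| .instr ?_
    constructor
    · simp [Instr.exec, h.six]
    · simp [Instr.exec, h.eight, h.twelve, WordOp.eval, e1]
    · simp [Instr.exec, h.ten, h.twelve, WordOp.eval, e2]
    · simp [Instr.exec, h.eleven]
    · simp [Instr.exec, h.twelve]
    · intro r hr
      have := h.high r hr
      simp only [Instr.exec]
      iterate 3 rw [Function.update_of_ne (by omega)]
      exact this
    · intro r hr
      simp only [Instr.exec]
      rw [Function.update_of_ne hr, h.realReg r hr]
    · intro a
      have := h.mem a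
      simp only [Instr.exec, Function.update_self,
        Function.update_of_ne (show (8 : ℕ) ≠ 13 by norm_num),
        Function.update_of_ne (show (11 : ℕ) ≠ 13 by norm_num), h.eight, h.eleven]
      rcases eq_or_ne a (2 + k) with rfl | hne
      · rw [Function.update_self, if_pos (by omega)]
      · rw [Function.update_of_ne hne, this]
        exact if_congr (by omega) rfl rfl
    · intro a
      have h1 := h.realMem a
      have h2 := h.mem (2 + k)
      rw [if_neg (by omega)] at h2
      simp only [Instr.exec, Function.update_self,
        Function.update_of_ne (show (10 : ℕ) ≠ 13 by norm_num),
        h.eight, h.ten, h2]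
      rcases eq_or_ne a k with rfl | hne
      · rw [Function.update_self, if_pos (by omega)]
      · rw [Function.update_of_ne hne, h1]
        exact if_congr (by omega) rfl rfl
  · have e2 : 2 % 2 ^ w = 2 := Nat.mod_eq_of_lt (by omega)
    have e1 : 1 % 2 ^ w = 1 := Nat.mod_eq_of_lt (by omega)
    constructor
    · simp [Instr.exec, h6]
    · simp [Instr.exec, e2]
    · simp [Instr.exec]
    · simp [Instr.exec]
    · simp [Instr.exec, e1]
    · intro r hr
      simp only [Instr.exec]
      iterate 4 rw [Function.update_of_ne (by omega)]
      exact hreg r hr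
    · exact fun r _ => hr r
    · exact fun a => (if_neg (by omega)).symm
    · exact ha

namespace Layout

variable {w : ℕ} (l : Layout w)

/-- The number of steps that suffice for building the curves. -/
def buildTime : ℕ := 28 * l.K + (l.p + l.q) * (l.N * 30 + 404) + 81

theorem runs_buildProg (hh : l.h = (l.N + 1) / 2) (φ : CNF l.N l.M) :
    Runs w buildProg (State.init φ.encode []) l.buildTime fun s =>
      s.reg 6 = l.H ∧ l.Built φ.memory s.mem ∧ (∀ r, 32 ≤ r → s.reg r = 0) ∧
        (∀ r, s.realReg r = 0) ∧ ∀ a, s.realMem a = 0 := by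
  have hrest : ∀ a, l.K ≤ a → φ.memory a = 0 := fun a ha =>
    List.getD_eq_default _ _ (by rw [φ.length_encode, ← l.K_eq]; exact ha)
  obtain ⟨t, s, h1, h2, ρ, h3, h4, h5⟩ := l.halts_buildProg hh (fm := φ.memory) rfl rfl
    (l.isBits_memory φ) hrest (State.init φ.encode []) (fun _ _ => rfl) rfl
  obtain ⟨h6, h7, h8⟩ := h1.sameOutside buildProg_isLocal
  refine ⟨t, s, h1, h2.trans ?_, (h3 6 (by norm_num)).trans h4.H, h5, h6, ?_, ?_⟩
  · rw [buildTime]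
    omega
  · exact fun r => by rw [h7]; rfl
  · exact fun r => by rw [h8]; rfl

/-- Equality of entire states is needed: the assumption on the distance algorithm speaks of runs
from `State.init` only. -/
theorem runs_wordInput (hh : l.h = (l.N + 1) / 2) (φ : CNF l.N l.M) :
    Runs w (.seq buildProg (clearProg 32)) (State.init φ.encode []) (l.buildTime + 32) fun s =>
      s = State.init ([(l.leftInput φ).size, (l.rightInput φ).size] ++ (l.leftInput φ).coords ++
        (l.rightInput φ).coords) [] := by
  refine .seq ((l.runs_buildProg hh φ).mono le_rfl ?_)
  rintro s ⟨-, hm, hr, hr', hm'⟩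
  refine (runs_clearProg w s 32).mono le_rfl ?_
  rintro _ rfl
  refine State.ext (fun r => ?_) (fun a => ?_) hr' hm'
  · by_cases h : r < 32
    · exact if_pos h
    · exact (if_neg h).trans (hr r (not_lt.1 h))
  · change s.mem a = _
    rw [List.append_assoc]
    rcases a with _ | _ | a
    · exact hm.zero.trans (l.size_leftInput φ).symm
    · exact hm.one.trans (l.size_rightInput φ).symm
    · have h := hm.getD_coords a
      rw [show 2 + a = a + 1 + 1 by omega] at h
      exact h.symm

/-- The first curve with real coordinates. -/
def realLeftInput (φ : CNF l.N l.M) : Curve (ℝ × ℝ) :=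
  (l.leftInput φ).map (Prod.map Nat.cast Nat.cast)

/-- The second curve with real coordinates. -/
def realRightInput (φ : CNF l.N l.M) : Curve (ℝ × ℝ) :=
  (l.rightInput φ).map (Prod.map Nat.cast Nat.cast)

/-- The last instruction resets real register 0, the one dirtied by `transferProg`, from a word
register that is already cleared. -/
theorem runs_realInput (hh : l.h = (l.N + 1) / 2) (φ : CNF l.N l.M) :
    Runs w (.seq buildProg (.seq transferProg (.seq (clearProg 32) (.instr (.ofWord 0 0)))))
      (State.init φ.encode []) (l.buildTime + (l.H * 7 + 5 + (32 + 1))) fun s =>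
      s = State.init [(l.realLeftInput φ).size, (l.realRightInput φ).size]
        ((l.realLeftInput φ).coords ++ (l.realRightInput φ).coords) := by
  have hb := l.bound
  have hH := l.H_eq
  refine .seq ((l.runs_buildProg hh φ).mono le_rfl ?_)
  rintro s ⟨h6, hm, hr, hr', hm'⟩
  refine .seq ((runs_transferProg (by omega) (by omega) h6 hr hr' hm').mono le_rfl fun s₁ h₁ => ?_)
  refine .seq ((runs_clearProg w s₁ 32).mono le_rfl ?_)
  rintro _ rfl
  refine .instr (State.ext (fun r => ?_) (fun a => ?_) (fun r => ?_) (fun a => ?_))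
  · change (if r < 32 then 0 else s₁.reg r) = 0
    by_cases h : r < 32
    · exact if_pos h
    · exact (if_neg h).trans (h₁.high r (not_lt.1 h))
  · change s₁.mem a = [_, _].getD a 0
    rw [h₁.mem]
    rcases a with _ | _ | a
    · rw [if_neg (by omega)]
      exact hm.zero.trans (l.size_leftInput φ).symm
    · rw [if_neg (by omega)]
      exact hm.one.trans (l.size_rightInput φ).symm
    · rw [List.getD_eq_default _ _ (by simp)]
      by_cases h : a + 2 < l.H
      · exact if_pos (by omega)
      · rw [if_neg (by omega), show a + 1 + 1 = l.H + (a + 2 - l.H) by omega, hm.rest]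
  · change Function.update s₁.realReg 0 (((if 0 < 32 then 0 else s₁.reg 0 : ℕ)) : ℝ) r = 0
    rcases eq_or_ne r 0 with rfl | hne
    · simp
    · rw [Function.update_of_ne hne, h₁.realReg r hne]
  · change s₁.realMem a = ((l.realLeftInput φ).coords ++ (l.realRightInput φ).coords).getD a 0
    have e : (List.map (Nat.cast : ℕ → ℝ)
        ((l.leftInput φ).coords ++ (l.rightInput φ).coords)).getD a 0 =
        (s.mem (2 + a) : ℝ) := by
      rw [← hm.getD_coords a, ← List.getD_map (f := (Nat.cast : ℕ → ℝ)), Nat.cast_zero]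
    rw [h₁.realMem, realLeftInput, realRightInput, Curve.coords_map,
      Curve.coords_map, ← List.map_append, e]
    by_cases h : a < l.H - 2
    · rw [if_pos h]
    · rw [if_neg h, show 2 + a = l.H + (2 + a - l.H) by omega, hm.rest, Nat.cast_zero]

end Layout

/-! ## Evaluating the answer -/

/-- Compare the fraction of the registers `0` and `1` with `440`. -/
def wordTest : Prog :=
  .seq (.instr (.op .div 2 0 1)) (.seq (.instr (.const 3 440))
    (.ite (.lt 2 3) (.instr (.const 0 1)) (.instr (.const 0 0))))

/-- The integer quotient is enough, since a fraction is below 440 iff its floor is; 440 lies midway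
between 400 and 480. -/
theorem runs_wordTest {w : ℕ} (hw : 440 < 2 ^ w) {s : State} (h0 : s.reg 0 < 2 ^ w) :
    Runs w wordTest s 4 fun s' => s'.reg 0 = if s.reg 0 / s.reg 1 < 440 then 1 else 0 := by
  have e1 : s.reg 0 / s.reg 1 % 2 ^ w = s.reg 0 / s.reg 1 :=
    Nat.mod_eq_of_lt ((Nat.div_le_self _ _).trans_lt h0)
  refine .seq (T₂ := 3) <| .instr <| .seq (T₂ := 2) <| .instr <| .ite (T := 1)
    (fun h => .instr ?_) (fun h => .instr ?_)
  all_goals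
    simp [Instr.exec, Test.holds, WordOp.eval, Nat.mod_eq_of_lt hw, e1] at h
  · rw [if_pos h]
    simpa [Instr.exec] using Nat.mod_eq_of_lt (show 1 < 2 ^ w by omega)
  · rw [if_neg (by omega)]
    simp [Instr.exec]

/-- Compare the square of real register `0` with `440`. -/
def realTest : Prog :=
  .seq (.instr (.realOp .mul 1 0 0)) (.seq (.instr (.const 3 440)) (.seq (.instr (.ofWord 2 3))
    (.ite (.realLt 1 2) (.instr (.const 0 1)) (.instr (.const 0 0)))))

open Classical in
theorem runs_realTest {w : ℕ} (hw : 440 < 2 ^ w) {s : State} :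
    Runs w realTest s 5 fun s' => s'.reg 0 = if s.realReg 0 ^ 2 < 440 then 1 else 0 := by
  refine .seq (T₂ := 4) <| .instr <| .seq (T₂ := 3) <| .instr <| .seq (T₂ := 2) <| .instr <|
    .ite (T := 1) (fun h => .instr ?_) (fun h => .instr ?_)
  all_goals
    simp [Instr.exec, Test.holds, RealOp.eval, Nat.mod_eq_of_lt hw, ← sq] at h
  · rw [if_pos h]
    simpa [Instr.exec] using Nat.mod_eq_of_lt (show 1 < 2 ^ w by omega)
  · rw [if_neg (not_lt.2 h)]
    simp [Instr.exec]

/-! ## Deciding satisfiability with a distance algorithm -/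

namespace Layout

/-- Needed for `K ≤ H`: the formula is no longer than the list of coordinates. -/
theorem two_mul_le (N : ℕ) : N ≤ 2 * 2 ^ ((N + 1) / 2) := by
  have := (Nat.lt_two_pow_self (n := (N + 1) / 2)).le
  omega

/-- The layout for a formula with `N` variables and `M` clauses. -/
def ofSize {N M w : ℕ} (hw : 100 * (2 ^ N * (N + M + 2)) < 2 ^ w) : Layout w where
  N := N
  M := M
  h := (N + 1) / 2
  L := 2 ^ ((N + 1) / 2)
  p := 2 ^ ((N + 1) / 2) * (M + 2)
  q := 2 ^ ((N + 1) / 2) * (M + 1) + 5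
  H := 2 + 2 * (2 ^ ((N + 1) / 2) * (M + 2) + (2 ^ ((N + 1) / 2) * (M + 1) + 5))
  K := 2 + 2 * (M * N)
  L_eq := rfl
  h_le := by omega
  p_eq := rfl
  q_eq := rfl
  H_eq := rfl
  K_eq := rfl
  K_le := by
    have := Nat.mul_le_mul_left M (two_mul_le N)
    ring_nf at this ⊢
    omega
  bound := by
    have h1 : 2 ^ ((N + 1) / 2) ≤ 2 ^ N := Nat.pow_le_pow_right (by norm_num) (by omega)
    have h2 : 2 ^ ((N + 1) / 2) * 2 ^ ((N + 1) / 2) ≤ 2 * 2 ^ N := by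
      rw [← pow_add, ← pow_succ']
      exact Nat.pow_le_pow_right (by norm_num) (by omega)
    have h3 := two_mul_le N
    have h4 : 1 ≤ 2 ^ N := Nat.one_le_two_pow
    generalize 2 ^ ((N + 1) / 2) = L at *
    generalize 2 ^ N = E at *
    have h5 : L * M ≤ E * M := Nat.mul_le_mul_right _ h1
    have h6 : M * N ≤ M * (2 * L) := Nat.mul_le_mul_left _ h3
    have h7 : N ≤ E * N := Nat.le_mul_of_pos_left _ h4
    have h8 : M ≤ E * M := Nat.le_mul_of_pos_left _ h4
    refine lt_of_le_of_lt ?_ hw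
    have h9 : M * (2 * L) = 2 * (L * M) := by ring
    rw [h9] at h6
    simp only [mul_add]
    omega

theorem p_add_q_ge {w : ℕ} (l : Layout w) : 5 ≤ l.p + l.q := by
  have := l.q_eq
  omega

theorem buildTime_le {w : ℕ} (l : Layout w) :
    l.buildTime + (l.H * 7 + 100) ≤ 1000 * ((l.p + l.q) * (l.N + 1)) := by
  have h1 := l.p_add_q_ge
  have h2 := l.K_le
  have h3 := l.H_eq
  have h4 : (l.p + l.q) * (l.N * 30 + 404) = 30 * ((l.p + l.q) * l.N) + 404 * (l.p + l.q) := by ring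
  rw [buildTime, h4, mul_add_one (l.p + l.q) l.N]
  omega

/-- The summand 32 bounds the coordinates and 2 comes from the word size condition of the distance
algorithm. -/
theorem max_le {N M w : ℕ} (hw : 100 * (2 ^ N * (N + M + 2)) < 2 ^ w) :
    max (ofSize hw).p (ofSize hw).q + 32 + 2 ≤ 2 ^ 5 * (2 ^ N * (N + M + 2)) := by
  have h1 : 2 ^ ((N + 1) / 2) ≤ 2 ^ N := Nat.pow_le_pow_right (by norm_num) (by omega)
  have h4 : 1 ≤ 2 ^ N := Nat.one_le_two_pow
  change max (2 ^ ((N + 1) / 2) * (M + 2)) (2 ^ ((N + 1) / 2) * (M + 1) + 5) + 32 + 2 ≤ _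
  generalize 2 ^ ((N + 1) / 2) = L at *
  generalize 2 ^ N = E at *
  have h5 : L * M ≤ E * M := Nat.mul_le_mul_right _ h1
  simp only [mul_add]
  omega

theorem le_of_mem_coords {w : ℕ} (l : Layout w) (φ : CNF l.N l.M) :
    ∀ x ∈ (l.leftInput φ).coords ++ (l.rightInput φ).coords, x ≤ 32 := by
  intro x hx
  rw [List.mem_append, Curve.coords, Curve.coords, List.mem_flatMap, List.mem_flatMap] at hx
  rcases hx with ⟨v, hv, hx⟩ | ⟨v, hv, hx⟩
  · obtain ⟨i, rfl⟩ := (List.mem_ofFn' _ _).1 hv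
    change x ∈ [(leftVertex _ _ i).1, (leftVertex _ _ i).2] at hx
    rcases leftVertex_mem (M := l.M) (A := φ.leftTable l.h) i with h | h | h <;>
      simp [h] at hx <;> omega
  · obtain ⟨i, rfl⟩ := (List.mem_ofFn' _ _).1 hv
    change x ∈ [(rightVertex _ _ _ i).1, (rightVertex _ _ _ i).2] at hx
    rcases rightVertex_mem (M := l.M) (L := l.L) (B := φ.rightTable l.h) i with
      h | h | h | h | h <;> simp [h] at hx <;> omega

end Layout

theorem State.bounded_init {w : ℕ} {words : List ℕ} {reals : List ℝ} (h : ∀ x ∈ words, x < 2 ^ w) :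
    (State.init words reals).Bounded w := by
  refine ⟨fun _ => show 0 < 2 ^ w by positivity, fun a => ?_⟩
  change words.getD a 0 < 2 ^ w
  rcases lt_or_ge a words.length with ha | ha
  · rw [List.getD_eq_getElem _ _ ha]
    exact h _ (List.getElem_mem ha)
  · rw [List.getD_eq_default _ _ ha]
    positivity

/-- The number of assignments of half of the variables. -/
def halfCount (N : ℕ) : ℕ := 2 ^ ((N + 1) / 2)

/-- The larger one of the numbers of vertices of the curves for a formula. -/
def curveSize (N M : ℕ) : ℕ := max (halfCount N * (M + 2)) (halfCount N * (M + 1) + 5)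

namespace Separates

variable {d : Curve Plane → Curve Plane → ℝ} (hd : Separates d) {w : ℕ} (l : Layout w)

theorem le_of_satisfiable (hd : Separates d) (hN : l.N ≤ 2 * l.h) {φ : CNF l.N l.M}
    (h : φ.Satisfiable) : d (l.leftInput φ).ofNat (l.rightInput φ).ofNat ^ 2 ≤ 400 := by
  refine hd.upper l.L_pos _ _ ?_
  rw [l.L_eq]
  exact (φ.satisfiable_iff l.h_le hN).1 h

theorem le_of_not_satisfiable (hd : Separates d) (hN : l.N ≤ 2 * l.h) {φ : CNF l.N l.M}
    (h : ¬ φ.Satisfiable) : 480 ≤ d (l.leftInput φ).ofNat (l.rightInput φ).ofNat ^ 2 := by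
  refine hd.lower l.L_pos _ _ ?_
  rw [l.L_eq]
  exact fun h' => h ((φ.satisfiable_iff l.h_le hN).2 h')

end Separates

/-- As `2 ≤ S`, both `2 ^ 5 * S ≤ S ^ 6` and `2 ^ 8 * S ≤ S ^ 9`. The first turns the word size
exponent `κ` of the distance algorithm into `6 * κ`, the second makes room for the layout and for
440. -/
theorem word_size_bounds {S κ w : ℕ} (hS : 2 ≤ S) (hw : S ^ (6 * κ + 9) ≤ 2 ^ w) :
    100 * S < 2 ^ w ∧ 440 < 2 ^ w ∧ ∀ n ≤ 2 ^ 5 * S, n ^ κ ≤ 2 ^ w := by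
  have h1 : 2 ^ 8 * S ≤ 2 ^ w := calc
    2 ^ 8 * S ≤ S ^ 8 * S := Nat.mul_le_mul_right _ (Nat.pow_le_pow_left hS 8)
    _ = S ^ 9 := (pow_succ S 8).symm
    _ ≤ S ^ (6 * κ + 9) := Nat.pow_le_pow_right (by omega) (by omega)
    _ ≤ 2 ^ w := hw
  refine ⟨by omega, by omega, fun n hn => ?_⟩
  calc
    n ^ κ ≤ (S ^ 6) ^ κ := Nat.pow_le_pow_left (hn.trans (by
      rw [pow_succ]
      exact Nat.mul_le_mul_right _ (Nat.pow_le_pow_left hS 5))) κ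
    _ = S ^ (6 * κ) := (pow_mul S 6 κ).symm
    _ ≤ S ^ (6 * κ + 9) := Nat.pow_le_pow_right (by omega) (by omega)
    _ ≤ 2 ^ w := hw

/-- The number of steps for deciding satisfiability with a distance algorithm of running
time `T`. -/
noncomputable def satTime (T : ℕ → ℝ) (N M : ℕ) : ℝ :=
  1000 * ((halfCount N * (M + 2) + (halfCount N * (M + 1) + 5)) * (N + 1)) + T (curveSize N M)

theorem Separates.exists_wordSatAlgorithm {d : Curve Plane → Curve Plane → ℝ} (hd : Separates d)
    {p : Prog} {T : ℕ → ℝ} (h : IsWordDistAlgorithm d p T) :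
    ∃ p', IsSatAlgorithm .word p' (satTime T) := by
  obtain ⟨hp, κ, hκ⟩ := h
  refine ⟨.seq (.seq buildProg (clearProg 32)) (.seq p wordTest),
    ⟨⟨Prog.IsLocal.isWord Layout.buildProg_isLocal, Prog.IsLocal.isWord (n := 32) (by decide)⟩, hp,
      Prog.IsLocal.isWord (n := 32) (by decide)⟩, 6 * κ + 9, fun N M φ w hw => ?_⟩
  have hS : 2 ≤ 2 ^ N * (N + M + 2) :=
    (show 2 ≤ N + M + 2 by omega).trans (Nat.le_mul_of_pos_left _ (by positivity))
  obtain ⟨hw1, hw2, hw3⟩ := word_size_bounds hS hw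
  let l : Layout w := .ofSize hw1
  have hN : l.N ≤ 2 * l.h := show N ≤ 2 * ((N + 1) / 2) by omega
  obtain ⟨t₁, s₁, e₁, ht₁, rfl⟩ := l.runs_wordInput rfl φ
  have hU := l.le_of_mem_coords φ
  have hmax := hw3 _ (Layout.max_le hw1)
  obtain ⟨t₂, s₂, e₂, ht₂, hne, hs₂⟩ := hκ (l.leftInput φ) (l.rightInput φ) 32 w hU hmax
  have hb := l.bound
  have hH := l.H_eq
  have hB : s₂.Bounded w := e₂.bounded (State.bounded_init fun x hx => by
    rw [List.append_assoc, List.mem_append] at hx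
    rcases hx with hx | hx
    · have hp' := l.size_leftInput φ
      have hq' := l.size_rightInput φ
      simp only [List.mem_cons, List.not_mem_nil, or_false] at hx
      omega
    · have := hU x hx
      omega)
  obtain ⟨t₃, s₃, e₃, ht₃, hs₃⟩ := runs_wordTest hw2 (hB.1 0)
  have hpos : (0 : ℝ) < s₂.reg 1 := by exact_mod_cast Nat.pos_of_ne_zero hne
  refine ⟨_, s₃, .seq e₁ (.seq e₂ e₃), ?_, fun hφ => ?_, fun hφ => ?_⟩
  · have h1 := l.buildTime_le
    have h2 : ((t₁ + t₃ : ℕ) : ℝ) ≤ ((1000 * ((l.p + l.q) * (l.N + 1)) : ℕ) : ℝ) := by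
      exact_mod_cast (by omega : t₁ + t₃ ≤ 1000 * ((l.p + l.q) * (l.N + 1)))
    have h3 : ((1000 * ((l.p + l.q) * (l.N + 1)) : ℕ) : ℝ) = 1000 * ((halfCount N * (M + 2) +
        (halfCount N * (M + 1) + 5)) * (N + 1)) := by
      change ((1000 * ((halfCount N * (M + 2) + (halfCount N * (M + 1) + 5)) *
        (N + 1)) : ℕ) : ℝ) = _
      push_cast
      rfl
    have h4 : (t₂ : ℝ) ≤ T (curveSize N M) := ht₂
    rw [satTime, ← h3]
    push_cast at h2 ⊢
    linarith
  · rw [hs₃, if_pos]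
    have := hd.le_of_satisfiable l hN hφ
    rw [← hs₂, div_le_iff₀ hpos] at this
    rw [Nat.div_lt_iff_lt_mul (Nat.pos_of_ne_zero hne)]
    have h5 : s₂.reg 0 ≤ 400 * s₂.reg 1 := by exact_mod_cast this
    omega
  · rw [hs₃, if_neg]
    have := hd.le_of_not_satisfiable l hN hφ
    rw [← hs₂, le_div_iff₀ hpos] at this
    rw [Nat.div_lt_iff_lt_mul (Nat.pos_of_ne_zero hne)]
    have h5 : 480 * s₂.reg 1 ≤ s₂.reg 0 := by exact_mod_cast this
    omega

theorem Separates.exists_realSatAlgorithm {d : Curve Plane → Curve Plane → ℝ} (hd : Separates d)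
    {p : Prog} {T : ℕ → ℝ} (h : IsRealDistAlgorithm d p T) :
    ∃ p', IsSatAlgorithm .real p' (satTime T) := by
  obtain ⟨-, κ, hκ⟩ := h
  refine ⟨.seq (.seq buildProg (.seq transferProg (.seq (clearProg 32) (.instr (.ofWord 0 0)))))
    (.seq p realTest), trivial, 6 * κ + 9, fun N M φ w hw => ?_⟩
  have hS : 2 ≤ 2 ^ N * (N + M + 2) :=
    (show 2 ≤ N + M + 2 by omega).trans (Nat.le_mul_of_pos_left _ (by positivity))
  obtain ⟨hw1, hw2, hw3⟩ := word_size_bounds hS hw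
  let l : Layout w := .ofSize hw1
  have hN : l.N ≤ 2 * l.h := show N ≤ 2 * ((N + 1) / 2) by omega
  obtain ⟨t₁, s₁, e₁, ht₁, rfl⟩ := l.runs_realInput rfl φ
  have hmax := hw3 (max l.p l.q + 2) ((by omega : _ ≤ max l.p l.q + 32 + 2).trans
    (Layout.max_le hw1))
  obtain ⟨t₂, s₂, e₂, ht₂, hs₂⟩ := hκ (l.realLeftInput φ) (l.realRightInput φ) w hmax
  obtain ⟨t₃, s₃, e₃, ht₃, hs₃⟩ := runs_realTest hw2 (s := s₂)
  -- Casting the coordinates and then forming the plane curve gives, by definition, the curve with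
  -- natural coordinates.
  replace hs₂ : s₂.realReg 0 = d (l.leftInput φ).ofNat (l.rightInput φ).ofNat := hs₂
  refine ⟨_, s₃, .seq e₁ (.seq e₂ e₃), ?_, fun hφ => ?_, fun hφ => ?_⟩
  · have h1 := l.buildTime_le
    have h2 : ((t₁ + t₃ : ℕ) : ℝ) ≤ ((1000 * ((l.p + l.q) * (l.N + 1)) : ℕ) : ℝ) := by
      exact_mod_cast (by omega : t₁ + t₃ ≤ 1000 * ((l.p + l.q) * (l.N + 1)))
    have h3 : ((1000 * ((l.p + l.q) * (l.N + 1)) : ℕ) : ℝ) = 1000 * ((halfCount N * (M + 2) +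
        (halfCount N * (M + 1) + 5)) * (N + 1)) := by
      change ((1000 * ((halfCount N * (M + 2) + (halfCount N * (M + 1) + 5)) *
        (N + 1)) : ℕ) : ℝ) = _
      push_cast
      rfl
    have h4 : (t₂ : ℝ) ≤ T (curveSize N M) := ht₂
    rw [satTime, ← h3]
    push_cast at h2 ⊢
    linarith
  · rw [hs₃, if_pos]
    rw [hs₂]
    have := hd.le_of_satisfiable l hN hφ
    linarith
  · rw [hs₃, if_neg]
    rw [hs₂]
    have := hd.le_of_not_satisfiable l hN hφ
    linarith

/-! ## Running times -/

/-- The curves have at most `6 * R * L` vertices, and `L ^ (2 - δ) ≤ β ^ (N + 1) ≤ 2 * β ^ N`. By `δ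
≤ 1` also `L ≤ L ^ (2 - δ)`, which absorbs the building time. The constants are 24000 = 1000 * 12 *
2 and 72 = 6 ^ 2 * 2. -/
theorem satTime_le {δ : ℝ} (h0 : 0 < δ) (h1 : δ ≤ 1) (C : ℝ) (N M : ℕ) :
    satTime (fun n => C * (n : ℝ) ^ (2 - δ)) N M ≤
      (24000 + 72 * |C|) * ((2 : ℝ) ^ (1 - δ / 2)) ^ N * ((N : ℝ) + M + 1) ^ 2 := by
  set β : ℝ := (2 : ℝ) ^ (1 - δ / 2) with hβ
  set R : ℝ := (N : ℝ) + M + 1 with hR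
  set L : ℝ := (halfCount N : ℝ) with hL
  have hN0 : (0 : ℝ) ≤ N := Nat.cast_nonneg N
  have hM0 : (0 : ℝ) ≤ M := Nat.cast_nonneg M
  have hR1 : 1 ≤ R := by rw [hR]; linarith
  have hL1 : 1 ≤ L := by
    rw [hL]
    exact_mod_cast Nat.one_le_two_pow
  have hβ0 : 0 < β := by positivity
  have hβ2 : β ≤ 2 := by
    calc β ≤ (2 : ℝ) ^ (1 : ℝ) := Real.rpow_le_rpow_of_exponent_le (by norm_num) (by linarith)
      _ = 2 := Real.rpow_one 2
  have hLβ : L ^ (2 - δ) ≤ 2 * β ^ N := by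
    have e : L = (2 : ℝ) ^ (((N + 1) / 2 : ℕ) : ℝ) := by
      rw [hL, halfCount, Real.rpow_natCast]
      push_cast
      rfl
    have h2 : (((N + 1) / 2 : ℕ) : ℝ) ≤ ((N : ℝ) + 1) / 2 := by
      have := Nat.cast_div_le (α := ℝ) (m := N + 1) (n := 2)
      push_cast at this
      exact this
    calc L ^ (2 - δ) = (2 : ℝ) ^ ((((N + 1) / 2 : ℕ) : ℝ) * (2 - δ)) := by
          rw [e, ← Real.rpow_mul (by norm_num)]
      _ ≤ (2 : ℝ) ^ ((1 - δ / 2) * ((N + 1 : ℕ) : ℝ)) := by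
          refine Real.rpow_le_rpow_of_exponent_le (by norm_num) ?_
          push_cast
          nlinarith
      _ = β ^ (N + 1) := by rw [Real.rpow_mul (by norm_num), Real.rpow_natCast]
      _ = β * β ^ N := pow_succ' β N
      _ ≤ 2 * β ^ N := by gcongr
  have hLL : L ≤ L ^ (2 - δ) := by
    calc L = L ^ (1 : ℝ) := (Real.rpow_one L).symm
      _ ≤ L ^ (2 - δ) := Real.rpow_le_rpow_of_exponent_le hL1 (by linarith)
  have hpR : L * (M + 2) ≤ 6 * R * L := by
    rw [hR]
    nlinarith
  have hqR : L * (M + 1) + 5 ≤ 6 * R * L := by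
    rw [hR]
    nlinarith
  have hbuild : 1000 * ((L * (M + 2) + (L * (M + 1) + 5)) * (N + 1)) ≤
      24000 * β ^ N * R ^ 2 := by
    have h3 : (N : ℝ) + 1 ≤ R := by rw [hR]; linarith
    calc 1000 * ((L * (M + 2) + (L * (M + 1) + 5)) * (N + 1))
        ≤ 1000 * ((6 * R * L + 6 * R * L) * R) := by gcongr
      _ = 12000 * L * R ^ 2 := by ring
      _ ≤ 12000 * (2 * β ^ N) * R ^ 2 := by
          gcongr
          exact hLL.trans hLβ
      _ = 24000 * β ^ N * R ^ 2 := by ring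
  have hsize : (curveSize N M : ℝ) ≤ 6 * R * L := by
    rw [curveSize, Nat.cast_max]
    push_cast
    exact max_le hpR hqR
  have hrun : C * (curveSize N M : ℝ) ^ (2 - δ) ≤ 72 * |C| * β ^ N * R ^ 2 := by
    calc C * (curveSize N M : ℝ) ^ (2 - δ) ≤ |C| * (6 * R * L) ^ (2 - δ) := by
          gcongr
          · exact le_abs_self C
          · linarith
      _ = |C| * ((6 * R) ^ (2 - δ) * L ^ (2 - δ)) := by
          rw [Real.mul_rpow (by positivity) (by positivity)]
      _ ≤ |C| * ((6 * R) ^ (2 : ℝ) * (2 * β ^ N)) := by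
          gcongr
          · linarith
          · linarith
      _ = 72 * |C| * β ^ N * R ^ 2 := by
          rw [Real.rpow_two]
          ring
  calc satTime (fun n => C * (n : ℝ) ^ (2 - δ)) N M
      ≤ 24000 * β ^ N * R ^ 2 + 72 * |C| * β ^ N * R ^ 2 := add_le_add hbuild hrun
    _ = (24000 + 72 * |C|) * β ^ N * R ^ 2 := by ring

theorem curveSize_pos (N M : ℕ) : 1 ≤ curveSize N M :=
  le_max_of_le_right (by omega)

theorem not_exists_distAlgorithm {μ : Model} (hSETH : SETHPrime μ)
    {d : Curve Plane → Curve Plane → ℝ} (hd : Separates d) {δ : ℝ} (hδ : 0 < δ) :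
    ¬ ∃ (p : Prog) (C : ℝ), IsDistAlgorithm μ d p fun n => C * (n : ℝ) ^ (2 - δ) := by
  rintro ⟨p, C, h⟩
  obtain ⟨p', hp'⟩ : ∃ p', IsSatAlgorithm μ p' (satTime fun n => C * (n : ℝ) ^ (2 - δ)) := by
    cases μ
    · exact hd.exists_wordSatAlgorithm h
    · exact hd.exists_realSatAlgorithm h
  -- Replacing `δ` by `min δ 1` and `C` by `|C|` only increases the time bound, because the curves
  -- have at least one vertex.
  have h1 : 0 < min δ 1 := lt_min hδ one_pos
  have h2 : (2 : ℝ) ^ (1 - min δ 1 / 2) < 2 := by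
    calc (2 : ℝ) ^ (1 - min δ 1 / 2) < (2 : ℝ) ^ (1 : ℝ) :=
          Real.rpow_lt_rpow_of_exponent_lt (by norm_num) (by linarith)
      _ = 2 := Real.rpow_one 2
  -- The saving is chosen so that the base of the exponential is exactly the `β` of `satTime_le`;
  -- the doubled absolute value arises as that lemma is applied to `|C|`.
  refine hSETH ⟨2 - (2 : ℝ) ^ (1 - min δ 1 / 2), by linarith, p', 24000 + 72 * |(|C|)|, 2,
    hp'.1, ?_⟩
  obtain ⟨κ, hκ⟩ := hp'.2
  refine ⟨κ, fun N M φ w hw => ?_⟩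
  obtain ⟨t, s, h3, h4, h5⟩ := hκ N M φ w hw
  refine ⟨t, s, h3, h4.trans ?_, h5⟩
  rw [sub_sub_cancel]
  refine le_trans ?_ (satTime_le h1 (min_le_right δ 1) |C| N M)
  have h6 : (1 : ℝ) ≤ curveSize N M := by exact_mod_cast curveSize_pos N M
  refine add_le_add le_rfl ?_
  exact mul_le_mul (le_abs_self C) (Real.rpow_le_rpow_of_exponent_le h6
    (by linarith [min_le_left δ 1])) (by positivity) (abs_nonneg C)

theorem theorem1 (μ : Model) (hSETH : SETHPrime μ) (δ : ℝ) (hδ : 0 < δ) :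
    (¬ ∃ (p : Prog) (C : ℝ),
      IsDistAlgorithm μ frechetDist p fun n => C * (n : ℝ) ^ (2 - δ)) ∧
    (¬ ∃ (p : Prog) (C : ℝ),
      IsDistAlgorithm μ discreteFrechetDist p fun n => C * (n : ℝ) ^ (2 - δ)) := by
  exact ⟨not_exists_distAlgorithm hSETH separates_frechetDist hδ,
    not_exists_distAlgorithm hSETH separates_discreteFrechetDist hδ⟩
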